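/- **Theorem 5.1.** For $\mu>0$ let $H^{\mu}(\mathbb R)$ be the space of real-valued $w\in L^2(\mathbb R)$ with $|\omega|^{\mu}\mathcal F(w)\in L^2(\mathbb R)$, with norm $\|w\|_{H^\mu}=\bigl(\|w\|_{L^2(\mathbb R)}^2+\||\omega|^{\mu}\mathcal F(w)\|_{L^2(\mathbb R)}^2\bigr)^{1/2}$, where $\mathcal F$ is the unitary Fourier transform in the angular frequency $\omega$. Let $H^{\mu}_0(0,1)$ be the completion of $C_0^\infty(0,1)$ in this norm, and let $H^{-1}(0,1)$ be the dual of $H^1_0(0,1)$ with the dual norm. For $0<\beta<1$ and $0\le\theta\le1$ put $$I^\beta_\theta w(x)=\frac{\theta}{\Gamma(\beta)}\int_0^x\frac{w(s)}{(x-s)^{1-\beta}}\,ds+\frac{1-\theta}{\Gamma(\beta)}\int_x^1\frac{w(s)}{(s-x)^{1-\beta}}\,ds,\qquad x\in(0,1),$$ and $A(w,v)=(D I^\beta_\theta w, Dv)_{L^2(0,1)}$, where $D$ is the weak derivative on $(0,1)$. Let $0<\beta<1/2$. There are constants $\kappa=\kappa(\beta)>0$ and $C=C(\beta)$ such that for every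 $0\le\theta\le1$ the following hold. 1. $I^\beta_\theta w\in H^1(0,1)$ for all $w\in H^{1-\beta}_0(0,1)$, and $A$ is a bounded bilinear form on $H^{1-\beta}_0(0,1)\times H^1_0(0,1)$, with $|A(w,v)|\le C\|w\|_{H^{1-\beta}}\|v\|_{H^1}$. 2. $A$ is weakly coercive: $$\inf_{w\in H^{1-\beta}_0(0,1)\setminus\{0\}}\ \sup_{v\in H^1_0(0,1)\setminus\{0\}}\frac{A(w,v)}{\|w\|_{H^{1-\beta}}\|v\|_{H^1}}\ge\kappa,\qquad \sup_{w\in H^{1-\beta}_0(0,1)}A(w,v)>0\quad\text{for all } v\in H^1_0(0,1)\setminus\{0\}.$$ 3. For every $f\in H^{-1}(0,1)$ there is a unique $u\in H^{1-\beta}_0(0,1)$ with $A(u,v)=\langle f,v\rangle$ for all $v\in H^1_0(0,1)$, and it satisfies $\|u\|_{H^{1-\beta}}\le\kappa^{-1}\|f\|_{H^{-1}}$. -/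

import Mathlib

open MeasureTheory Set
open scoped FourierTransform ContDiff ENNReal

noncomputable section

namespace FracPG

/-- The complexification of a real-valued `L²(ℝ)` function. -/
def complexify : Lp ℝ 2 (volume : Measure ℝ) →L[ℝ] Lp ℂ 2 (volume : Measure ℝ) :=
  Complex.ofRealCLM.compLpL 2 volume

/-- The (Plancherel) Fourier transform of a real-valued `L²(ℝ)` function, in the normalization
`𝓕 w ξ = ∫ x, exp (-2 π i x ξ) w x`. The angular frequency is `ω = 2 π ξ`. -/
def fourierL2 (w : Lp ℝ 2 (volume : Measure ℝ)) : Lp ℂ 2 (volume : Measure ℝ) :=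
  𝓕 (complexify w)

/-- The function `ξ ↦ |ω| ^ μ * 𝓕 w ξ` with `ω = 2 π ξ`, whose `L²` norm is the seminorm of
`H^μ(ℝ)`. -/
def weightedFourier (μ : ℝ) (w : Lp ℝ 2 (volume : Measure ℝ)) : ℝ → ℂ :=
  fun ξ => ((|2 * Real.pi * ξ| ^ μ : ℝ) : ℂ) * fourierL2 w ξ

theorem fourierL2_add (w z : Lp ℝ 2 (volume : Measure ℝ)) :
    fourierL2 (w + z) = fourierL2 w + fourierL2 z := by
  simp [fourierL2, FourierTransform.fourier_add]

theorem fourierL2_smul (c : ℝ) (w : Lp ℝ 2 (volume : Measure ℝ)) :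
    fourierL2 (c • w) = (c : ℂ) • fourierL2 w := by
  have h : complexify (c • w) = (c : ℂ) • complexify w := by
    rw [map_smul]; rfl
  rw [fourierL2, h, FourierTransform.fourier_smul]; rfl

theorem weightedFourier_add (μ : ℝ) (w z : Lp ℝ 2 (volume : Measure ℝ)) :
    weightedFourier μ (w + z) =ᵐ[volume] weightedFourier μ w + weightedFourier μ z := by
  unfold weightedFourier
  rw [fourierL2_add]
  filter_upwards [Lp.coeFn_add (fourierL2 w) (fourierL2 z)] with ξ h
  simp only [Pi.add_apply] at h ⊢
  rw [h, mul_add]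

theorem weightedFourier_smul (μ c : ℝ) (w : Lp ℝ 2 (volume : Measure ℝ)) :
    weightedFourier μ (c • w) =ᵐ[volume] c • weightedFourier μ w := by
  unfold weightedFourier
  rw [fourierL2_smul]
  filter_upwards [Lp.coeFn_smul (c : ℂ) (fourierL2 w)] with ξ h
  simp only [Pi.smul_apply, smul_eq_mul, Complex.real_smul] at h ⊢
  rw [h, mul_left_comm]

/-- The set of (real-valued) functions of `H^μ(ℝ)`: those `w ∈ L²(ℝ)` with
`|ω| ^ μ * 𝓕 w ∈ L²(ℝ)`. -/
def sobolevSubmodule (μ : ℝ) : Submodule ℝ (Lp ℝ 2 (volume : Measure ℝ)) where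
  carrier := {w | MemLp (weightedFourier μ w) 2 volume}
  zero_mem' := by
    have h := weightedFourier_smul μ 0 0
    simp only [zero_smul] at h
    exact (memLp_congr_ae h).2 MemLp.zero
  add_mem' {w z} hw hz := (memLp_congr_ae (weightedFourier_add μ w z)).2 (MemLp.add hw hz)
  smul_mem' c w hw := (memLp_congr_ae (weightedFourier_smul μ c w)).2 (MemLp.const_smul hw c)

/-- The fractional Sobolev space `H^μ(ℝ)` of real-valued functions. It carries the norm
`(‖w‖² + ‖|ω| ^ μ * 𝓕 w‖²) ^ (1/2)` (norms of `L²(ℝ)`), not the norm of `L²(ℝ)`. -/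
def SobolevR (μ : ℝ) : Type := ↥(sobolevSubmodule μ)

namespace SobolevR

variable {μ : ℝ}

instance : AddCommGroup (SobolevR μ) := inferInstanceAs (AddCommGroup ↥(sobolevSubmodule μ))

instance : Module ℝ (SobolevR μ) := inferInstanceAs (Module ℝ ↥(sobolevSubmodule μ))

/-- The inclusion `H^μ(ℝ) ⊆ L²(ℝ)`. -/
def toL2 : SobolevR μ →ₗ[ℝ] Lp ℝ 2 (volume : Measure ℝ) := (sobolevSubmodule μ).subtype

theorem toL2_injective : Function.Injective (toL2 (μ := μ)) := Subtype.val_injective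

theorem memLp_weighted (w : SobolevR μ) : MemLp (weightedFourier μ (toL2 w)) 2 volume := w.2

/-- `|ω| ^ μ * 𝓕 w` as an element of `L²(ℝ)`. -/
def weighted : SobolevR μ →ₗ[ℝ] Lp ℂ 2 (volume : Measure ℝ) where
  toFun w := MemLp.toLp (weightedFourier μ (toL2 w)) (memLp_weighted w)
  map_add' w z := by
    refine Eq.trans ?_ (MemLp.toLp_add (memLp_weighted w) (memLp_weighted z))
    exact MemLp.toLp_congr _ _ (by rw [map_add]; exact weightedFourier_add μ _ _)
  map_smul' c w := by
    refine Eq.trans ?_ (MemLp.toLp_const_smul c (memLp_weighted w))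
    exact MemLp.toLp_congr _ _ (by rw [map_smul]; exact weightedFourier_smul μ c _)

/-- `w ↦ (w, |ω| ^ μ * 𝓕 w)`, which induces the norm of `H^μ(ℝ)`. -/
def graphMap : SobolevR μ →ₗ[ℝ]
    WithLp 2 (Lp ℝ 2 (volume : Measure ℝ) × Lp ℂ 2 (volume : Measure ℝ)) :=
  (WithLp.linearEquiv 2 ℝ
    (Lp ℝ 2 (volume : Measure ℝ) × Lp ℂ 2 (volume : Measure ℝ))).symm.toLinearMap ∘ₗ
      (toL2.prod weighted)

theorem graphMap_injective : Function.Injective (graphMap (μ := μ)) := by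
  intro w z h
  have h' := (WithLp.linearEquiv 2 ℝ
    (Lp ℝ 2 (volume : Measure ℝ) × Lp ℂ 2 (volume : Measure ℝ))).symm.injective h
  exact toL2_injective (congrArg Prod.fst h')

instance : NormedAddCommGroup (SobolevR μ) :=
  NormedAddCommGroup.induced (SobolevR μ)
    (WithLp 2 (Lp ℝ 2 (volume : Measure ℝ) × Lp ℂ 2 (volume : Measure ℝ)))
    graphMap graphMap_injective

instance : NormedSpace ℝ (SobolevR μ) :=
  NormedSpace.induced ℝ (SobolevR μ)
    (WithLp 2 (Lp ℝ 2 (volume : Measure ℝ) × Lp ℂ 2 (volume : Measure ℝ))) graphMap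

theorem norm_sq_eq (w : SobolevR μ) : ‖w‖ ^ 2 = ‖toL2 w‖ ^ 2 + ‖weighted w‖ ^ 2 :=
  WithLp.prod_norm_sq_eq_of_L2 (graphMap w)

end SobolevR

/-- `φ ∈ C_0^∞(0,1)`: smooth, with compact support contained in the open interval `(0,1)`. -/
structure IsTestFunction (φ : ℝ → ℝ) : Prop where
  smooth : ContDiff ℝ ∞ φ
  hasCompactSupport : HasCompactSupport φ
  tsupport_subset : tsupport φ ⊆ Ioo 0 1

theorem IsTestFunction.zero : IsTestFunction 0 :=
  ⟨contDiff_const, HasCompactSupport.zero, by simp⟩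

theorem IsTestFunction.add {φ ψ : ℝ → ℝ} (hφ : IsTestFunction φ) (hψ : IsTestFunction ψ) :
    IsTestFunction (φ + ψ) :=
  ⟨hφ.smooth.add hψ.smooth, hφ.hasCompactSupport.add hψ.hasCompactSupport,
    (tsupport_add φ ψ).trans (union_subset hφ.tsupport_subset hψ.tsupport_subset)⟩

theorem IsTestFunction.smul (c : ℝ) {φ : ℝ → ℝ} (hφ : IsTestFunction φ) :
    IsTestFunction (c • φ) :=
  ⟨contDiff_const.smul hφ.smooth, hφ.hasCompactSupport.smul_left (f := fun _ => c),
    (tsupport_smul_subset_right (fun _ => c) φ).trans hφ.tsupport_subset⟩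

/-- `C_0^∞(0,1)` as a subspace of `H^μ(ℝ)`. -/
def testSubmodule (μ : ℝ) : Submodule ℝ (SobolevR μ) where
  carrier := {w | ∃ φ, IsTestFunction φ ∧ SobolevR.toL2 w =ᵐ[volume] φ}
  zero_mem' := ⟨0, .zero, by rw [map_zero]; exact Lp.coeFn_zero _ _ _⟩
  add_mem' {w z} := by
    rintro ⟨φ, hφ, hw⟩ ⟨ψ, hψ, hz⟩
    refine ⟨φ + ψ, hφ.add hψ, ?_⟩
    rw [map_add]
    exact (Lp.coeFn_add _ _).trans (hw.add hz)
  smul_mem' c w := by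
    rintro ⟨φ, hφ, hw⟩
    refine ⟨c • φ, hφ.smul c, ?_⟩
    rw [map_smul]
    exact (Lp.coeFn_smul _ _).trans (hw.const_smul c)

/-- `H^μ_0(0,1)`: the completion of `C_0^∞(0,1)` in the norm of `H^μ(ℝ)`, i.e. its closure in
the space `H^μ(ℝ)`. -/
abbrev SobolevZero (μ : ℝ) : Type := ↥(testSubmodule μ).topologicalClosure

/-- The function `ℝ → ℝ` (vanishing a.e. outside `(0,1)`) given by an element of `H^μ_0(0,1)`. -/
def SobolevZero.fn {μ : ℝ} (w : SobolevZero μ) : ℝ → ℝ := SobolevR.toL2 (w : SobolevR μ)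

/-- `g` is the weak derivative of `u` on `(0,1)`. -/
def HasWeakDeriv (u g : ℝ → ℝ) : Prop :=
  LocallyIntegrableOn u (Ioo 0 1) ∧ LocallyIntegrableOn g (Ioo 0 1) ∧
    ∀ φ, IsTestFunction φ →
      ∫ x in Ioo (0 : ℝ) 1, u x * deriv φ x = -∫ x in Ioo (0 : ℝ) 1, g x * φ x

/-- `u ∈ H^1(0,1)`: `u` and its weak derivative are in `L²(0,1)`. -/
def MemSobolevOne (u : ℝ → ℝ) : Prop :=
  MemLp u 2 (volume.restrict (Ioo 0 1)) ∧
    ∃ g, HasWeakDeriv u g ∧ MemLp g 2 (volume.restrict (Ioo 0 1))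

open Classical in
/-- `D u`, the weak derivative of `u` on `(0,1)` (which is unique almost everywhere), with the
default value `0` if there is none. -/
def weakDeriv (u : ℝ → ℝ) : ℝ → ℝ :=
  if h : ∃ g, HasWeakDeriv u g then h.choose else 0

/-- The left fractional integral of order `σ` on `(0,1)`. -/
def leftFracInt (σ : ℝ) (w : ℝ → ℝ) (x : ℝ) : ℝ :=
  1 / Real.Gamma σ * ∫ s in Ioo 0 x, w s / (x - s) ^ (1 - σ)

/-- The right fractional integral of order `σ` on `(0,1)`. -/
def rightFracInt (σ : ℝ) (w : ℝ → ℝ) (x : ℝ) : ℝ :=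
  1 / Real.Gamma σ * ∫ s in Ioo x 1, w s / (s - x) ^ (1 - σ)

/-- The two-sided fractional integral operator `I^β_θ`. -/
def twoSidedFracInt (β θ : ℝ) (w : ℝ → ℝ) (x : ℝ) : ℝ :=
  θ * leftFracInt β w x + (1 - θ) * rightFracInt β w x

/-- The Petrov-Galerkin form `A(w,v) = (D I^β_θ w, D v)_{L²(0,1)}` (diffusivity `K = 1`). -/
def pgForm (β θ : ℝ) (w : SobolevZero (1 - β)) (v : SobolevZero 1) : ℝ :=
  ∫ x in Ioo (0 : ℝ) 1, weakDeriv (twoSidedFracInt β θ w.fn) x * weakDeriv v.fn x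

/-- `H^{-1}(0,1)`: the dual space of `H^1_0(0,1)`, with the dual norm. -/
abbrev SobolevMinusOne : Type := StrongDual ℝ (SobolevZero 1)

/-- `u` solves the Petrov-Galerkin problem with right-hand side `f`. -/
def IsPGSolution (β θ : ℝ) (f : SobolevMinusOne) (u : SobolevZero (1 - β)) : Prop :=
  ∀ v : SobolevZero 1, pgForm β θ u v = f v

end FracPG

end

/-! The form is `A(w,v) = (G w, D v)` in `L²(0,1)`, where `G w = θ g + (1 - θ) k` and `g`, `k` are
the derivatives of the left and right fractional integrals of `w`. By the Poincaré inequality `D`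
has closed range on `H^1_0(0,1)`, and by du Bois-Reymond the orthogonal complement of that range is
the line of constants. The inf-sup condition therefore says that `G w` stays at distance at least a
multiple of `‖w‖` from the constants, uniformly in `θ`.

Two facts give this. The first is an angle estimate. The left kernel has Fourier symbol `(iω)^(-β)`
and the right one its conjugate, so `‖g‖²` and `‖k‖²` are at most the squared seminorm `N` of order
`1 - β`. For a test function `w`, `g` vanishes left of the interval and `k` right of it, so `∫ g k`
may be taken over the line and is at least `cos(πβ) N`, which is positive for `β < 1/2`. Hence `(G
w, g + k) = θ‖g‖² + (1 - θ)‖k‖² + (g, k) ≥ cos(πβ) N`. Kernels damped by `exp(-εt)` keep every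
function integrable, and `ε → 0` at the end (`integral_left_sq_le`, `integral_right_sq_le`,
`seminormSq_le_integral_left_mul_right`).

The second is a positive weight `h = x^(p-1) (1-x)^(q-1)`, `p + q = 2 - β`, orthogonal to every `G
w` (`exists_betaWeight_annihilates`): for a suitable `p` the transposed two-sided fractional
integral of `h` is constant. Its exponents are at least `-β > -1/2`, so `h` is square integrable
with a bound independent of `θ`. Subtracting a multiple of `h` from `g + k` makes it orthogonal to
constants without changing its product with `G w`, and Cauchy-Schwarz gives the distance estimate
(`le_norm_combination_sub_smul`, `infSup_test`). Density of test functions carries it to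
`H^{1-β}_0(0,1)`.

For nondegeneracy in `v`, the diagonal values `A(φ,φ)` control `‖φ‖²` in `L²`. If `A(w,v) ≤ 0` for
all `w`, then `A(φ,φ) ≤ A(φ, φ - v)`, which tends to zero as `φ → v`, and so `v = 0`. Existence
follows as in the Babuška-Lax-Milgram theorem; the inf-sup bound gives uniqueness and stability. -/

noncomputable section

namespace FracPG

open Filter Topology Real

/-! ### Fourier transforms of damped Riesz kernels -/

/-- The exponentially damped causal Riesz kernel `t ↦ t ^ (β - 1) exp (-ε t) / Γ(β)`, `t > 0`. -/
def dampedKernel (β ε : ℝ) : ℝ → ℝ :=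
  (Ioi (0 : ℝ)).indicator fun t => t ^ (β - 1) * exp (-(ε * t)) / Gamma β

theorem integrableOn_rpow_mul_exp {s ε : ℝ} (hs : -1 < s) (hε : 0 < ε) :
    IntegrableOn (fun t : ℝ => t ^ s * exp (-(ε * t))) (Ioi 0) := by
  simpa [neg_mul] using integrableOn_rpow_mul_exp_neg_mul_rpow (s := s) (p := 1) hs one_pos hε

theorem integrable_dampedKernel {β ε : ℝ} (hβ : 0 < β) (hε : 0 < ε) :
    Integrable (dampedKernel β ε) := by
  rw [dampedKernel, integrable_indicator_iff measurableSet_Ioi]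
  exact (integrableOn_rpow_mul_exp (by linarith) hε).div_const _

/-- The Laplace transform of a real power at `ε + 2 π i ξ`. -/
def laplaceRpow (s ε ξ : ℝ) : ℂ :=
  ∫ t in Ioi (0 : ℝ), ((t ^ s * exp (-(ε * t)) : ℝ) : ℂ) * Complex.exp (-(2 * π * Complex.I * ξ * t))

theorem norm_laplace_osc (ξ t : ℝ) : ‖Complex.exp (-(2 * π * Complex.I * ξ * t))‖ = 1 := by
  rw [show -(2 * π * Complex.I * ξ * t) = ((-(2 * π * ξ * t) : ℝ) : ℂ) * Complex.I by
    push_cast; ring]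
  exact Complex.norm_exp_ofReal_mul_I _

theorem integrableOn_laplace {s ε : ℝ} (hs : -1 < s) (hε : 0 < ε) (ξ : ℝ) :
    IntegrableOn (fun t : ℝ => ((t ^ s * exp (-(ε * t)) : ℝ) : ℂ) *
      Complex.exp (-(2 * π * Complex.I * ξ * t))) (Ioi 0) := by
  refine Integrable.mono' (integrableOn_rpow_mul_exp hs hε).norm ?_ ?_
  · refine (Complex.continuous_ofReal.comp_aestronglyMeasurable
      (integrableOn_rpow_mul_exp hs hε).aestronglyMeasurable).mul ?_
    exact Continuous.aestronglyMeasurable (by fun_prop)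
  · refine Eventually.of_forall fun t => ?_
    rw [norm_mul, norm_laplace_osc, mul_one, Complex.norm_real]

theorem hasDerivAt_laplaceRpow {s ε : ℝ} (hs : -1 < s) (hε : 0 < ε) (ξ : ℝ) :
    HasDerivAt (laplaceRpow s ε) (-(2 * π * Complex.I) * laplaceRpow (s + 1) ε ξ) ξ := by
  have key := hasDerivAt_integral_of_dominated_loc_of_deriv_le
    (μ := volume.restrict (Ioi (0 : ℝ))) (s := univ) (x₀ := ξ)
    (F := fun (ξ t : ℝ) => ((t ^ s * exp (-(ε * t)) : ℝ) : ℂ) *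
      Complex.exp (-(2 * π * Complex.I * ξ * t)))
    (F' := fun (ξ t : ℝ) => -(2 * π * Complex.I) * (((t ^ (s + 1) * exp (-(ε * t)) : ℝ) : ℂ) *
      Complex.exp (-(2 * π * Complex.I * ξ * t))))
    (bound := fun t => 2 * π * ‖t ^ (s + 1) * exp (-(ε * t))‖)
    univ_mem (Eventually.of_forall fun x => (integrableOn_laplace hs hε x).aestronglyMeasurable)
    (integrableOn_laplace hs hε ξ)
    ((integrableOn_laplace (s := s + 1) (by linarith) hε ξ).aestronglyMeasurable.const_mul _)
    (Eventually.of_forall fun t x _ => by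
      rw [norm_mul, norm_mul, norm_laplace_osc, mul_one, Complex.norm_real]
      simp [abs_of_pos pi_pos])
    ((integrableOn_rpow_mul_exp (by linarith) hε).norm.const_mul _)
    (by
      filter_upwards [ae_restrict_mem measurableSet_Ioi] with t ht x _
      have h1 : HasDerivAt (fun x : ℝ => -(2 * π * Complex.I * x * t))
          (-(2 * π * Complex.I * t)) x := by
        have := ((Complex.ofRealCLM.hasDerivAt (x := x)).const_mul (2 * π * Complex.I)).mul_const
          (t : ℂ)
        simpa using this.fun_neg
      have h2 := (h1.cexp).const_mul ((t ^ s * exp (-(ε * t)) : ℝ) : ℂ)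
      refine h2.congr_deriv ?_
      rw [rpow_add_one (ne_of_gt ht)]
      push_cast
      ring)
  refine key.2.congr_deriv ?_
  rw [integral_const_mul, laplaceRpow]

/-- Integration by parts, with no boundary term at the origin because `s > 0`. Combined with
`hasDerivAt_laplaceRpow` it yields a first-order linear differential equation in `ξ`. -/
theorem laplaceRpow_rec {s ε : ℝ} (hs : 0 < s) (hε : 0 < ε) (ξ : ℝ) :
    (ε + 2 * π * Complex.I * ξ) * laplaceRpow s ε ξ = s * laplaceRpow (s - 1) ε ξ := by
  have hI := integrableOn_laplace (s := s) (by linarith) hε ξ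
  have hI' := integrableOn_laplace (s := s - 1) (by linarith) hε ξ
  have key := integral_Ioi_of_hasDerivAt_of_tendsto (a := 0) (m := 0)
    (f := fun t : ℝ => ((t ^ s * exp (-(ε * t)) : ℝ) : ℂ) *
      Complex.exp (-(2 * π * Complex.I * ξ * t)))
    (f' := fun t : ℝ => s * (((t ^ (s - 1) * exp (-(ε * t)) : ℝ) : ℂ) *
      Complex.exp (-(2 * π * Complex.I * ξ * t))) - (ε + 2 * π * Complex.I * ξ) *
      (((t ^ s * exp (-(ε * t)) : ℝ) : ℂ) * Complex.exp (-(2 * π * Complex.I * ξ * t)))) ?_ ?_ ?_ ?_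
  · rw [integral_sub (hI'.const_mul _) (hI.const_mul _), integral_const_mul,
      integral_const_mul] at key
    simp only [zero_rpow hs.ne', zero_mul, Complex.ofReal_zero, sub_zero] at key
    rw [laplaceRpow, laplaceRpow]
    exact (sub_eq_zero.1 key).symm
  · have : ContinuousAt (fun t : ℝ => t ^ s) 0 := continuousAt_rpow_const _ _ (Or.inr hs.le)
    refine ContinuousAt.continuousWithinAt ?_
    refine ContinuousAt.mul ?_ (Continuous.continuousAt (by fun_prop))
    exact Complex.continuous_ofReal.continuousAt.comp (this.mul (by fun_prop))
  · intro t ht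
    have ht0 : t ≠ 0 := ne_of_gt ht
    have h1 : HasDerivAt (fun t : ℝ => t ^ s * exp (-(ε * t)))
        (s * t ^ (s - 1) * exp (-(ε * t)) + t ^ s * (exp (-(ε * t)) * -ε)) t := by
      refine (hasDerivAt_rpow_const (Or.inl ht0)).mul (HasDerivAt.exp ?_)
      simpa using ((hasDerivAt_id t).const_mul ε).fun_neg
    have h2 : HasDerivAt (fun t : ℝ => Complex.exp (-(2 * π * Complex.I * ξ * t)))
        (Complex.exp (-(2 * π * Complex.I * ξ * t)) * -(2 * π * Complex.I * ξ)) t := by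
      refine HasDerivAt.cexp ?_
      simpa using ((Complex.ofRealCLM.hasDerivAt (x := t)).const_mul (2 * π * Complex.I * ξ)).fun_neg
    refine (h1.ofReal_comp.mul h2).congr_deriv ?_
    push_cast
    ring
  · exact (hI'.const_mul _).sub (hI.const_mul _)
  · have h := tendsto_rpow_mul_exp_neg_mul_atTop_nhds_zero s ε hε
    rw [tendsto_zero_iff_norm_tendsto_zero] at h ⊢
    refine h.congr fun t => ?_
    rw [norm_mul (_ : ℂ), norm_laplace_osc, mul_one, Complex.norm_real, neg_mul]

theorem damped_re_pos {ε : ℝ} (hε : 0 < ε) (ξ : ℝ) : 0 < (ε + 2 * π * Complex.I * ξ).re := by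
  simpa using hε

theorem damped_ne_zero {ε : ℝ} (hε : 0 < ε) (ξ : ℝ) : (ε + 2 * π * Complex.I * ξ : ℂ) ≠ 0 := by
  intro h
  have := damped_re_pos hε ξ
  rw [h] at this
  simp at this

/-- The differential equation makes the transform times `(ε + 2πiξ)^β` constant in `ξ`; its value at
`ξ = 0` is Euler's integral for `Γ(β)`. The base has positive real part, so the principal power is
differentiable along the whole line. -/
theorem laplaceRpow_eq {β ε : ℝ} (hβ : 0 < β) (hε : 0 < ε) (ξ : ℝ) :
    laplaceRpow (β - 1) ε ξ = Gamma β * (ε + 2 * π * Complex.I * ξ) ^ (-β : ℂ) := by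
  have hd : ∀ x : ℝ, HasDerivAt (fun x : ℝ => laplaceRpow (β - 1) ε x *
      (ε + 2 * π * Complex.I * x) ^ (β : ℂ)) 0 x := by
    intro x
    have h1 := hasDerivAt_laplaceRpow (s := β - 1) (by linarith) hε x
    have h2 : HasDerivAt (fun x : ℝ => (ε + 2 * π * Complex.I * x : ℂ)) (2 * π * Complex.I) x := by
      simpa using ((Complex.ofRealCLM.hasDerivAt (x := x)).const_mul
        (2 * π * Complex.I)).const_add (ε : ℂ)
    have h3 := (Complex.hasStrictDerivAt_cpow_const (c := (β : ℂ))
      (Or.inl (damped_re_pos hε x))).hasDerivAt.comp x h2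
    refine (h1.mul h3).congr_deriv ?_
    have hr := laplaceRpow_rec hβ hε x
    rw [sub_add_cancel]
    have hp : (ε + 2 * π * Complex.I * x : ℂ) ^ (β : ℂ) =
        (ε + 2 * π * Complex.I * x) ^ ((β : ℂ) - 1) * (ε + 2 * π * Complex.I * x) := by
      nth_rewrite 3 [← Complex.cpow_one (ε + 2 * π * Complex.I * x : ℂ)]
      rw [← Complex.cpow_add _ _ (damped_ne_zero hε x), sub_add_cancel]
    rw [Function.comp_apply, hp]
    linear_combination (-2 * π * Complex.I * (ε + 2 * π * Complex.I * x) ^ ((β : ℂ) - 1)) * hr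
  have hconst := is_const_of_deriv_eq_zero (fun x => (hd x).differentiableAt)
    (fun x => (hd x).deriv) ξ 0
  have h0 : laplaceRpow (β - 1) ε 0 = ((ε ^ (-β) * Gamma β : ℝ) : ℂ) := by
    have := integral_rpow_mul_exp_neg_mul_Ioi hβ hε
    rw [one_div, inv_rpow hε.le, ← rpow_neg hε.le] at this
    rw [← this, laplaceRpow, ← integral_complex_ofReal]
    simp
  have hε0 : ((ε : ℂ)) ^ (β : ℂ) = ((ε ^ β : ℝ) : ℂ) := (Complex.ofReal_cpow hε.le β).symm
  simp only [h0, Complex.ofReal_zero, mul_zero, add_zero, hε0] at hconst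
  rw [Complex.cpow_neg, ← div_eq_mul_inv, eq_div_iff, hconst]
  · have : ε ^ (-β) * ε ^ β = 1 := by rw [← rpow_add hε]; simp
    rw [← Complex.ofReal_mul, mul_right_comm, this, one_mul]
  · exact fun h => damped_ne_zero hε ξ ((Complex.cpow_eq_zero_iff _ _).1 h).1

theorem fourier_dampedKernel {β ε : ℝ} (hβ : 0 < β) (hε : 0 < ε) (ξ : ℝ) :
    𝓕 (fun t => (dampedKernel β ε t : ℂ)) ξ = (ε + 2 * π * Complex.I * ξ) ^ (-β : ℂ) := by
  rw [Real.fourier_real_eq_integral_exp_smul]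
  have hG : (Gamma β : ℂ) ≠ 0 := Complex.ofReal_ne_zero.2 (Gamma_pos_of_pos hβ).ne'
  have h := laplaceRpow_eq hβ hε ξ
  rw [laplaceRpow, ← integral_indicator measurableSet_Ioi] at h
  rw [← mul_right_inj' hG, ← h, ← integral_const_mul]
  congr 1
  ext t
  by_cases ht : t ∈ Ioi (0 : ℝ)
  · simp only [dampedKernel, indicator_of_mem ht, smul_eq_mul]
    push_cast
    field_simp
  · simp [dampedKernel, indicator_of_notMem ht]

theorem fourier_dampedKernel_neg {β ε : ℝ} (hβ : 0 < β) (hε : 0 < ε) (ξ : ℝ) :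
    𝓕 (fun t => (dampedKernel β ε (-t) : ℂ)) ξ =
      (starRingEnd ℂ) ((ε + 2 * π * Complex.I * ξ) ^ (-β : ℂ)) := by
  rw [← fourier_dampedKernel hβ hε, Real.fourier_real_eq_integral_exp_smul,
    Real.fourier_real_eq_integral_exp_smul, ← integral_conj,
    ← integral_neg_eq_self (fun t => (starRingEnd ℂ) _)]
  congr 1
  ext t
  simp only [smul_eq_mul, map_mul, Complex.conj_ofReal, ← Complex.exp_conj, Complex.conj_I]
  congr 2
  push_cast
  ring

/-! ### Parseval's identity and convolutions -/

/-- Parseval's identity for integrable functions, one of which is the Fourier inverse of its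
transform. -/
theorem integral_conj_mul_eq_fourier {u v : ℝ → ℂ} (hu : Integrable u) (hv : Integrable v)
    (hvc : Continuous v) (hv' : Integrable (𝓕 v)) :
    ∫ x, (starRingEnd ℂ) (u x) * v x = ∫ ξ, (starRingEnd ℂ) (𝓕 u ξ) * 𝓕 v ξ := by
  have h := VectorFourier.integral_sesq_fourierIntegral_eq_neg_flip (innerSL ℂ (E := ℂ))
    (L := innerₗ ℝ) (μ := volume) (ν := volume) Real.continuous_fourierChar continuous_inner hu hv'
  have h2 := hvc.fourierInv_fourier_eq hv hv'
  -- The flipped transform has the opposite sign in the exponent: it is the inverse Fourier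
  -- transform.
  have h3 : ∀ x, VectorFourier.fourierIntegral 𝐞 volume (-(innerₗ ℝ).flip) (𝓕 v) x = v x := by
    intro x
    rw [← congrFun h2 x]
    simp [Real.fourierInv_eq, VectorFourier.fourierIntegral]
  simp only [h3, innerSL_apply_apply, RCLike.inner_apply] at h
  simp only [mul_comm ((starRingEnd ℂ) _)]
  exact h.symm

theorem norm_fourier_le_integral {u : ℝ → ℂ} (ξ : ℝ) : ‖𝓕 u ξ‖ ≤ ∫ x, ‖u x‖ :=
  VectorFourier.norm_fourierIntegral_le_integral_norm _ _ _ _ _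

theorem continuous_fourier_of_integrable {u : ℝ → ℂ} (hu : Integrable u) : Continuous (𝓕 u) :=
  VectorFourier.fourierIntegral_continuous Real.continuous_fourierChar continuous_inner hu

/-- Convolution of real functions on the line. -/
abbrev conv (K f : ℝ → ℝ) : ℝ → ℝ := convolution K f (ContinuousLinearMap.mul ℝ ℝ) volume

theorem conv_apply (K f : ℝ → ℝ) (x : ℝ) : conv K f x = ∫ t, K t * f (x - t) := rfl

theorem conv_apply_swap (K f : ℝ → ℝ) (x : ℝ) : conv K f x = ∫ s, K (x - s) * f s :=
  convolution_mul_swap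

/-- The Fourier transform of a real function. -/
abbrev fhat (f : ℝ → ℝ) : ℝ → ℂ := 𝓕 (fun x => (f x : ℂ))

theorem fourier_conv {K f : ℝ → ℝ} (hK : Integrable K) (hf : Integrable f) (ξ : ℝ) :
    fhat (conv K f) ξ = fhat K ξ * fhat f ξ := by
  have h : (fun x => (conv K f x : ℂ)) = convolution (fun x => (K x : ℂ)) (fun x => (f x : ℂ))
      (ContinuousLinearMap.mul ℂ ℂ) volume := by
    funext x
    rw [conv_apply, ← integral_complex_ofReal, convolution_mul]
    simp
  rw [fhat, h]
  exact Real.fourier_mul_convolution_eq hK.ofReal hf.ofReal ξ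

/-- Parseval's identity for real functions. -/
theorem integral_mul_eq_fhat {u v : ℝ → ℝ} (hu : Integrable u) (hv : Integrable v)
    (hvc : Continuous v) (hv' : Integrable (fhat v)) :
    ∫ x, u x * v x = ∫ ξ, ((starRingEnd ℂ) (fhat u ξ) * fhat v ξ).re := by
  have h := integral_conj_mul_eq_fourier hu.ofReal hv.ofReal
    (Complex.continuous_ofReal.comp hvc) hv'
  have hint : Integrable fun ξ => (starRingEnd ℂ) (fhat u ξ) * fhat v ξ :=
    hv'.bdd_mul (continuous_fourier_of_integrable hu.ofReal).star.aestronglyMeasurable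
      (Eventually.of_forall fun ξ => by
        rw [starRingEnd_apply, norm_star]; exact norm_fourier_le_integral ξ)
  have h2 := Complex.reCLM.integral_comp_comm hint
  simp only [Complex.reCLM_apply] at h2
  rw [h2]
  have h3 : ∫ x, (starRingEnd ℂ) ((u x : ℝ) : ℂ) * ((v x : ℝ) : ℂ) =
      ((∫ x, u x * v x : ℝ) : ℂ) := by
    rw [← integral_complex_ofReal]
    simp
  exact (Complex.ofReal_re _).symm.trans (congrArg Complex.re (h3.symm.trans h))

/-! ### Test functions and the homogeneous seminorms -/

namespace IsTestFunction

variable {φ : ℝ → ℝ}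

theorem continuous (hφ : IsTestFunction φ) : Continuous φ := hφ.smooth.continuous

theorem deriv (hφ : IsTestFunction φ) : IsTestFunction (deriv φ) where
  smooth := (contDiff_infty_iff_deriv.1 hφ.smooth).2
  hasCompactSupport := hφ.hasCompactSupport.deriv
  tsupport_subset := (tsupport_deriv_subset (𝕜 := ℝ)).trans hφ.tsupport_subset

theorem integrable (hφ : IsTestFunction φ) : Integrable φ :=
  hφ.continuous.integrable_of_hasCompactSupport hφ.hasCompactSupport

theorem memLp_two (hφ : IsTestFunction φ) : MemLp φ 2 volume :=
  hφ.continuous.memLp_of_hasCompactSupport hφ.hasCompactSupport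

theorem eq_zero (hφ : IsTestFunction φ) {x : ℝ} (hx : x ∉ Ioo (0 : ℝ) 1) : φ x = 0 :=
  image_eq_zero_of_notMem_tsupport fun h => hx (hφ.tsupport_subset h)

theorem differentiable (hφ : IsTestFunction φ) : Differentiable ℝ φ :=
  hφ.smooth.differentiable (by simp)

/-- A test function as a complex Schwartz function. -/
def schwartz (hφ : IsTestFunction φ) : SchwartzMap ℝ ℂ :=
  HasCompactSupport.toSchwartzMap (f := fun x => (φ x : ℂ))
    (hφ.hasCompactSupport.comp_left (g := Complex.ofReal) Complex.ofReal_zero)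
    (Complex.ofRealCLM.contDiff.comp hφ.smooth)

theorem fourier_schwartz (hφ : IsTestFunction φ) :
    ((𝓕 hφ.schwartz : SchwartzMap ℝ ℂ) : ℝ → ℂ) = fhat φ := rfl

theorem continuous_fourier (hφ : IsTestFunction φ) : Continuous (fhat φ) := by
  rw [← hφ.fourier_schwartz]; exact SchwartzMap.continuous _

theorem integrable_fourier (hφ : IsTestFunction φ) : Integrable (fhat φ) := by
  rw [← hφ.fourier_schwartz]; exact SchwartzMap.integrable _

theorem fourier_deriv (hφ : IsTestFunction φ) (ξ : ℝ) :
    fhat (_root_.deriv φ) ξ = (2 * π * Complex.I * ξ) * fhat φ ξ := by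
  have hd : _root_.deriv (fun x => (φ x : ℂ)) = fun x => ((_root_.deriv φ x : ℝ) : ℂ) := by
    ext x
    exact (hφ.differentiable x).hasDerivAt.ofReal_comp.deriv
  have h := Real.fourier_deriv (f := fun x => (φ x : ℂ)) hφ.integrable.ofReal
    (fun x => (hφ.differentiable x).hasDerivAt.ofReal_comp.differentiableAt)
    (by rw [hd]; exact hφ.deriv.integrable.ofReal)
  rw [hd] at h
  exact congrFun h ξ

theorem norm_fourier_deriv (hφ : IsTestFunction φ) (ξ : ℝ) :
    ‖fhat (_root_.deriv φ) ξ‖ ^ 2 =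
      |2 * π * ξ| ^ 2 * ‖fhat φ ξ‖ ^ 2 := by
  rw [hφ.fourier_deriv, norm_mul, mul_pow]
  simp [abs_of_pos pi_pos]

end IsTestFunction

/-- The square of the seminorm of `H^μ(ℝ)`. -/
def seminormSq (μ : ℝ) (φ : ℝ → ℝ) : ℝ :=
  ∫ ξ, |2 * π * ξ| ^ (2 * μ) * ‖fhat φ ξ‖ ^ 2

theorem abs_rpow_le_one_add_sq {μ : ℝ} (h0 : 0 ≤ μ) (h1 : μ ≤ 1) (y : ℝ) :
    |y| ^ (2 * μ) ≤ 1 + |y| ^ 2 := by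
  rcases le_total |y| 1 with h | h
  · have := rpow_le_one (abs_nonneg y) h (by linarith : 0 ≤ 2 * μ)
    nlinarith [sq_nonneg |y|]
  · have := rpow_le_rpow_of_exponent_le h (by linarith : 2 * μ ≤ 2)
    rw [rpow_two] at this
    linarith

theorem IsTestFunction.integrable_weight {φ : ℝ → ℝ} (hφ : IsTestFunction φ) :
    Integrable fun ξ : ℝ => (1 + |2 * π * ξ| ^ 2) * ‖fhat φ ξ‖ ^ 2 := by
  set F : SchwartzMap ℝ ℂ := 𝓕 hφ.schwartz
  have hF : (F : ℝ → ℂ) = fhat φ := hφ.fourier_schwartz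
  rw [← hF]
  have h0 := F.integrable_pow_mul volume 0
  have h2 := (F.integrable_pow_mul volume 2).const_mul ((2 * π) ^ 2)
  have hb : ∀ ξ, ‖F ξ‖ ≤ ∫ x, ‖(φ x : ℂ)‖ := fun ξ => by
    rw [hF]; exact norm_fourier_le_integral ξ
  -- One factor of `‖F ξ‖²` is bounded by the `L¹` norm of `φ`; the other absorbs the weight by
  -- Schwartz decay.
  refine ((h0.add h2).const_mul (∫ x, ‖(φ x : ℂ)‖)).mono'
    (Continuous.aestronglyMeasurable (by fun_prop)) (Eventually.of_forall fun ξ => ?_)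
  rw [Real.norm_of_nonneg (by positivity)]
  simp only [Pi.add_apply, pow_zero, one_mul, Real.norm_eq_abs, abs_mul, abs_of_pos pi_pos,
    abs_two]
  have := mul_le_mul_of_nonneg_right (hb ξ)
    (by positivity : 0 ≤ (1 + (2 * π * |ξ|) ^ 2) * ‖F ξ‖)
  nlinarith

theorem IsTestFunction.integrable_seminorm {φ : ℝ → ℝ} (hφ : IsTestFunction φ) {μ : ℝ}
    (h0 : 0 ≤ μ) (h1 : μ ≤ 1) :
    Integrable fun ξ : ℝ => |2 * π * ξ| ^ (2 * μ) * ‖fhat φ ξ‖ ^ 2 := by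
  refine hφ.integrable_weight.mono' ?_ (Eventually.of_forall fun ξ => ?_)
  · refine Continuous.aestronglyMeasurable (Continuous.mul ?_ (hφ.continuous_fourier.norm.pow 2))
    exact (by fun_prop : Continuous fun ξ : ℝ => |2 * π * ξ|).rpow_const fun _ => Or.inr (by linarith)
  · rw [Real.norm_of_nonneg (by positivity)]
    exact mul_le_mul_of_nonneg_right (abs_rpow_le_one_add_sq h0 h1 _) (by positivity)

theorem IsTestFunction.integrable_norm_sq {φ : ℝ → ℝ} (hφ : IsTestFunction φ) :
    Integrable fun ξ : ℝ => ‖fhat φ ξ‖ ^ 2 := by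
  simpa using hφ.integrable_seminorm (μ := 0) le_rfl zero_le_one

/-- Plancherel's theorem for test functions. -/
theorem IsTestFunction.integral_sq {φ : ℝ → ℝ} (hφ : IsTestFunction φ) :
    ∫ x, φ x ^ 2 = ∫ ξ, ‖fhat φ ξ‖ ^ 2 := by
  have h := integral_mul_eq_fhat hφ.integrable hφ.integrable hφ.continuous hφ.integrable_fourier
  simp only [Complex.conj_mul'] at h
  simp only [sq, h]
  congr 1
  funext ξ
  norm_cast

/-- A function supported in the unit interval has at most half of its mass in low frequencies. -/
theorem IsTestFunction.integral_sq_le {φ : ℝ → ℝ} (hφ : IsTestFunction φ) {μ : ℝ}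
    (h0 : 0 ≤ μ) (h1 : μ ≤ 1) : ∫ x, φ x ^ 2 ≤ 2 * seminormSq μ φ := by
  have hL1 : (∫ x, ‖(φ x : ℂ)‖) ^ 2 ≤ ∫ x, φ x ^ 2 := by
    have e1 : ∫ x, ‖(φ x : ℂ)‖ = ∫ x in Ioo (0 : ℝ) 1, |φ x| := by
      rw [setIntegral_eq_integral_of_forall_compl_eq_zero]
      · simp
      · intro x hx; simp [hφ.eq_zero hx]
    have e2 : ∫ x, φ x ^ 2 = ∫ x in Ioo (0 : ℝ) 1, φ x ^ 2 := by
      rw [setIntegral_eq_integral_of_forall_compl_eq_zero]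
      intro x hx; simp [hφ.eq_zero hx]
    rw [e1, e2]
    have hi : Integrable (fun x => |φ x|) (volume.restrict (Ioo (0 : ℝ) 1)) :=
      hφ.integrable.abs.integrableOn
    have hi2 : Integrable (fun x => φ x ^ 2) (volume.restrict (Ioo (0 : ℝ) 1)) :=
      hφ.memLp_two.integrable_sq.integrableOn
    set m := ∫ x in Ioo (0 : ℝ) 1, |φ x|
    have hc : ∫ x in Ioo (0 : ℝ) 1, (1 : ℝ) = 1 := by simp
    -- Cauchy-Schwarz on an interval of length one, as nonnegativity of the variance of `|φ|`.
    have : 0 ≤ ∫ x in Ioo (0 : ℝ) 1, (|φ x| - m) ^ 2 := integral_nonneg fun x => sq_nonneg _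
    have e3 : ∫ x in Ioo (0 : ℝ) 1, (|φ x| - m) ^ 2 =
        (∫ x in Ioo (0 : ℝ) 1, φ x ^ 2) - m ^ 2 := by
      have : ∀ x, (|φ x| - m) ^ 2 = φ x ^ 2 - 2 * m * |φ x| + m ^ 2 * 1 := fun x => by
        rw [sub_sq, sq_abs]; ring
      simp only [this]
      rw [integral_add (f := fun x => φ x ^ 2 - 2 * m * |φ x|) (hi2.sub (hi.const_mul (2 * m)))
        (integrable_const _), integral_sub hi2 (hi.const_mul _), integral_const_mul, integral_const_mul, hc]
      ring
    linarith
  -- For `|ξ| < 1/4` the transform is bounded by the `L¹` norm, hence by the `L²` norm. This window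
  -- has length `1/2`, so it carries at most half of the mass. Outside it `|2πξ| ≥ π/2 > 1`, and the
  -- weight is at least one.
  have hpt : ∀ ξ, ‖fhat φ ξ‖ ^ 2 ≤
      (Ioo (-(1 / 4) : ℝ) (1 / 4)).indicator (fun _ => ∫ x, φ x ^ 2) ξ +
        |2 * π * ξ| ^ (2 * μ) * ‖fhat φ ξ‖ ^ 2 := by
    intro ξ
    by_cases hξ : ξ ∈ Ioo (-(1 / 4) : ℝ) (1 / 4)
    · rw [indicator_of_mem hξ]
      have : ‖fhat φ ξ‖ ^ 2 ≤ (∫ x, ‖(φ x : ℂ)‖) ^ 2 := by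
        gcongr; exact norm_fourier_le_integral ξ
      have : 0 ≤ |2 * π * ξ| ^ (2 * μ) * ‖fhat φ ξ‖ ^ 2 := by positivity
      linarith
    · rw [indicator_of_notMem hξ, zero_add]
      have h4 : 1 / 4 ≤ |ξ| := by
        by_contra hc
        exact hξ (abs_lt.1 (not_le.1 hc))
      have : 1 ≤ |2 * π * ξ| := by
        rw [abs_mul, abs_of_pos (by positivity : (0 : ℝ) < 2 * π)]
        nlinarith [pi_gt_three]
      exact le_mul_of_one_le_left (by positivity) (one_le_rpow this (by linarith))
  have hind : Integrable ((Ioo (-(1 / 4) : ℝ) (1 / 4)).indicator fun _ => ∫ x, φ x ^ 2) :=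
    (integrable_indicator_iff measurableSet_Ioo).2 (by simp)
  have := integral_mono hφ.integrable_norm_sq (hind.add (hφ.integrable_seminorm h0 h1)) hpt
  rw [← hφ.integral_sq, integral_add' hind (hφ.integrable_seminorm h0 h1),
    integral_indicator measurableSet_Ioo, setIntegral_const, Real.volume_real_Ioo_of_le (by norm_num),
    smul_eq_mul] at this
  unfold seminormSq
  linarith

/-! ### Convolutions of test functions and removal of the damping -/

theorem conv_continuous {K φ : ℝ → ℝ} (hK : Integrable K) (hφ : IsTestFunction φ) :
    Continuous (conv K φ) :=
  hφ.hasCompactSupport.continuous_convolution_right _ hK.locallyIntegrable hφ.continuous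

theorem conv_integrable {K f : ℝ → ℝ} (hK : Integrable K) (hf : Integrable f) :
    Integrable (conv K f) := hK.integrable_convolution _ hf

theorem integrable_fourier_conv {K φ : ℝ → ℝ} (hK : Integrable K) (hφ : IsTestFunction φ) :
    Integrable (fhat (conv K φ)) := by
  rw [show fhat (conv K φ) = fun ξ => fhat K ξ * fhat φ ξ from
    funext (fourier_conv hK hφ.integrable)]
  exact hφ.integrable_fourier.bdd_mul
    (continuous_fourier_of_integrable hK.ofReal).aestronglyMeasurable
    (Eventually.of_forall fun ξ => norm_fourier_le_integral ξ)

theorem integral_conv_mul_conv {K L φ : ℝ → ℝ} (hK : Integrable K) (hL : Integrable L)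
    (hφ : IsTestFunction φ) :
    ∫ x, conv K φ x * conv L φ x =
      ∫ ξ, ((starRingEnd ℂ) (fhat K ξ) * fhat L ξ).re * ‖fhat φ ξ‖ ^ 2 := by
  rw [integral_mul_eq_fhat (conv_integrable hK hφ.integrable) (conv_integrable hL hφ.integrable)
    (conv_continuous hL hφ) (integrable_fourier_conv hL hφ)]
  congr 1
  funext ξ
  rw [fourier_conv hK hφ.integrable, fourier_conv hL hφ.integrable, map_mul, mul_mul_mul_comm,
    Complex.conj_mul', ← Complex.ofReal_pow, Complex.re_mul_ofReal]

theorem integral_mul_conv {K φ : ℝ → ℝ} (hK : Integrable K) (hφ : IsTestFunction φ) :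
    ∫ x, φ x * conv K φ x = ∫ ξ, (fhat K ξ).re * ‖fhat φ ξ‖ ^ 2 := by
  rw [integral_mul_eq_fhat hφ.integrable (conv_integrable hK hφ.integrable)
    (conv_continuous hK hφ) (integrable_fourier_conv hK hφ)]
  congr 1
  funext ξ
  rw [fourier_conv hK hφ.integrable, mul_left_comm, Complex.conj_mul', ← Complex.ofReal_pow,
    Complex.re_mul_ofReal]

/-- The kernel of the left fractional integral on the unit interval. -/
def intervalKernel (β : ℝ) : ℝ → ℝ :=
  (Ioo (0 : ℝ) 1).indicator fun t => t ^ (β - 1) / Gamma β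

theorem integrable_intervalKernel {β : ℝ} (hβ : 0 < β) : Integrable (intervalKernel β) := by
  rw [intervalKernel, integrable_indicator_iff measurableSet_Ioo]
  refine Integrable.div_const ?_ _
  exact (intervalIntegral.integrableOn_Ioo_rpow_iff one_pos).2 (by linarith)

/-- The reflection of a function on the line. -/
abbrev refl (K : ℝ → ℝ) : ℝ → ℝ := fun t => K (-t)

theorem conv_refl (K f : ℝ → ℝ) (x : ℝ) :
    conv (refl K) f x = conv K (fun y => f (1 - y)) (1 - x) := by
  rw [conv_apply, conv_apply, ← integral_neg_eq_self]
  congr 1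
  funext t
  simp only [refl, neg_neg]
  congr 2
  ring

theorem IsTestFunction.reflect {φ : ℝ → ℝ} (hφ : IsTestFunction φ) :
    IsTestFunction fun x => φ (1 - x) where
  smooth := hφ.smooth.comp (contDiff_const.sub contDiff_id)
  hasCompactSupport := hφ.hasCompactSupport.comp_homeomorph (Homeomorph.subLeft 1)
  tsupport_subset := by
    have : tsupport (fun x => φ (1 - x)) = (Homeomorph.subLeft (1 : ℝ)) ⁻¹' tsupport φ :=
      tsupport_comp_eq_preimage φ (Homeomorph.subLeft (1 : ℝ))
    rw [this]
    intro x hx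
    have := hφ.tsupport_subset hx
    simp only [Homeomorph.coe_subLeft, mem_Ioo] at this ⊢
    constructor <;> linarith [this.1, this.2]

theorem IsTestFunction.bounded {φ : ℝ → ℝ} (hφ : IsTestFunction φ) : ∃ B, ∀ x, |φ x| ≤ B :=
  hφ.hasCompactSupport.exists_bound_of_continuous hφ.continuous

/-- If `φ (x - t) ≠ 0` then `t < x < 1`, so truncating the kernel at `1` is invisible. Only the
factor `exp (-εt)` depends on `ε`, which prepares the dominated convergence. -/
theorem dampedKernel_mul {β ε x : ℝ} {φ : ℝ → ℝ} (hφ : IsTestFunction φ) (hx : x < 1) (t : ℝ) :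
    dampedKernel β ε t * φ (x - t) = exp (-(ε * t)) * (intervalKernel β t * φ (x - t)) := by
  by_cases h : φ (x - t) = 0
  · simp [h]
  · have hxt : x - t ∈ Ioo (0 : ℝ) 1 := by
      by_contra hc; exact h (hφ.eq_zero hc)
    by_cases ht : 0 < t
    · rw [dampedKernel, intervalKernel, indicator_of_mem (mem_Ioi.2 ht),
        indicator_of_mem (by constructor <;> linarith [hxt.1])]
      ring
    · rw [dampedKernel, intervalKernel, indicator_of_notMem (by simpa using ht),
        indicator_of_notMem (by simp [ht])]
      simp

theorem integrable_kernel_mul {K φ : ℝ → ℝ} (hK : Integrable K) (hφ : IsTestFunction φ) (x : ℝ) :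
    Integrable fun t => K t * φ (x - t) := by
  obtain ⟨B, hB⟩ := hφ.bounded
  exact hK.mul_bdd (hφ.continuous.comp (continuous_const.sub continuous_id)).aestronglyMeasurable
    (Eventually.of_forall fun t => hB (x - t))

theorem norm_exp_mul_intervalKernel_le {β ε : ℝ} (hε : 0 < ε) {φ : ℝ → ℝ} (x t : ℝ) :
    ‖exp (-(ε * t)) * (intervalKernel β t * φ (x - t))‖ ≤ ‖intervalKernel β t * φ (x - t)‖ := by
  by_cases ht : t ∈ Ioo (0 : ℝ) 1
  · rw [norm_mul, Real.norm_of_nonneg (exp_nonneg _)]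
    exact mul_le_of_le_one_left (norm_nonneg _)
      (exp_le_one_iff.2 (neg_nonpos.2 (mul_nonneg hε.le ht.1.le)))
  · simp [intervalKernel, indicator_of_notMem ht]

theorem tendsto_conv_dampedKernel {β x : ℝ} (hβ : 0 < β) {φ : ℝ → ℝ} (hφ : IsTestFunction φ)
    (hx : x < 1) : Tendsto (fun ε => conv (dampedKernel β ε) φ x) (𝓝[>] 0)
      (𝓝 (conv (intervalKernel β) φ x)) := by
  simp only [conv_apply, dampedKernel_mul hφ hx]
  refine tendsto_integral_filter_of_dominated_convergence
    (fun t => ‖intervalKernel β t * φ (x - t)‖) ?_ ?_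
    (integrable_kernel_mul (integrable_intervalKernel hβ) hφ x).norm ?_
  · refine Eventually.of_forall fun ε => ?_
    exact (Continuous.aestronglyMeasurable (by fun_prop)).mul
      (integrable_kernel_mul (integrable_intervalKernel hβ) hφ x).aestronglyMeasurable
  · filter_upwards [self_mem_nhdsWithin] with ε hε
    exact Eventually.of_forall fun t => norm_exp_mul_intervalKernel_le hε x t
  · refine Eventually.of_forall fun t => ?_
    have : Continuous fun ε : ℝ => exp (-(ε * t)) * (intervalKernel β t * φ (x - t)) := by
      fun_prop
    simpa using (this.tendsto 0).mono_left nhdsWithin_le_nhds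

theorem conv_dampedKernel_bounded {β : ℝ} (hβ : 0 < β) {φ : ℝ → ℝ} (hφ : IsTestFunction φ) :
    ∃ B, ∀ ε > 0, ∀ x < 1, |conv (dampedKernel β ε) φ x| ≤ B := by
  obtain ⟨B, hB⟩ := hφ.bounded
  refine ⟨∫ t, ‖intervalKernel β t‖ * B, fun ε hε x hx => ?_⟩
  simp only [conv_apply, dampedKernel_mul hφ hx]
  rw [← Real.norm_eq_abs]
  refine norm_integral_le_of_norm_le ((integrable_intervalKernel hβ).norm.mul_const B)
    (Eventually.of_forall fun t => ?_)
  refine (norm_exp_mul_intervalKernel_le hε x t).trans ?_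
  rw [norm_mul]
  exact mul_le_mul_of_nonneg_left (hB _) (norm_nonneg _)

/-- Causality of the kernel. With the mirror statement at the right end, it confines the product of
a left and a right convolution to the unit interval. -/
theorem conv_dampedKernel_eq_zero {β ε x : ℝ} {φ : ℝ → ℝ} (hφ : IsTestFunction φ) (hx : x ≤ 0) :
    conv (dampedKernel β ε) φ x = 0 := by
  rw [conv_apply]
  refine integral_eq_zero_of_ae (Eventually.of_forall fun t => ?_)
  by_cases ht : 0 < t
  · simp [hφ.eq_zero (x := x - t) fun h => by linarith [h.1]]
  · simp [dampedKernel, indicator_of_notMem (s := Ioi (0 : ℝ)) (a := t) (by simpa using ht)]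

theorem tendsto_conv_refl_dampedKernel {β x : ℝ} (hβ : 0 < β) {φ : ℝ → ℝ}
    (hφ : IsTestFunction φ) (hx : 0 < x) :
    Tendsto (fun ε => conv (refl (dampedKernel β ε)) φ x) (𝓝[>] 0)
      (𝓝 (conv (refl (intervalKernel β)) φ x)) := by
  simp only [conv_refl]
  exact tendsto_conv_dampedKernel hβ hφ.reflect (by linarith)

theorem conv_refl_dampedKernel_bounded {β : ℝ} (hβ : 0 < β) {φ : ℝ → ℝ}
    (hφ : IsTestFunction φ) :
    ∃ B, ∀ ε > 0, ∀ x > 0, |conv (refl (dampedKernel β ε)) φ x| ≤ B := by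
  obtain ⟨B, hB⟩ := conv_dampedKernel_bounded hβ hφ.reflect
  exact ⟨B, fun ε hε x hx => by rw [conv_refl]; exact hB ε hε _ (by linarith)⟩

theorem conv_refl_dampedKernel_eq_zero {β ε x : ℝ} {φ : ℝ → ℝ} (hφ : IsTestFunction φ)
    (hx : 1 ≤ x) : conv (refl (dampedKernel β ε)) φ x = 0 := by
  rw [conv_refl]; exact conv_dampedKernel_eq_zero hφ.reflect (by linarith)

/-! ### Bounds for the damped symbol and its limit -/

theorem norm_damped_ge (ε ξ : ℝ) : |2 * π * ξ| ≤ ‖(ε + 2 * π * Complex.I * ξ : ℂ)‖ := by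
  have : (ε + 2 * π * Complex.I * ξ : ℂ).im = 2 * π * ξ := by simp
  rw [← this]
  exact Complex.abs_im_le_norm _

theorem norm_damped_rpow_mul_le {ε s : ℝ} (ξ : ℝ) (hs : 0 ≤ s) :
    ‖(ε + 2 * π * Complex.I * ξ : ℂ)‖ ^ (-s) * |2 * π * ξ| ^ 2 ≤
      |2 * π * ξ| ^ (2 * (1 - s / 2)) := by
  rcases eq_or_ne (2 * π * ξ) 0 with h | h
  · rw [h]
    simp only [abs_zero, ne_eq, OfNat.ofNat_ne_zero, not_false_eq_true, zero_pow, mul_zero]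
    exact rpow_nonneg le_rfl _
  · have h0 : 0 < |2 * π * ξ| := abs_pos.2 h
    have : |2 * π * ξ| ^ (2 * (1 - s / 2)) = |2 * π * ξ| ^ (-s) * |2 * π * ξ| ^ 2 := by
      rw [← rpow_two, ← rpow_add h0]; congr 1; ring
    rw [this]
    gcongr ?_ * _
    exact rpow_le_rpow_of_nonpos h0 (norm_damped_ge ε ξ) (by linarith)

/-- The argument of a number in the right half-plane is at most `π/2` in absolute value, so that of
its power is at most `πs/2 ≤ π`, and the cosine decreases on `[0, π]`. -/
theorem re_damped_cpow_ge {ε s : ℝ} (hε : 0 < ε) (hs : 0 ≤ s) (hs1 : s ≤ 2) (ξ : ℝ) :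
    cos (π * s / 2) * ‖(ε + 2 * π * Complex.I * ξ : ℂ)‖ ^ (-s) ≤
      ((ε + 2 * π * Complex.I * ξ : ℂ) ^ (-s : ℂ)).re := by
  set z : ℂ := ε + 2 * π * Complex.I * ξ
  have hz : z ≠ 0 := damped_ne_zero hε ξ
  have harg : |z.arg| ≤ π / 2 := Complex.abs_arg_le_pi_div_two_iff.2 (damped_re_pos hε ξ).le
  have h : z ^ (-s : ℂ) = ((‖z‖ ^ (-s) : ℝ) : ℂ) * Complex.exp ((-(s * z.arg) : ℝ) * Complex.I) := by
    rw [Complex.cpow_def_of_ne_zero hz, Complex.log, rpow_def_of_pos (norm_pos_iff.2 hz),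
      Complex.ofReal_exp, ← Complex.exp_add]
    congr 1
    push_cast
    ring
  rw [h, Complex.re_ofReal_mul, Complex.exp_ofReal_mul_I_re, mul_comm, cos_neg, ← cos_abs (s * _)]
  gcongr
  rw [abs_mul, abs_of_nonneg hs]
  apply cos_le_cos_of_nonneg_of_le_pi (by positivity)
  · nlinarith [pi_pos]
  · nlinarith

/-- Since `|ε + iω| ≥ |ω|`, the undamped integrand dominates. Pointwise convergence can fail only at
`ξ = 0`, a null set. -/
theorem tendsto_damped_seminorm {s : ℝ} (hs : 0 < s) (hs1 : s ≤ 1) {φ : ℝ → ℝ}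
    (hφ : IsTestFunction φ) :
    Tendsto (fun ε : ℝ => ∫ ξ : ℝ, ‖(ε + 2 * π * Complex.I * ξ : ℂ)‖ ^ (-s) *
      ‖fhat (deriv φ) ξ‖ ^ 2) (𝓝[>] 0) (𝓝 (seminormSq (1 - s / 2) φ)) := by
  simp only [hφ.norm_fourier_deriv, ← mul_assoc]
  refine tendsto_integral_filter_of_dominated_convergence
    (fun ξ => |2 * π * ξ| ^ (2 * (1 - s / 2)) * ‖fhat φ ξ‖ ^ 2) ?_ ?_
    (hφ.integrable_seminorm (by linarith) (by linarith)) ?_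
  · filter_upwards [self_mem_nhdsWithin] with ε hε
    refine Continuous.aestronglyMeasurable ?_
    refine (Continuous.mul ?_ (by fun_prop)).mul (hφ.continuous_fourier.norm.pow 2)
    exact (by fun_prop : Continuous fun ξ : ℝ => ‖(ε + 2 * π * Complex.I * ξ : ℂ)‖).rpow_const
      fun ξ => Or.inl (norm_ne_zero_iff.2 (damped_ne_zero hε ξ))
  · refine Eventually.of_forall fun ε => Eventually.of_forall fun ξ => ?_
    rw [Real.norm_of_nonneg (by positivity)]
    gcongr ?_ * _
    exact norm_damped_rpow_mul_le ξ hs.le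
  · have hae : ∀ᵐ ξ : ℝ, ξ ≠ 0 := by simp [ae_iff, measure_singleton]
    filter_upwards [hae] with ξ hξ
    have h0 : 0 < |2 * π * ξ| := abs_pos.2 (by positivity)
    have e : |2 * π * ξ| ^ (2 * (1 - s / 2)) =
        ‖((0 : ℝ) + 2 * π * Complex.I * ξ : ℂ)‖ ^ (-s) * |2 * π * ξ| ^ 2 := by
      rw [show ‖((0 : ℝ) + 2 * π * Complex.I * ξ : ℂ)‖ = |2 * π * ξ| by
        simp [abs_mul], ← rpow_two, ← rpow_add h0]
      congr 1; ring
    rw [e]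
    refine ((Tendsto.mono_left ?_ nhdsWithin_le_nhds).mul_const _).mul_const _
    refine ContinuousAt.tendsto (f := fun ε : ℝ => ‖(ε + 2 * π * Complex.I * ξ : ℂ)‖ ^ (-s)) ?_
    refine ContinuousAt.rpow_const (Continuous.continuousAt (by fun_prop)) (Or.inl ?_)
    have := norm_damped_ge 0 ξ
    exact (h0.trans_le this).ne'

theorem seminormSq_le_of_damped {s c B : ℝ} (hs : 0 < s) (hs1 : s ≤ 1) {φ : ℝ → ℝ}
    (hφ : IsTestFunction φ) {b : ℝ → ℝ} (hb : Tendsto b (𝓝[>] 0) (𝓝 B))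
    (h : ∀ ε : ℝ, 0 < ε → c * ∫ ξ : ℝ, ‖(ε + 2 * π * Complex.I * ξ : ℂ)‖ ^ (-s) *
      ‖fhat (deriv φ) ξ‖ ^ 2 ≤ b ε) : c * seminormSq (1 - s / 2) φ ≤ B :=
  le_of_tendsto_of_tendsto ((tendsto_damped_seminorm hs hs1 hφ).const_mul c) hb
    (by filter_upwards [self_mem_nhdsWithin] with ε hε using h ε hε)

theorem integrable_norm_fhat_deriv {φ : ℝ → ℝ} (hφ : IsTestFunction φ) {ε s : ℝ} (hε : 0 < ε)
    (hs : 0 ≤ s) (hs1 : s ≤ 1) :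
    Integrable fun ξ : ℝ => ‖(ε + 2 * π * Complex.I * ξ : ℂ)‖ ^ (-s) *
      ‖fhat (deriv φ) ξ‖ ^ 2 := by
  refine (hφ.integrable_seminorm (μ := 1 - s / 2) (by linarith) (by linarith)).mono' ?_ ?_
  · refine Continuous.aestronglyMeasurable (Continuous.mul ?_ (hφ.deriv.continuous_fourier.norm.pow 2))
    exact (by fun_prop : Continuous fun ξ : ℝ => ‖(ε + 2 * π * Complex.I * ξ : ℂ)‖).rpow_const
      fun ξ => Or.inl (norm_ne_zero_iff.2 (damped_ne_zero hε ξ))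
  · refine Eventually.of_forall fun ξ => ?_
    rw [Real.norm_of_nonneg (by positivity), hφ.norm_fourier_deriv, ← mul_assoc]
    gcongr ?_ * _
    exact norm_damped_rpow_mul_le ξ hs

theorem integrable_re_cpow {φ : ℝ → ℝ} (hφ : IsTestFunction φ) {ε s : ℝ} (hε : 0 < ε)
    (hs : 0 ≤ s) (hs1 : s ≤ 1) :
    Integrable fun ξ : ℝ => ((ε + 2 * π * Complex.I * ξ : ℂ) ^ (-s : ℂ)).re *
      ‖fhat (deriv φ) ξ‖ ^ 2 := by
  refine (integrable_norm_fhat_deriv hφ hε hs hs1).mono' ?_ (Eventually.of_forall fun ξ => ?_)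
  · refine Continuous.aestronglyMeasurable (Continuous.mul ?_ (hφ.deriv.continuous_fourier.norm.pow 2))
    refine Complex.continuous_re.comp ?_
    refine Continuous.cpow (by fun_prop) continuous_const fun ξ => Or.inl (damped_re_pos hε ξ)
  · rw [norm_mul, Real.norm_of_nonneg (by positivity : 0 ≤ ‖fhat (deriv φ) ξ‖ ^ 2)]
    gcongr ?_ * _
    refine (Complex.abs_re_le_norm _).trans ?_
    rw [← Complex.ofReal_neg, Complex.norm_cpow_real]

theorem integral_re_cpow_ge {φ : ℝ → ℝ} (hφ : IsTestFunction φ) {ε s : ℝ} (hε : 0 < ε)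
    (hs : 0 ≤ s) (hs1 : s ≤ 1) :
    cos (π * s / 2) * ∫ ξ : ℝ, ‖(ε + 2 * π * Complex.I * ξ : ℂ)‖ ^ (-s) *
      ‖fhat (deriv φ) ξ‖ ^ 2 ≤ ∫ ξ : ℝ, ((ε + 2 * π * Complex.I * ξ : ℂ) ^ (-s : ℂ)).re *
      ‖fhat (deriv φ) ξ‖ ^ 2 := by
  rw [← integral_const_mul]
  refine integral_mono ((integrable_norm_fhat_deriv hφ hε hs hs1).const_mul _)
    (integrable_re_cpow hφ hε hs hs1) fun ξ => ?_
  simp only [← mul_assoc]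
  gcongr ?_ * _
  exact re_damped_cpow_ge hε hs (by linarith) ξ

/-! ### Norms and angle of the left and right fractional derivatives -/

section

variable {β : ℝ} {φ : ℝ → ℝ}

/-- By Plancherel only the modulus of the symbol matters, so one argument serves the left and the
right kernel. Passing from the line to the unit interval only loses mass. -/
theorem integral_conv_sq_le (hβ : 0 < β) (hβ1 : β ≤ 1 / 2) (hφ : IsTestFunction φ) {ε : ℝ}
    (hε : 0 < ε) {K : ℝ → ℝ} (hK : Integrable K)
    (hK' : ∀ ξ : ℝ, ‖fhat K ξ‖ = ‖(ε + 2 * π * Complex.I * ξ : ℂ)‖ ^ (-β)) :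
    ∫ x in Ioo (0 : ℝ) 1, conv K (deriv φ) x ^ 2 ≤ seminormSq (1 - β) φ := by
  have hcb := (conv_continuous hK hφ.deriv)
  have hpt : ∀ ξ, ((starRingEnd ℂ) (fhat K ξ) * fhat K ξ).re * ‖fhat (deriv φ) ξ‖ ^ 2 =
      ‖(ε + 2 * π * Complex.I * ξ : ℂ)‖ ^ (-(2 * β)) * ‖fhat (deriv φ) ξ‖ ^ 2 := by
    intro ξ
    rw [Complex.conj_mul', hK', ← Complex.ofReal_pow, Complex.ofReal_re, ← rpow_natCast,
      ← rpow_mul (norm_nonneg _)]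
    congr 2
    push_cast
    ring
  have hint := integral_conv_mul_conv hK hK hφ.deriv
  simp only [hpt, ← sq] at hint
  have h1 : ∫ x, conv K (deriv φ) x ^ 2 ≤ seminormSq (1 - β) φ := by
    rw [hint]
    refine integral_mono (integrable_norm_fhat_deriv hφ hε (by linarith) (by linarith))
      (hφ.integrable_seminorm (by linarith) (by linarith)) fun ξ => ?_
    simp only [hφ.norm_fourier_deriv, ← mul_assoc]
    gcongr ?_ * _
    refine (norm_damped_rpow_mul_le ξ (by linarith)).trans_eq ?_
    congr 1; ring
  refine le_trans (setIntegral_le_integral ?_ (Eventually.of_forall fun x => sq_nonneg _)) h1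
  have hb : ∃ B, ∀ x, |conv K (deriv φ) x| ≤ B := by
    obtain ⟨B, hB⟩ := hφ.deriv.bounded
    refine ⟨∫ t, ‖K t‖ * B, fun x => ?_⟩
    rw [conv_apply, ← Real.norm_eq_abs]
    refine norm_integral_le_of_norm_le (hK.norm.mul_const B) (Eventually.of_forall fun t => ?_)
    rw [norm_mul]
    exact mul_le_mul_of_nonneg_left (hB _) (norm_nonneg _)
  obtain ⟨B, hB⟩ := hb
  simp only [sq]
  exact (conv_integrable hK hφ.deriv.integrable).mul_bdd hcb.aestronglyMeasurable
    (Eventually.of_forall hB)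

theorem norm_fhat_dampedKernel (hβ : 0 < β) {ε : ℝ} (hε : 0 < ε) (ξ : ℝ) :
    ‖fhat (dampedKernel β ε) ξ‖ = ‖(ε + 2 * π * Complex.I * ξ : ℂ)‖ ^ (-β) := by
  rw [fhat, fourier_dampedKernel hβ hε, ← Complex.ofReal_neg, Complex.norm_cpow_real]

theorem norm_fhat_refl_dampedKernel (hβ : 0 < β) {ε : ℝ} (hε : 0 < ε) (ξ : ℝ) :
    ‖fhat (refl (dampedKernel β ε)) ξ‖ = ‖(ε + 2 * π * Complex.I * ξ : ℂ)‖ ^ (-β) := by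
  rw [fhat, fourier_dampedKernel_neg hβ hε, RCLike.norm_conj, ← Complex.ofReal_neg,
    Complex.norm_cpow_real]

/-- Limits of integrals over the unit interval of products of uniformly bounded functions. -/
theorem tendsto_integral_Ioo_mul {f g : ℝ → ℝ → ℝ} {F G : ℝ → ℝ} {B C : ℝ}
    (hf : ∀ ε > 0, Continuous (f ε)) (hg : ∀ ε > 0, Continuous (g ε))
    (hfB : ∀ ε > 0, ∀ x ∈ Ioo (0 : ℝ) 1, |f ε x| ≤ B)
    (hgC : ∀ ε > 0, ∀ x ∈ Ioo (0 : ℝ) 1, |g ε x| ≤ C)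
    (hfF : ∀ x ∈ Ioo (0 : ℝ) 1, Tendsto (fun ε => f ε x) (𝓝[>] 0) (𝓝 (F x)))
    (hgG : ∀ x ∈ Ioo (0 : ℝ) 1, Tendsto (fun ε => g ε x) (𝓝[>] 0) (𝓝 (G x))) :
    Tendsto (fun ε => ∫ x in Ioo (0 : ℝ) 1, f ε x * g ε x) (𝓝[>] 0)
      (𝓝 (∫ x in Ioo (0 : ℝ) 1, F x * G x)) := by
  refine tendsto_integral_filter_of_dominated_convergence (fun _ => B * C) ?_ ?_
    (integrable_const _) ?_
  · filter_upwards [self_mem_nhdsWithin] with ε hε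
    exact ((hf ε hε).mul (hg ε hε)).aestronglyMeasurable
  · filter_upwards [self_mem_nhdsWithin] with ε hε
    filter_upwards [ae_restrict_mem measurableSet_Ioo] with x hx
    rw [norm_mul]
    exact mul_le_mul (hfB ε hε x hx) (hgC ε hε x hx) (norm_nonneg _)
      ((abs_nonneg _).trans (hfB ε hε x hx))
  · filter_upwards [ae_restrict_mem measurableSet_Ioo] with x hx
    exact (hfF x hx).mul (hgG x hx)

theorem integrable_refl {K : ℝ → ℝ} (hK : Integrable K) : Integrable (refl K) := hK.comp_neg

theorem integral_left_sq_le (hβ : 0 < β) (hβ1 : β ≤ 1 / 2) (hφ : IsTestFunction φ) :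
    ∫ x in Ioo (0 : ℝ) 1, conv (intervalKernel β) (deriv φ) x ^ 2 ≤ seminormSq (1 - β) φ := by
  obtain ⟨B, hB⟩ := conv_dampedKernel_bounded hβ hφ.deriv
  have hc : ∀ ε > 0, Continuous (conv (dampedKernel β ε) (deriv φ)) := fun ε hε =>
    conv_continuous (integrable_dampedKernel hβ hε) hφ.deriv
  have h := tendsto_integral_Ioo_mul hc hc (fun ε hε x hx => hB ε hε x hx.2)
    (fun ε hε x hx => hB ε hε x hx.2) (fun x hx => tendsto_conv_dampedKernel hβ hφ.deriv hx.2)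
    (fun x hx => tendsto_conv_dampedKernel hβ hφ.deriv hx.2)
  simp only [← sq] at h
  refine le_of_tendsto h ?_
  filter_upwards [self_mem_nhdsWithin] with ε hε
  exact integral_conv_sq_le hβ hβ1 hφ hε (integrable_dampedKernel hβ hε)
    (norm_fhat_dampedKernel hβ hε)

theorem integral_right_sq_le (hβ : 0 < β) (hβ1 : β ≤ 1 / 2) (hφ : IsTestFunction φ) :
    ∫ x in Ioo (0 : ℝ) 1, conv (refl (intervalKernel β)) (deriv φ) x ^ 2 ≤
      seminormSq (1 - β) φ := by
  obtain ⟨B, hB⟩ := conv_refl_dampedKernel_bounded hβ hφ.deriv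
  have hc : ∀ ε > 0, Continuous (conv (refl (dampedKernel β ε)) (deriv φ)) := fun ε hε =>
    conv_continuous (integrable_refl (integrable_dampedKernel hβ hε)) hφ.deriv
  have h := tendsto_integral_Ioo_mul hc hc (fun ε hε x hx => hB ε hε x hx.1)
    (fun ε hε x hx => hB ε hε x hx.1)
    (fun x hx => tendsto_conv_refl_dampedKernel hβ hφ.deriv hx.1)
    (fun x hx => tendsto_conv_refl_dampedKernel hβ hφ.deriv hx.1)
  simp only [← sq] at h
  refine le_of_tendsto h ?_
  filter_upwards [self_mem_nhdsWithin] with ε hε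
  exact integral_conv_sq_le hβ hβ1 hφ hε (integrable_refl (integrable_dampedKernel hβ hε))
    (norm_fhat_refl_dampedKernel hβ hε)

/-- The left and the right fractional derivatives form an acute angle. -/
theorem seminormSq_le_integral_left_mul_right (hβ : 0 < β) (hβ1 : β ≤ 1 / 2)
    (hφ : IsTestFunction φ) :
    cos (π * β) * seminormSq (1 - β) φ ≤ ∫ x in Ioo (0 : ℝ) 1,
      conv (intervalKernel β) (deriv φ) x * conv (refl (intervalKernel β)) (deriv φ) x := by
  obtain ⟨B, hB⟩ := conv_dampedKernel_bounded hβ hφ.deriv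
  obtain ⟨C, hC⟩ := conv_refl_dampedKernel_bounded hβ hφ.deriv
  have h := tendsto_integral_Ioo_mul
    (fun ε hε => conv_continuous (integrable_dampedKernel hβ hε) hφ.deriv)
    (fun ε hε => conv_continuous (integrable_refl (integrable_dampedKernel hβ hε)) hφ.deriv)
    (fun ε hε x hx => hB ε hε x hx.2) (fun ε hε x hx => hC ε hε x hx.1)
    (fun x hx => tendsto_conv_dampedKernel hβ hφ.deriv hx.2)
    (fun x hx => tendsto_conv_refl_dampedKernel hβ hφ.deriv hx.1)
  have key := seminormSq_le_of_damped (s := 2 * β) (c := cos (π * β)) (by linarith)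
    (by linarith) hφ h fun ε hε => ?_
  · rwa [mul_div_cancel_left₀ _ (two_ne_zero' ℝ)] at key
  -- The left factor vanishes for `x ≤ 0` and the right one for `x ≥ 1`, so the integral is over the
  -- whole line and Parseval's identity applies.
  · rw [setIntegral_eq_integral_of_forall_compl_eq_zero, integral_conv_mul_conv
      (integrable_dampedKernel hβ hε) (integrable_refl (integrable_dampedKernel hβ hε)) hφ.deriv]
    · have := integral_re_cpow_ge hφ hε (s := 2 * β) (by linarith) (by linarith)
      rw [show π * (2 * β) / 2 = π * β by ring] at this
      refine this.trans_eq ?_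
      congr 1
      funext ξ
      -- The right symbol is the conjugate of the left one; the conjugation in Parseval's identity
      -- makes the product the conjugate of `z^(-2β)`, with no cancellation of phases.
      rw [show fhat (dampedKernel β ε) ξ = _ from fourier_dampedKernel hβ hε ξ,
        show fhat (refl (dampedKernel β ε)) ξ = _ from fourier_dampedKernel_neg hβ hε ξ, ← map_mul,
        Complex.conj_re, ← Complex.cpow_add _ _ (damped_ne_zero hε ξ)]
      congr 3
      push_cast
      ring
    · intro x hx
      by_cases h0 : 0 < x
      · rw [conv_refl_dampedKernel_eq_zero hφ.deriv (by
          by_contra hc; exact hx ⟨h0, not_le.1 hc⟩), mul_zero]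
      · rw [conv_dampedKernel_eq_zero hφ.deriv (not_lt.1 h0), zero_mul]

theorem deriv_mem_bound (hφ : IsTestFunction φ) :
    ∃ B, ∀ x ∈ Ioo (0 : ℝ) 1, |deriv φ x| ≤ B := by
  obtain ⟨B, hB⟩ := hφ.deriv.bounded
  exact ⟨B, fun x _ => hB x⟩

/-- Coercivity of the left fractional diffusion form in the energy seminorm. -/
theorem seminormSq_le_integral_left (hβ : 0 < β) (hβ1 : β ≤ 1 / 2) (hφ : IsTestFunction φ) :
    cos (π * β / 2) * seminormSq (1 - β / 2) φ ≤ ∫ x in Ioo (0 : ℝ) 1,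
      deriv φ x * conv (intervalKernel β) (deriv φ) x := by
  obtain ⟨B, hB⟩ := conv_dampedKernel_bounded hβ hφ.deriv
  obtain ⟨C, hC⟩ := deriv_mem_bound hφ
  have h := tendsto_integral_Ioo_mul (f := fun _ => deriv φ) (F := deriv φ)
    (fun _ _ => hφ.deriv.continuous)
    (fun ε hε => conv_continuous (integrable_dampedKernel hβ hε) hφ.deriv)
    (fun _ _ => hC) (fun ε hε x hx => hB ε hε x hx.2) (fun x _ => tendsto_const_nhds)
    (fun x hx => tendsto_conv_dampedKernel hβ hφ.deriv hx.2)
  refine seminormSq_le_of_damped hβ (by linarith) hφ h fun ε hε => ?_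
  rw [setIntegral_eq_integral_of_forall_compl_eq_zero, integral_mul_conv
    (integrable_dampedKernel hβ hε) hφ.deriv]
  · refine (integral_re_cpow_ge hφ hε hβ.le (by linarith)).trans_eq ?_
    congr 1
    funext ξ
    rw [fhat, fhat, fourier_dampedKernel hβ hε]
  · intro x hx
    rw [hφ.deriv.eq_zero hx, zero_mul]

theorem seminormSq_le_integral_right (hβ : 0 < β) (hβ1 : β ≤ 1 / 2) (hφ : IsTestFunction φ) :
    cos (π * β / 2) * seminormSq (1 - β / 2) φ ≤ ∫ x in Ioo (0 : ℝ) 1,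
      deriv φ x * conv (refl (intervalKernel β)) (deriv φ) x := by
  obtain ⟨B, hB⟩ := conv_refl_dampedKernel_bounded hβ hφ.deriv
  obtain ⟨C, hC⟩ := deriv_mem_bound hφ
  have h := tendsto_integral_Ioo_mul (f := fun _ => deriv φ) (F := deriv φ)
    (fun _ _ => hφ.deriv.continuous)
    (fun ε hε => conv_continuous (integrable_refl (integrable_dampedKernel hβ hε)) hφ.deriv)
    (fun _ _ => hC) (fun ε hε x hx => hB ε hε x hx.1) (fun x _ => tendsto_const_nhds)
    (fun x hx => tendsto_conv_refl_dampedKernel hβ hφ.deriv hx.1)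
  refine seminormSq_le_of_damped hβ (by linarith) hφ h fun ε hε => ?_
  rw [setIntegral_eq_integral_of_forall_compl_eq_zero, integral_mul_conv
    (integrable_refl (integrable_dampedKernel hβ hε)) hφ.deriv]
  · refine (integral_re_cpow_ge hφ hε hβ.le (by linarith)).trans_eq ?_
    congr 1
    funext ξ
    rw [fhat, fhat, fourier_dampedKernel_neg hβ hε, Complex.conj_re]
  · intro x hx
    rw [hφ.deriv.eq_zero hx, zero_mul]

end

/-! ### Fractional integrals of beta densities and the annihilating weight -/

/-- The density `s ^ (p - 1) * (1 - s) ^ (q - 1)` of the beta integral. -/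
def betaWeight (p q s : ℝ) : ℝ := s ^ (p - 1) * (1 - s) ^ (q - 1)

theorem betaWeight_nonneg {p q s : ℝ} (hs : s ∈ Ioo (0 : ℝ) 1) : 0 ≤ betaWeight p q s :=
  mul_nonneg (rpow_nonneg hs.1.le _) (rpow_nonneg (by linarith [hs.2]) _)

theorem ofReal_betaWeight {p q s : ℝ} (hs : s ∈ Ioo (0 : ℝ) 1) :
    (betaWeight p q s : ℂ) = (s : ℂ) ^ ((p : ℂ) - 1) * (1 - (s : ℂ)) ^ ((q : ℂ) - 1) := by
  have h1 : (0 : ℝ) ≤ 1 - s := by linarith [hs.2]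
  rw [betaWeight, Complex.ofReal_mul, Complex.ofReal_cpow hs.1.le, Complex.ofReal_cpow h1]
  push_cast
  rfl

theorem integrableOn_betaWeight {p q : ℝ} (hp : 0 < p) (hq : 0 < q) :
    IntegrableOn (betaWeight p q) (Ioo 0 1) := by
  have h := Complex.betaIntegral_convergent (u := p) (v := q) (by simpa) (by simpa)
  rw [intervalIntegrable_iff_integrableOn_Ioo_of_le zero_le_one] at h
  refine IntegrableOn.congr_fun (f := fun s : ℝ => RCLike.re ((s : ℂ) ^ ((p : ℂ) - 1) *
    (1 - (s : ℂ)) ^ ((q : ℂ) - 1))) h.re (fun s hs => ?_) measurableSet_Ioo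
  simp only [← ofReal_betaWeight hs]
  simp

theorem integral_betaWeight {p q : ℝ} (hp : 0 < p) (hq : 0 < q) :
    ∫ s in Ioo (0 : ℝ) 1, betaWeight p q s = Gamma p * Gamma q / Gamma (p + q) := by
  have h := ProbabilityTheory.beta_eq_betaIntegralReal p q hp hq
  rw [ProbabilityTheory.beta] at h
  rw [h, Complex.betaIntegral, intervalIntegral.integral_of_le zero_le_one,
    integral_Ioc_eq_integral_Ioo, ← Complex.ofReal_re (∫ s in Ioo (0 : ℝ) 1, betaWeight p q s),
    ← integral_complex_ofReal]
  congr 1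
  exact setIntegral_congr_fun measurableSet_Ioo fun s hs => ofReal_betaWeight hs

/-- The Möbius substitution `σ = (1 - x) τ / (1 - x τ)` in the beta integral. -/
theorem integral_betaWeight_mul_rpow {p q x : ℝ} (hx : x ∈ Ioo (0 : ℝ) 1) :
    ∫ τ in Ioo (0 : ℝ) 1, betaWeight p q τ * (1 - x * τ) ^ (-(p + q)) =
      (1 - x) ^ (-p) * ∫ s in Ioo (0 : ℝ) 1, betaWeight p q s := by
  have hx1 : 0 < 1 - x := by linarith [hx.2]
  have hpos : ∀ τ ∈ Ioo (0 : ℝ) 1, 0 < 1 - x * τ := fun τ hτ => by nlinarith [hτ.1, hτ.2, hx.1]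
  have hden : ∀ σ ∈ Ioo (0 : ℝ) 1, 0 < 1 - x + x * σ := fun σ hσ => by nlinarith [hσ.1, hx.1]
  have himg : (fun τ : ℝ => (1 - x) * τ / (1 - x * τ)) '' Ioo 0 1 = Ioo 0 1 := by
    ext σ
    constructor
    · rintro ⟨τ, hτ, rfl⟩
      have := hpos τ hτ
      refine ⟨div_pos (mul_pos hx1 hτ.1) this, (div_lt_one this).2 ?_⟩
      nlinarith [hτ.2]
    · intro hσ
      have h := hden σ hσ
      -- The inverse of the Möbius map.
      refine ⟨σ / (1 - x + x * σ), ⟨div_pos hσ.1 h, (div_lt_one h).2 (by nlinarith [hσ.2])⟩, ?_⟩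
      have : 1 - x * (σ / (1 - x + x * σ)) = (1 - x) / (1 - x + x * σ) := by
        field_simp; ring
      simp only [this]
      field_simp
  have hinj : InjOn (fun τ : ℝ => (1 - x) * τ / (1 - x * τ)) (Ioo 0 1) := by
    intro a ha b hb hab
    have h1 := hpos a ha
    have h2 := hpos b hb
    simp only at hab
    rw [div_eq_div_iff h1.ne' h2.ne'] at hab
    have : (1 - x) * (a - b) = 0 := by linear_combination hab
    rcases mul_eq_zero.1 this with h | h <;> linarith
  have key := integral_image_eq_integral_abs_deriv_smul (s := Ioo (0 : ℝ) 1)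
    (f := fun τ : ℝ => (1 - x) * τ / (1 - x * τ)) (f' := fun τ => (1 - x) / (1 - x * τ) ^ 2)
    measurableSet_Ioo (fun τ hτ => ?_) hinj (betaWeight p q)
  · rw [himg] at key
    rw [key, ← integral_const_mul]
    refine setIntegral_congr_fun measurableSet_Ioo fun τ hτ => ?_
    have h1 := hpos τ hτ
    have h2 : 0 < 1 - τ := by linarith [hτ.2]
    have e : 1 - (1 - x) * τ / (1 - x * τ) = (1 - τ) / (1 - x * τ) := by field_simp; ring
    simp only [betaWeight, e, smul_eq_mul]
    rw [abs_of_pos (by positivity), div_rpow (mul_nonneg hx1.le hτ.1.le) h1.le,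
      mul_rpow hx1.le hτ.1.le, div_rpow h2.le h1.le]
    have e1 : (1 - x) ^ (-p) * (1 - x) ^ (p - 1) * (1 - x) = 1 := by
      nth_rewrite 3 [← rpow_one (1 - x)]
      rw [← rpow_add hx1, ← rpow_add hx1]
      ring_nf
      exact rpow_zero _
    have e2 : (1 - x * τ) ^ (-(p + q)) * ((1 - x * τ) ^ (p - 1) * (1 - x * τ) ^ (q - 1) *
        (1 - x * τ) ^ 2) = 1 := by
      rw [← rpow_two, ← rpow_add h1, ← rpow_add h1, ← rpow_add h1]
      ring_nf
      exact rpow_zero _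
    have n1 := (rpow_pos_of_pos h1 (p - 1)).ne'
    have n2 := (rpow_pos_of_pos h1 (q - 1)).ne'
    have n3 := (rpow_pos_of_pos h1 (-(p + q))).ne'
    rw [eq_div_of_mul_eq (by positivity) e2]
    generalize (1 - x) ^ (-p) = A, (1 - x) ^ (p - 1) = B, (1 - x * τ) ^ (p - 1) = M,
      (1 - x * τ) ^ (q - 1) = N, τ ^ (p - 1) = T, (1 - τ) ^ (q - 1) = S at *
    have : A * ((1 - x) / (1 - x * τ) ^ 2 * (B * T / M * (S / N))) =
        (A * B * (1 - x)) * (T * S * (1 / (M * N * (1 - x * τ) ^ 2))) := by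
      field_simp
    rw [this, e1, one_mul]
  · have h1 := hpos τ hτ
    have hd : HasDerivAt (fun τ : ℝ => 1 - x * τ) (-x) τ := by
      simpa using ((hasDerivAt_id τ).const_mul x).const_sub 1
    have hn : HasDerivAt (fun τ : ℝ => (1 - x) * τ) (1 - x) τ := by
      simpa using (hasDerivAt_id τ).const_mul (1 - x)
    refine ((hn.fun_div hd h1.ne').congr_deriv ?_).hasDerivWithinAt
    congr 1
    ring

theorem one_sub_mul_pos {x τ : ℝ} (hx : x ∈ Ioo (0 : ℝ) 1) (hτ : τ ∈ Ioo (0 : ℝ) 1) :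
    1 - x ≤ 1 - x * τ := by nlinarith [hx.1, hτ.2]

theorem integrableOn_betaWeight_mul_rpow {p q x : ℝ} (hp : 0 < p) (hq : 0 < q) (r : ℝ)
    (hx : x ∈ Ioo (0 : ℝ) 1) :
    IntegrableOn (fun τ => betaWeight p q τ * (1 - x * τ) ^ r) (Ioo 0 1) := by
  have hx1 : 0 < 1 - x := by linarith [hx.2]
  refine Integrable.mul_bdd (c := 1 + (1 - x) ^ r) (integrableOn_betaWeight hp hq) ?_ ?_
  · exact Measurable.aestronglyMeasurable (by fun_prop)
  · filter_upwards [ae_restrict_mem measurableSet_Ioo] with τ hτ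
    have h := one_sub_mul_pos hx hτ
    rw [Real.norm_of_nonneg (rpow_nonneg (hx1.le.trans h) _)]
    have h0 := rpow_nonneg hx1.le r
    rcases le_total 0 r with hr | hr
    · have := rpow_le_one (hx1.le.trans h) (by nlinarith [hx.1, hτ.1]) hr
      linarith
    · have := rpow_le_rpow_of_nonpos hx1 h hr
      linarith

theorem hasDerivAt_integral_betaWeight {p q x : ℝ} (hp : 0 < p) (hq : 0 < q) (r : ℝ)
    (hx : x ∈ Ioo (0 : ℝ) 1) :
    HasDerivAt (fun x : ℝ => ∫ τ in Ioo (0 : ℝ) 1, betaWeight p q τ * (1 - x * τ) ^ r)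
      (∫ τ in Ioo (0 : ℝ) 1, betaWeight p q τ * (-(r * τ) * (1 - x * τ) ^ (r - 1))) x := by
  have hx1 : 0 < 1 - x := by linarith [hx.2]
  -- For `y < x + d` one has `1 - yτ ≥ 1 - y ≥ d`, so the integrand stays uniformly away from its
  -- singularity near `x`.
  set d := (1 - x) / 2
  have hd : 0 < d := by positivity
  refine (hasDerivAt_integral_of_dominated_loc_of_deriv_le
    (μ := volume.restrict (Ioo (0 : ℝ) 1)) (s := Ioo 0 (x + d)) (x₀ := x)
    (F := fun x τ => betaWeight p q τ * (1 - x * τ) ^ r)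
    (F' := fun x τ => betaWeight p q τ * (-(r * τ) * (1 - x * τ) ^ (r - 1)))
    (bound := fun τ => betaWeight p q τ * (|r| * (1 + d ^ (r - 1))))
    (Ioo_mem_nhds hx.1 (by linarith)) (Eventually.of_forall fun y => ?_)
    (integrableOn_betaWeight_mul_rpow hp hq r hx) ?_ ?_
    ((integrableOn_betaWeight hp hq).mul_const _) ?_).2
  · exact Measurable.aestronglyMeasurable (by unfold betaWeight; fun_prop)
  · exact Measurable.aestronglyMeasurable (by unfold betaWeight; fun_prop)
  · filter_upwards [ae_restrict_mem measurableSet_Ioo] with τ hτ y hy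
    have hw : 0 ≤ betaWeight p q τ := betaWeight_nonneg hτ
    have hy1 : d ≤ 1 - y := by
      have : x + d = 1 - d := by simp only [d]; ring
      linarith [hy.2]
    have h := hy1.trans (one_sub_mul_pos ⟨hy.1, by linarith⟩ hτ)
    have h' : 0 ≤ (1 - y * τ) ^ (r - 1) := rpow_nonneg (hd.le.trans h) _
    rw [norm_mul, Real.norm_of_nonneg hw, norm_mul, norm_neg, norm_mul, Real.norm_of_nonneg h',
      Real.norm_of_nonneg hτ.1.le]
    gcongr ?_ * ?_
    have h2 : (1 - y * τ) ^ (r - 1) ≤ 1 + d ^ (r - 1) := by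
      have h0 := rpow_nonneg hd.le (r - 1)
      rcases le_total 0 (r - 1) with hr | hr
      · have := rpow_le_one (hd.le.trans h) (by nlinarith [hy.1, hτ.1]) hr
        linarith
      · have := rpow_le_rpow_of_nonpos hd h hr
        linarith
    gcongr ?_ * ?_
    exact mul_le_of_le_one_right (norm_nonneg _) hτ.2.le
  · filter_upwards [ae_restrict_mem measurableSet_Ioo] with τ hτ y hy
    have hy1 : 0 < 1 - y * τ := by
      have : x + d = 1 - d := by simp only [d]; ring
      have := one_sub_mul_pos (x := y) ⟨hy.1, by linarith [hy.2]⟩ hτ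
      linarith [hy.2]
    have h1 : HasDerivAt (fun y : ℝ => 1 - y * τ) (-τ) y := by
      simpa using ((hasDerivAt_id y).mul_const τ).const_sub 1
    refine ((h1.rpow_const (p := r) (Or.inl hy1.ne')).const_mul _).congr_deriv ?_
    ring

/-- The fractional integral of a beta density with `p + q = 2 - β` is an incomplete beta
function. -/
theorem hasDerivAt_rpow_mul_integral_betaWeight {p q β x : ℝ} (hp : 0 < p) (hβ : 0 < β)
    (hpq : p + q = 2 - β) (hx : x ∈ Ioo (0 : ℝ) 1) :
    HasDerivAt (fun x : ℝ => x ^ (1 - q) *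
      ∫ τ in Ioo (0 : ℝ) 1, betaWeight p β τ * (1 - x * τ) ^ (q - 1))
      ((1 - q) * (∫ s in Ioo (0 : ℝ) 1, betaWeight p β s) * (x ^ (-q) * (1 - x) ^ (-p))) x := by
  have h1 : HasDerivAt (fun x : ℝ => x ^ (1 - q)) ((1 - q) * x ^ (1 - q - 1)) x :=
    hasDerivAt_rpow_const (Or.inl hx.1.ne')
  refine (h1.mul (hasDerivAt_integral_betaWeight hp hβ (q - 1) hx)).congr_deriv ?_
  have hM := integral_betaWeight_mul_rpow (p := p) (q := β) hx
  have e1 : x ^ (1 - q) = x ^ (-q) * x := by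
    rw [← rpow_add_one hx.1.ne']; ring_nf
  have e2 : 1 - q - 1 = -q := by ring
  have hint1 := integrableOn_betaWeight_mul_rpow hp hβ (q - 1) hx
  have hint2 := integrableOn_betaWeight_mul_rpow hp hβ (q - 1 - 1) hx
  -- Writing `xτ = 1 - (1 - xτ)` splits the derivative in two. One part cancels the derivative of
  -- `x^(1-q)`; the other has exponent `-(p + β)`, exactly that of the Möbius formula.
  have e3 : ∀ τ ∈ Ioo (0 : ℝ) 1, betaWeight p β τ * (-((q - 1) * τ) * (1 - x * τ) ^ (q - 1 - 1)) =
      ((1 - q) / x) * (betaWeight p β τ * (1 - x * τ) ^ (-(p + β)) -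
        betaWeight p β τ * (1 - x * τ) ^ (q - 1)) := by
    intro τ hτ
    have hpos : 0 < 1 - x * τ := by
      have := one_sub_mul_pos hx hτ
      linarith [hx.2]
    have ha : (1 - x * τ) ^ (q - 1) = (1 - x * τ) ^ (q - 1 - 1) * (1 - x * τ) := by
      rw [← rpow_add_one hpos.ne']; ring_nf
    have hb : -(p + β) = q - 1 - 1 := by linarith
    rw [ha, hb]
    have := hx.1.ne'
    field_simp
    ring
  have hb : -(p + β) = q - 1 - 1 := by linarith
  rw [setIntegral_congr_fun measurableSet_Ioo e3, integral_const_mul,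
    integral_sub (by rw [hb]; exact hint2) hint1, hM, e1, e2]
  have := hx.1.ne'
  field_simp
  ring

section

variable {β : ℝ}

theorem leftFracInt_eq_conv (f : ℝ → ℝ) {x : ℝ} (hx : x ∈ Ioo (0 : ℝ) 1) :
    leftFracInt β f x = conv (intervalKernel β) ((Ioo (0 : ℝ) 1).indicator f) x := by
  rw [leftFracInt, conv_apply_swap, ← integral_const_mul, ← integral_indicator measurableSet_Ioo]
  congr 1
  funext s
  by_cases hs : s ∈ Ioo 0 x
  · have hxs : 0 < x - s := by linarith [hs.2]
    rw [indicator_of_mem hs, intervalKernel, indicator_of_mem (by constructor <;> linarith [hs.1, hx.2]),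
      indicator_of_mem (by constructor <;> linarith [hs.1, hs.2, hx.2]),
      show β - 1 = -(1 - β) by ring, rpow_neg hxs.le]
    field_simp
  · rw [indicator_of_notMem hs]
    by_cases h1 : s ∈ Ioo (0 : ℝ) 1
    · rw [intervalKernel, indicator_of_notMem, zero_mul]
      exact fun h2 => hs ⟨h1.1, by linarith [h2.1]⟩
    · rw [indicator_of_notMem h1, mul_zero]

theorem rightFracInt_eq_conv (f : ℝ → ℝ) {x : ℝ} (hx : x ∈ Ioo (0 : ℝ) 1) :
    rightFracInt β f x = conv (refl (intervalKernel β)) ((Ioo (0 : ℝ) 1).indicator f) x := by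
  rw [rightFracInt, conv_apply_swap, ← integral_const_mul, ← integral_indicator measurableSet_Ioo]
  congr 1
  funext s
  rw [refl, neg_sub]
  by_cases hs : s ∈ Ioo x 1
  · have hxs : 0 < s - x := by linarith [hs.1]
    rw [indicator_of_mem hs, intervalKernel, indicator_of_mem (by constructor <;> linarith [hs.2, hx.1]),
      indicator_of_mem (by constructor <;> linarith [hs.1, hs.2, hx.1]),
      show β - 1 = -(1 - β) by ring, rpow_neg hxs.le]
    field_simp
  · rw [indicator_of_notMem hs]
    by_cases h1 : s ∈ Ioo (0 : ℝ) 1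
    · rw [intervalKernel, indicator_of_notMem, zero_mul]
      exact fun h2 => hs ⟨by linarith [h2.1], h1.2⟩
    · rw [indicator_of_notMem h1, mul_zero]

/-- The substitution `s = xτ` moves all dependence on the upper limit into a power of `x` and the
factor `(1 - xτ)^(q-1)`. -/
theorem leftFracInt_betaWeight {p q : ℝ} (hpq : p + q = 2 - β) {x : ℝ}
    (hx : x ∈ Ioo (0 : ℝ) 1) : leftFracInt β (betaWeight p q) x =
      1 / Gamma β * (x ^ (1 - q) *
        ∫ τ in Ioo (0 : ℝ) 1, betaWeight p β τ * (1 - x * τ) ^ (q - 1)) := by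
  rw [leftFracInt, ← integral_Ioc_eq_integral_Ioo, ← integral_Ioc_eq_integral_Ioo,
    ← intervalIntegral.integral_of_le hx.1.le, ← intervalIntegral.integral_of_le (zero_le_one' ℝ)]
  have h := intervalIntegral.mul_integral_comp_mul_left (a := 0) (b := 1) (c := x)
    (f := fun s => betaWeight p q s / (x - s) ^ (1 - β))
  rw [mul_zero, mul_one] at h
  rw [← h]
  congr 1
  rw [intervalIntegral.integral_of_le (zero_le_one' ℝ),
    intervalIntegral.integral_of_le (zero_le_one' ℝ), integral_Ioc_eq_integral_Ioo,
    integral_Ioc_eq_integral_Ioo, ← integral_const_mul, ← integral_const_mul]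
  refine setIntegral_congr_fun measurableSet_Ioo fun τ hτ => ?_
  have h1 : 0 < 1 - τ := by linarith [hτ.2]
  have e : x - x * τ = x * (1 - τ) := by ring
  simp only [betaWeight, e]
  rw [mul_rpow hx.1.le hτ.1.le, mul_rpow hx.1.le h1.le, show β - 1 = -(1 - β) by ring,
    rpow_neg h1.le, show 1 - q = (p - 1) + -(1 - β) + 1 by linarith, rpow_add_one hx.1.ne',
    rpow_add hx.1, rpow_neg hx.1.le]
  have := (rpow_pos_of_pos hx.1 (1 - β)).ne'
  have := (rpow_pos_of_pos h1 (1 - β)).ne'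
  field_simp

theorem hasDerivAt_conv_betaWeight {p q : ℝ} (hβ : 0 < β) (hp : 0 < p) (hpq : p + q = 2 - β)
    {x : ℝ} (hx : x ∈ Ioo (0 : ℝ) 1) :
    HasDerivAt (conv (intervalKernel β) ((Ioo (0 : ℝ) 1).indicator (betaWeight p q)))
      (1 / Gamma β * ((1 - q) * (∫ s in Ioo (0 : ℝ) 1, betaWeight p β s) *
        (x ^ (-q) * (1 - x) ^ (-p)))) x := by
  refine ((hasDerivAt_rpow_mul_integral_betaWeight hp hβ hpq hx).const_mul
    (1 / Gamma β)).congr_of_eventuallyEq ?_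
  filter_upwards [Ioo_mem_nhds hx.1 hx.2] with y hy
  rw [← leftFracInt_eq_conv _ hy, leftFracInt_betaWeight hpq hy]

theorem indicator_betaWeight_reflect (p q : ℝ) :
    (fun y => (Ioo (0 : ℝ) 1).indicator (betaWeight p q) (1 - y)) =
      (Ioo (0 : ℝ) 1).indicator (betaWeight q p) := by
  funext y
  by_cases hy : y ∈ Ioo (0 : ℝ) 1
  · rw [indicator_of_mem hy, indicator_of_mem (by constructor <;> linarith [hy.1, hy.2]),
      betaWeight, betaWeight, sub_sub_cancel, mul_comm]
  · rw [indicator_of_notMem hy, indicator_of_notMem]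
    exact fun h => hy (by constructor <;> linarith [h.1, h.2])

/-- Reflection about `1/2` exchanges `p` and `q`. The outcome is again a multiple of `x^(-q)
(1-x)^(-p)`, with the sign reversed, so the two one-sided derivatives can cancel identically in `x`.
-/
theorem hasDerivAt_conv_refl_betaWeight {p q : ℝ} (hβ : 0 < β) (hq : 0 < q)
    (hpq : p + q = 2 - β) {x : ℝ} (hx : x ∈ Ioo (0 : ℝ) 1) :
    HasDerivAt (conv (refl (intervalKernel β)) ((Ioo (0 : ℝ) 1).indicator (betaWeight p q)))
      (-(1 / Gamma β * ((1 - p) * (∫ s in Ioo (0 : ℝ) 1, betaWeight q β s) *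
        (x ^ (-q) * (1 - x) ^ (-p))))) x := by
  have h := hasDerivAt_conv_betaWeight (p := q) (q := p) hβ hq (by linarith)
    (x := 1 - x) (by constructor <;> linarith [hx.1, hx.2])
  have h2 := h.comp x ((hasDerivAt_id x).const_sub 1)
  have e : conv (refl (intervalKernel β)) ((Ioo (0 : ℝ) 1).indicator (betaWeight p q)) =
      conv (intervalKernel β) ((Ioo (0 : ℝ) 1).indicator (betaWeight q p)) ∘ fun x => 1 - id x := by
    funext y
    rw [conv_refl, indicator_betaWeight_reflect]
    rfl
  rw [e]
  refine h2.congr_deriv ?_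
  rw [sub_sub_cancel]
  ring

/-- This is the balance of coefficients that makes the two derivatives cancel, with `q = 2 - β - p`.
At `p = 1 - β` one has `q = 1` and the left side vanishes; at `p = 1` the right side does. Both
sides are nonnegative at these ends, so the intermediate value theorem applies. -/
theorem exists_beta_exponent (hβ : 0 < β) (hβ1 : β < 1) {θ : ℝ} (h0 : 0 ≤ θ) (h1 : θ ≤ 1) :
    ∃ p ∈ Icc (1 - β) 1, (1 - θ) * ((1 - (2 - β - p)) * ∫ s in Ioo (0 : ℝ) 1, betaWeight p β s) =
      θ * ((1 - p) * ∫ s in Ioo (0 : ℝ) 1, betaWeight (2 - β - p) β s) := by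
  have hcG : ContinuousOn Gamma (Ioi 0) := fun x hx =>
    (differentiableAt_Gamma fun m hm => by
      have : (0 : ℝ) ≤ m := m.cast_nonneg
      have := mem_Ioi.1 hx; linarith).continuousAt.continuousWithinAt
  set b : ℝ → ℝ := fun p => Gamma p * Gamma β / Gamma (p + β)
  have hb : ContinuousOn b (Ioi 0) := by
    refine (hcG.mul continuousOn_const).div (hcG.comp (by fun_prop) fun p hp => ?_) fun p hp => ?_
    · exact add_pos hp hβ
    · exact (Gamma_pos_of_pos (add_pos hp hβ)).ne'
  have hbpos : ∀ p > 0, 0 < b p := fun p hp => by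
    have := Gamma_pos_of_pos hp
    have := Gamma_pos_of_pos hβ
    have := Gamma_pos_of_pos (add_pos hp hβ)
    positivity
  have hF : ContinuousOn (fun p => (1 - θ) * ((1 - (2 - β - p)) * b p) -
      θ * ((1 - p) * b (2 - β - p))) (Icc (1 - β) 1) := by
    have hb1 : ContinuousOn b (Icc (1 - β) 1) := hb.mono fun p hp => by
      have := hp.1; simp only [mem_Ioi]; linarith
    have hb2 : ContinuousOn (fun p => b (2 - β - p)) (Icc (1 - β) 1) :=
      hb.comp (by fun_prop) fun p hp => by
        have := hp.2; simp only [mem_Ioi]; linarith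
    exact (continuousOn_const.mul ((by fun_prop : Continuous fun p : ℝ => 1 - (2 - β - p)).continuousOn.mul
      hb1)).sub (continuousOn_const.mul
      ((by fun_prop : Continuous fun p : ℝ => 1 - p).continuousOn.mul hb2))
  have hmem : (0 : ℝ) ∈ Icc ((1 - θ) * ((1 - (2 - β - (1 - β))) * b (1 - β)) -
      θ * ((1 - (1 - β)) * b (2 - β - (1 - β)))) ((1 - θ) * ((1 - (2 - β - 1)) * b 1) -
      θ * ((1 - 1) * b (2 - β - 1))) := by
    have e1 := (hbpos (2 - β - (1 - β)) (by linarith)).le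
    have e2 := (hbpos 1 one_pos).le
    constructor
    · have : 0 ≤ θ * (β * b (2 - β - (1 - β))) := by positivity
      nlinarith
    · have : 0 ≤ (1 - θ) * (β * b 1) := mul_nonneg (by linarith) (by positivity)
      nlinarith
  obtain ⟨p, hp, hp0⟩ := intermediate_value_Icc (by linarith) hF hmem
  refine ⟨p, hp, ?_⟩
  rw [integral_betaWeight (by linarith [hp.1]) hβ, integral_betaWeight (by linarith [hp.2]) hβ]
  exact sub_eq_zero.1 hp0

/-- Fubini's theorem for convolutions. -/
theorem integral_conv_mul {K w ψ : ℝ → ℝ} (hK : Integrable K) (hw : Integrable w)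
    (hψ : Continuous ψ) {B : ℝ} (hB : ∀ x, |ψ x| ≤ B) :
    ∫ x, conv K w x * ψ x = ∫ x, w x * conv (refl K) ψ x := by
  have h := hw.convolution_integrand (ContinuousLinearMap.mul ℝ ℝ) hK
  have h2 : Integrable (fun z : ℝ × ℝ => (ContinuousLinearMap.mul ℝ ℝ (w z.2)) (K (z.1 - z.2)) *
      ψ z.1) (volume.prod volume) :=
    h.mul_bdd (hψ.comp continuous_fst).aestronglyMeasurable (Eventually.of_forall fun z => hB z.1)
  have h3 := integral_integral_swap (f := fun x s => w s * K (x - s) * ψ x) h2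
  calc ∫ x, conv K w x * ψ x = ∫ x, ∫ s, w s * K (x - s) * ψ x := by
        congr 1; funext x
        rw [conv_apply_swap, integral_mul_const]
        congr 2; funext s; ring
    _ = ∫ s, ∫ x, w s * K (x - s) * ψ x := h3
    _ = _ := by
        congr 1; funext s
        rw [conv_apply_swap, ← integral_const_mul]
        congr 1; funext x
        rw [refl, neg_sub]; ring

theorem refl_refl (K : ℝ → ℝ) : refl (refl K) = K := by
  funext t; simp [refl]

theorem integrable_indicator_betaWeight {p q : ℝ} (hp : 0 < p) (hq : 0 < q) :
    Integrable ((Ioo (0 : ℝ) 1).indicator (betaWeight p q)) :=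
  (integrable_indicator_iff measurableSet_Ioo).2 (integrableOn_betaWeight hp hq)

theorem IsTestFunction.integral_deriv {φ : ℝ → ℝ} (hφ : IsTestFunction φ) :
    ∫ x, _root_.deriv φ x = 0 :=
  integral_eq_zero_of_hasDerivAt_of_integrable (fun x => (hφ.differentiable x).hasDerivAt)
    hφ.deriv.integrable hφ.integrable

/-- A suitable beta density annihilates the range of the two-sided fractional derivative. -/
theorem exists_betaWeight_annihilates (hβ : 0 < β) (hβ1 : β < 1) {θ : ℝ} (h0 : 0 ≤ θ)
    (h1 : θ ≤ 1) : ∃ p q : ℝ, 1 - β ≤ p ∧ p ≤ 1 ∧ 1 - β ≤ q ∧ q ≤ 1 ∧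
      ∀ φ, IsTestFunction φ → ∫ x in Ioo (0 : ℝ) 1, betaWeight p q x *
        (θ * conv (intervalKernel β) (deriv φ) x +
          (1 - θ) * conv (refl (intervalKernel β)) (deriv φ) x) = 0 := by
  obtain ⟨p, hp, hpe⟩ := exists_beta_exponent hβ hβ1 h0 h1
  refine ⟨p, 2 - β - p, hp.1, hp.2, by linarith [hp.2], by linarith [hp.1], fun φ hφ => ?_⟩
  set q := 2 - β - p
  have hp0 : 0 < p := by linarith [hp.1]
  have hq0 : 0 < q := by simp only [q]; linarith [hp.2]
  have hpq : p + q = 2 - β := by simp only [q]; ring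
  set h := (Ioo (0 : ℝ) 1).indicator (betaWeight p q)
  have hh : Integrable h := integrable_indicator_betaWeight hp0 hq0
  set K := intervalKernel β
  have hK : Integrable K := integrable_intervalKernel hβ
  obtain ⟨B, hB⟩ := hφ.deriv.bounded
  -- Transposition reflects the kernel, so the weights `θ` and `1 - θ` change places between the
  -- left and the right integral of `h`.
  have f1 := integral_conv_mul (integrable_refl hK) hh hφ.deriv.continuous hB
  have f2 := integral_conv_mul hK hh hφ.deriv.continuous hB
  rw [refl_refl] at f1
  have hd : ∀ x ∈ Ioo (0 : ℝ) 1, HasDerivAt (fun x => θ * conv (refl K) h x +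
      (1 - θ) * conv K h x) 0 x := fun x hx => by
    refine (((hasDerivAt_conv_refl_betaWeight hβ hq0 hpq hx).const_mul θ).add
      ((hasDerivAt_conv_betaWeight hβ hp0 hpq hx).const_mul (1 - θ))).congr_deriv ?_
    linear_combination (1 / Gamma β * (x ^ (-q) * (1 - x) ^ (-p))) * hpe
  obtain ⟨c, hc⟩ : ∃ c, ∀ x ∈ Ioo (0 : ℝ) 1,
      θ * conv (refl K) h x + (1 - θ) * conv K h x = c := by
    refine ⟨_, fun x hx => (convex_Ioo (0 : ℝ) 1).is_const_of_fderivWithin_eq_zero (𝕜 := ℝ)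
      (f := fun x => θ * conv (refl K) h x + (1 - θ) * conv K h x)
      (fun y hy => (hd y hy).differentiableAt.differentiableWithinAt) (fun y hy => ?_) hx
      (⟨by norm_num, by norm_num⟩ : (1 / 2 : ℝ) ∈ Ioo (0 : ℝ) 1)⟩
    rw [fderivWithin_of_isOpen isOpen_Ioo hy]
    have := (hd y hy).hasFDerivAt.fderiv
    rw [this]
    simp
  have hcK : ∀ L : ℝ → ℝ, Integrable L → Integrable fun x => h x * conv L (deriv φ) x := by
    intro L hL
    obtain ⟨B', hB'⟩ : ∃ B', ∀ x, |conv L (deriv φ) x| ≤ B' := by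
      refine ⟨∫ t, ‖L t‖ * B, fun x => ?_⟩
      rw [conv_apply, ← Real.norm_eq_abs]
      refine norm_integral_le_of_norm_le (hL.norm.mul_const B) (Eventually.of_forall fun t => ?_)
      rw [norm_mul]
      exact mul_le_mul_of_nonneg_left (hB _) (norm_nonneg _)
    exact hh.mul_bdd (conv_continuous hL hφ.deriv).aestronglyMeasurable (Eventually.of_forall hB')
  have hcφ : ∀ L : ℝ → ℝ, Integrable L → Integrable fun x => conv L h x * deriv φ x :=
    fun L hL => (conv_integrable hL hh).mul_bdd hφ.deriv.continuous.aestronglyMeasurable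
      (Eventually.of_forall hB)
  calc _ = ∫ x, h x * (θ * conv K (deriv φ) x + (1 - θ) * conv (refl K) (deriv φ) x) := by
        rw [← integral_indicator measurableSet_Ioo]
        congr 1; funext x
        by_cases hx : x ∈ Ioo (0 : ℝ) 1 <;> simp [h, hx]
    _ = θ * (∫ x, h x * conv K (deriv φ) x) +
        (1 - θ) * ∫ x, h x * conv (refl K) (deriv φ) x := by
        rw [← integral_const_mul, ← integral_const_mul, ← integral_add
          ((hcK K hK).const_mul _) ((hcK _ (integrable_refl hK)).const_mul _)]
        congr 1; funext x; ring
    _ = θ * (∫ x, conv (refl K) h x * deriv φ x) + (1 - θ) * ∫ x, conv K h x * deriv φ x := by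
        rw [f1, f2]
    -- Outside the unit interval the combination need not equal `c`, but there `deriv φ` vanishes.
    _ = ∫ x, c * deriv φ x := by
        rw [← integral_const_mul, ← integral_const_mul, ← integral_add
          ((hcφ _ (integrable_refl hK)).const_mul _) ((hcφ K hK).const_mul _)]
        congr 1; funext x
        by_cases hx : x ∈ Ioo (0 : ℝ) 1
        · rw [← hc x hx]; ring
        · rw [hφ.deriv.eq_zero hx]; ring
    _ = 0 := by rw [integral_const_mul, hφ.integral_deriv, mul_zero]

end

/-! ### The inf-sup estimate for test functions -/

/-- The space `C_0^∞(0,1)`. -/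
def testFunctions : Submodule ℝ (ℝ → ℝ) where
  carrier := {φ | IsTestFunction φ}
  zero_mem' := .zero
  add_mem' hφ hψ := hφ.add hψ
  smul_mem' c _ hφ := hφ.smul c

/-- The space `L²(0,1)`. -/
abbrev L2Unit : Type := Lp ℝ 2 (volume.restrict (Ioo (0 : ℝ) 1))

theorem memLp_unit_of_continuous {f : ℝ → ℝ} (hf : Continuous f) :
    MemLp f 2 (volume.restrict (Ioo (0 : ℝ) 1)) := by
  obtain ⟨B, hB⟩ := isCompact_Icc.exists_bound_of_continuousOn (s := Icc (0 : ℝ) 1)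
    hf.continuousOn
  refine MemLp.of_bound hf.aestronglyMeasurable B ?_
  filter_upwards [ae_restrict_mem measurableSet_Ioo] with x hx
  exact hB x (Ioo_subset_Icc_self hx)

theorem inner_toLp_unit {f g : ℝ → ℝ} (hf : MemLp f 2 (volume.restrict (Ioo (0 : ℝ) 1)))
    (hg : MemLp g 2 (volume.restrict (Ioo (0 : ℝ) 1))) :
    inner ℝ (hf.toLp f) (hg.toLp g) = ∫ x in Ioo (0 : ℝ) 1, f x * g x := by
  rw [L2.inner_def]
  refine integral_congr_ae ?_
  filter_upwards [hf.coeFn_toLp, hg.coeFn_toLp] with x h1 h2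
  rw [h1, h2]
  simp [mul_comm]

theorem norm_sq_toLp_unit {f : ℝ → ℝ} (hf : MemLp f 2 (volume.restrict (Ioo (0 : ℝ) 1))) :
    ‖hf.toLp f‖ ^ 2 = ∫ x in Ioo (0 : ℝ) 1, f x ^ 2 := by
  rw [← real_inner_self_eq_norm_sq, inner_toLp_unit]
  simp only [sq]

namespace IsTestFunction

theorem deriv_add {φ ψ : ℝ → ℝ} (hφ : IsTestFunction φ) (hψ : IsTestFunction ψ) :
    _root_.deriv (φ + ψ) = _root_.deriv φ + _root_.deriv ψ := by
  funext x
  exact _root_.deriv_add (hφ.differentiable x) (hψ.differentiable x)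

theorem deriv_smul (c : ℝ) {φ : ℝ → ℝ} (hφ : IsTestFunction φ) :
    _root_.deriv (c • φ) = c • _root_.deriv φ := by
  funext x
  exact deriv_const_smul c (hφ.differentiable x)

end IsTestFunction

theorem conv_add {K φ ψ : ℝ → ℝ} (hK : Integrable K) (hφ : IsTestFunction φ)
    (hψ : IsTestFunction ψ) : conv K (φ + ψ) = conv K φ + conv K ψ := by
  funext x
  simp only [conv_apply, Pi.add_apply, mul_add]
  exact integral_add (integrable_kernel_mul hK hφ x) (integrable_kernel_mul hK hψ x)

theorem conv_smul (K : ℝ → ℝ) (c : ℝ) (φ : ℝ → ℝ) : conv K (c • φ) = c • conv K φ := by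
  funext x
  simp only [conv_apply, Pi.smul_apply, smul_eq_mul, mul_left_comm _ c]
  exact integral_const_mul _ _

/-- The derivative of test functions, with values in `L²(0,1)`. -/
def derivTest : testFunctions →ₗ[ℝ] L2Unit where
  toFun φ := MemLp.toLp (deriv φ.1) (memLp_unit_of_continuous φ.2.deriv.continuous)
  map_add' φ ψ := by
    rw [← MemLp.toLp_add]
    exact MemLp.toLp_congr _ _ (by rw [Submodule.coe_add, φ.2.deriv_add ψ.2])
  map_smul' c φ := by
    rw [RingHom.id_apply, ← MemLp.toLp_const_smul]
    exact MemLp.toLp_congr _ _ (by rw [Submodule.coe_smul, φ.2.deriv_smul])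

/-- The convolution of a kernel with the derivative of test functions, in `L²(0,1)`. -/
def convTest (K : ℝ → ℝ) (hK : Integrable K) : testFunctions →ₗ[ℝ] L2Unit where
  toFun φ := MemLp.toLp (conv K (deriv φ.1))
    (memLp_unit_of_continuous (conv_continuous hK φ.2.deriv))
  map_add' φ ψ := by
    rw [← MemLp.toLp_add]
    exact MemLp.toLp_congr _ _ (by
      rw [Submodule.coe_add, φ.2.deriv_add ψ.2, conv_add hK φ.2.deriv ψ.2.deriv])
  map_smul' c φ := by
    rw [RingHom.id_apply, ← MemLp.toLp_const_smul]
    exact MemLp.toLp_congr _ _ (by rw [Submodule.coe_smul, φ.2.deriv_smul, conv_smul])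

/-- The constant function `1` in `L²(0,1)`. -/
def oneUnit : L2Unit := MemLp.toLp (fun _ => 1) (memLp_unit_of_continuous continuous_const)

theorem norm_oneUnit : ‖oneUnit‖ = 1 := by
  have h := norm_sq_toLp_unit (memLp_unit_of_continuous (f := fun _ => 1) continuous_const)
  have h2 : ‖oneUnit‖ ^ 2 = 1 := by rw [oneUnit, h]; simp
  exact (pow_eq_one_iff_of_nonneg (norm_nonneg _) two_ne_zero).1 h2

/-- If `g` and `k` form an acute angle and their convex combination is orthogonal to a vector `h`
not orthogonal to `e`, then it is far from the multiples of `e`. -/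
theorem le_norm_combination_sub_smul {Y : Type*} [NormedAddCommGroup Y] [InnerProductSpace ℝ Y]
    {g k h e : Y} {N M c₀ θ c : ℝ} (h0 : 0 ≤ θ) (h1 : θ ≤ 1) (hN : 0 ≤ N)
    (he : ‖e‖ = 1) (hM : ‖h‖ ≤ M) (hh : 1 ≤ inner ℝ h e)
    (hg : ‖g‖ ^ 2 ≤ N) (hk : ‖k‖ ^ 2 ≤ N)
    (hgk : c₀ * N ≤ inner ℝ g k)
    (horth : inner ℝ h (θ • g + (1 - θ) • k) = 0) :
    c₀ / (2 * (1 + M)) * √N ≤ ‖θ • g + (1 - θ) • k - c • e‖ := by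
  have hM0 : 0 ≤ M := (norm_nonneg h).trans hM
  have hg' : ‖g‖ ≤ √N := Real.le_sqrt_of_sq_le hg
  have hk' : ‖k‖ ≤ √N := Real.le_sqrt_of_sq_le hk
  have hgk' : ‖g + k‖ ≤ 2 * √N := (norm_add_le _ _).trans (by linarith)
  set m := inner ℝ (g + k) e
  set a := inner ℝ h e
  set G := θ • g + (1 - θ) • k
  -- The multiple of `h` makes `H` orthogonal to `e`; since `h` is orthogonal to `G`, the product
  -- with `G` is unaffected.
  set H := g + k - (m / a) • h
  have ha : 0 < a := by linarith
  have hm : |m / a| ≤ 2 * √N := by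
    rw [abs_div, abs_of_pos ha]
    have : |m| ≤ ‖g + k‖ := by simpa [he] using abs_real_inner_le_norm (g + k) e
    exact (div_le_self (abs_nonneg _) hh).trans (this.trans hgk')
  have hH : ‖H‖ ≤ 2 * √N * (1 + M) := by
    refine (norm_sub_le _ _).trans ?_
    rw [norm_smul, Real.norm_eq_abs]
    have := mul_le_mul hm hM (norm_nonneg _) (by positivity)
    linarith
  have hGH : inner ℝ (G - c • e) H = inner ℝ G (g + k) := by
    have e1 : inner ℝ e H = 0 := by
      simp only [H, inner_sub_right, inner_smul_right]
      rw [real_inner_comm _ e, real_inner_comm _ e]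
      change m - m / a * a = 0
      field_simp
      ring
    have e2 : inner ℝ G h = 0 := by rw [real_inner_comm]; exact horth
    rw [inner_sub_left, inner_smul_left, e1, mul_zero, sub_zero]
    simp only [H, inner_sub_right, inner_smul_right, e2, mul_zero, sub_zero]
  -- The mixed terms carry the weights `θ` and `1 - θ`, which add up to one: a full `inner ℝ g k`
  -- survives beside nonnegative squares.
  have hlow : c₀ * N ≤ inner ℝ G (g + k) := by
    simp only [G, inner_add_left, inner_add_right, inner_smul_left, real_inner_self_eq_norm_sq,
      real_inner_comm g k, conj_trivial]
    have h1' : 0 ≤ 1 - θ := by linarith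
    have t1 := mul_nonneg h0 (sq_nonneg ‖g‖)
    have t2 := mul_nonneg h1' (sq_nonneg ‖k‖)
    linarith
  have hup : c₀ * N ≤ ‖G - c • e‖ * (2 * √N * (1 + M)) := by
    rw [← hGH] at hlow
    exact hlow.trans ((real_inner_le_norm _ _).trans
      (mul_le_mul_of_nonneg_left hH (norm_nonneg _)))
  rcases hN.eq_or_lt with h | h
  · rw [← h]; simp
  · have hs : 0 < √N := Real.sqrt_pos.2 h
    rw [div_mul_eq_mul_div, div_le_iff₀ (by positivity)]
    have : √N * √N = N := Real.mul_self_sqrt hN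
    refine le_of_mul_le_mul_right ?_ hs
    calc c₀ * √N * √N = c₀ * N := by rw [mul_assoc, this]
      _ ≤ _ := hup
      _ = _ := by ring

theorem seminormSq_nonneg (μ : ℝ) (φ : ℝ → ℝ) : 0 ≤ seminormSq μ φ :=
  integral_nonneg fun _ => by positivity

theorem rpow_sub_one_bounds {p β x : ℝ} (hp : 1 - β ≤ p) (hp1 : p ≤ 1) (hx : x ∈ Ioo (0 : ℝ) 1) :
    1 ≤ x ^ (p - 1) ∧ x ^ (p - 1) ≤ x ^ (-β) :=
  ⟨one_le_rpow_of_pos_of_le_one_of_nonpos hx.1 hx.2.le (by linarith),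
    rpow_le_rpow_of_exponent_ge hx.1 hx.2.le (by linarith)⟩

section

variable {β : ℝ}

/-- Both exponents lie in `[-β, 0]`. The lower bound keeps the weight away from orthogonality to the
constants; the upper one is independent of `p` and `q`, which makes the final constant independent
of `θ`. -/
theorem betaWeight_bounds {p q x : ℝ} (hp : 1 - β ≤ p) (hp1 : p ≤ 1) (hq : 1 - β ≤ q)
    (hq1 : q ≤ 1) (hx : x ∈ Ioo (0 : ℝ) 1) :
    1 ≤ betaWeight p q x ∧ betaWeight p q x ^ 2 ≤ betaWeight (1 - 2 * β) (1 - 2 * β) x := by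
  have hx' : 1 - x ∈ Ioo (0 : ℝ) 1 := by constructor <;> linarith [hx.1, hx.2]
  obtain ⟨a1, a2⟩ := rpow_sub_one_bounds hp hp1 hx
  obtain ⟨b1, b2⟩ := rpow_sub_one_bounds hq hq1 hx'
  refine ⟨one_le_mul_of_one_le_of_one_le a1 b1, ?_⟩
  have e : ∀ y : ℝ, 0 < y → y ^ (1 - 2 * β - 1) = (y ^ (-β)) ^ 2 := fun y hy => by
    rw [← rpow_natCast, ← rpow_mul hy.le]; congr 1; push_cast; ring
  rw [betaWeight, betaWeight, e x hx.1, e _ hx'.1, ← mul_pow]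
  gcongr
  exact zero_le_one.trans (a1.trans a2)

theorem memLp_betaWeight (hβ1 : β < 1 / 2) {p q : ℝ} (hp : 1 - β ≤ p) (hp1 : p ≤ 1)
    (hq : 1 - β ≤ q) (hq1 : q ≤ 1) :
    MemLp (betaWeight p q) 2 (volume.restrict (Ioo (0 : ℝ) 1)) := by
  have hm : Measurable (betaWeight p q) := by unfold betaWeight; fun_prop
  refine (memLp_two_iff_integrable_sq hm.aestronglyMeasurable).2 ?_
  refine Integrable.mono' (integrableOn_betaWeight (p := 1 - 2 * β) (q := 1 - 2 * β)
    (by linarith) (by linarith)) (hm.pow_const 2).aestronglyMeasurable ?_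
  filter_upwards [ae_restrict_mem measurableSet_Ioo] with x hx
  rw [Real.norm_of_nonneg (sq_nonneg _)]
  exact (betaWeight_bounds hp hp1 hq hq1 hx).2

/-- The bound for the inf-sup constant of the seminorms. -/
def infSupConst (β : ℝ) : ℝ :=
  cos (π * β) / (2 * (1 + √(∫ x in Ioo (0 : ℝ) 1, betaWeight (1 - 2 * β) (1 - 2 * β) x)))

theorem cos_pi_mul_pos (hβ : 0 < β) (hβ1 : β < 1 / 2) : 0 < cos (π * β) :=
  cos_pos_of_mem_Ioo ⟨by nlinarith [pi_pos], by nlinarith [pi_pos]⟩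

theorem infSupConst_pos (hβ : 0 < β) (hβ1 : β < 1 / 2) : 0 < infSupConst β :=
  div_pos (cos_pi_mul_pos hβ hβ1) (by positivity)

/-- Inf-sup estimate for test functions: the two-sided fractional derivative stays away from the
constants. -/
theorem infSup_test (hβ : 0 < β) (hβ1 : β < 1 / 2) {θ : ℝ} (h0 : 0 ≤ θ) (h1 : θ ≤ 1)
    (φ : testFunctions) (c : ℝ) :
    infSupConst β * √(seminormSq (1 - β) φ.1) ≤
      ‖θ • convTest (intervalKernel β) (integrable_intervalKernel hβ) φ +
        (1 - θ) • convTest (refl (intervalKernel β))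
          (integrable_refl (integrable_intervalKernel hβ)) φ - c • oneUnit‖ := by
  obtain ⟨p, q, hp, hp1, hq, hq1, hann⟩ := exists_betaWeight_annihilates hβ (by linarith) h0 h1
  have hL := integral_left_sq_le hβ hβ1.le φ.2
  have hR := integral_right_sq_le hβ hβ1.le φ.2
  have hLR := seminormSq_le_integral_left_mul_right hβ hβ1.le φ.2
  have mh := memLp_betaWeight hβ1 hp hp1 hq hq1
  have mg := memLp_unit_of_continuous
    (conv_continuous (integrable_intervalKernel hβ) φ.2.deriv)
  have mk := memLp_unit_of_continuous
    (conv_continuous (integrable_refl (integrable_intervalKernel hβ)) φ.2.deriv)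
  have hint : Integrable (betaWeight p q) (volume.restrict (Ioo (0 : ℝ) 1)) :=
    mh.integrable one_le_two
  have hmono : ∫ x in Ioo (0 : ℝ) 1, betaWeight p q x ^ 2 ≤
      ∫ x in Ioo (0 : ℝ) 1, betaWeight (1 - 2 * β) (1 - 2 * β) x :=
    setIntegral_mono_on mh.integrable_sq
      (integrableOn_betaWeight (by linarith) (by linarith)) measurableSet_Ioo
      fun x hx => (betaWeight_bounds hp hp1 hq hq1 hx).2
  have hone : 1 ≤ ∫ x in Ioo (0 : ℝ) 1, betaWeight p q x * 1 := by
    have : ∫ x in Ioo (0 : ℝ) 1, (1 : ℝ) = 1 := by simp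
    refine this.symm.trans_le ?_
    simp only [mul_one]
    exact setIntegral_mono_on (integrable_const _) hint measurableSet_Ioo
      fun x hx => (betaWeight_bounds hp hp1 hq hq1 hx).1
  have hcomb : θ • convTest (intervalKernel β) (integrable_intervalKernel hβ) φ +
      (1 - θ) • convTest (refl (intervalKernel β))
        (integrable_refl (integrable_intervalKernel hβ)) φ =
      MemLp.toLp _ ((mg.const_smul θ).add (mk.const_smul (1 - θ))) := rfl
  refine le_norm_combination_sub_smul (h := mh.toLp _) h0 h1 (seminormSq_nonneg _ _)
    norm_oneUnit ?_ ?_ ?_ ?_ ?_ ?_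
  · refine Real.le_sqrt_of_sq_le ?_
    rw [norm_sq_toLp_unit]
    exact hmono
  · rw [oneUnit, inner_toLp_unit]
    exact hone
  · exact (norm_sq_toLp_unit mg).trans_le hL
  · exact (norm_sq_toLp_unit mk).trans_le hR
  · exact hLR.trans_eq (inner_toLp_unit mg mk).symm
  · rw [hcomb, inner_toLp_unit]
    exact hann φ.1 φ.2

end

/-! ### Embedding of test functions, density and completeness -/

namespace IsTestFunction

variable {φ : ℝ → ℝ}

/-- A test function as an element of `L²(ℝ)`. -/
def toL2 (hφ : IsTestFunction φ) : Lp ℝ 2 (volume : Measure ℝ) := hφ.memLp_two.toLp φ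

theorem complexify_toL2 (hφ : IsTestFunction φ) :
    complexify hφ.toL2 = hφ.schwartz.toLp 2 volume := by
  refine Lp.ext ?_
  filter_upwards [ContinuousLinearMap.coeFn_compLpL (p := 2) (μ := volume) Complex.ofRealCLM
    hφ.toL2, hφ.schwartz.coeFn_toLp 2 volume, hφ.memLp_two.coeFn_toLp] with x h1 h2 h3
  rw [h2, complexify, h1, toL2, h3]
  rfl

/-- The transform on `L²` agrees with the integral on Schwartz functions; this ties the Sobolev
norms to `seminormSq`. -/
theorem coeFn_fourierL2 (hφ : IsTestFunction φ) : fourierL2 hφ.toL2 =ᵐ[volume] fhat φ := by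
  rw [fourierL2, hφ.complexify_toL2, SchwartzMap.toLp_fourier_eq]
  exact (𝓕 hφ.schwartz : SchwartzMap ℝ ℂ).coeFn_toLp 2 volume

theorem weightedFourier_ae (hφ : IsTestFunction φ) (μ : ℝ) :
    weightedFourier μ hφ.toL2 =ᵐ[volume]
      fun ξ => ((|2 * π * ξ| ^ μ : ℝ) : ℂ) * fhat φ ξ := by
  filter_upwards [hφ.coeFn_fourierL2] with ξ h
  rw [weightedFourier, h]

theorem norm_weight_sq (φ : ℝ → ℝ) (μ ξ : ℝ) :
    ‖((|2 * π * ξ| ^ μ : ℝ) : ℂ) * fhat φ ξ‖ ^ 2 =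
      |2 * π * ξ| ^ (2 * μ) * ‖fhat φ ξ‖ ^ 2 := by
  rw [norm_mul, mul_pow, Complex.norm_real, Real.norm_of_nonneg (by positivity), ← rpow_natCast,
    ← rpow_mul (abs_nonneg _), mul_comm μ]
  norm_cast

theorem memLp_weightedFourier (hφ : IsTestFunction φ) {μ : ℝ} (h0 : 0 ≤ μ) (h1 : μ ≤ 1) :
    MemLp (weightedFourier μ hφ.toL2) 2 volume := by
  refine (memLp_congr_ae (hφ.weightedFourier_ae μ)).2 ?_
  refine (memLp_two_iff_integrable_sq_norm ?_).2 ?_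
  · refine Continuous.aestronglyMeasurable (Continuous.mul ?_ hφ.continuous_fourier)
    refine Complex.continuous_ofReal.comp ?_
    exact (by fun_prop : Continuous fun ξ : ℝ => |2 * π * ξ|).rpow_const fun _ => Or.inr h0
  · simp only [norm_weight_sq]
    exact hφ.integrable_seminorm h0 h1

end IsTestFunction

/-- The embedding of `C_0^∞(0,1)` into `H^μ_0(0,1)`. -/
def embTest {μ : ℝ} (h0 : 0 ≤ μ) (h1 : μ ≤ 1) : testFunctions →ₗ[ℝ] SobolevZero μ where
  toFun φ := ⟨(⟨φ.2.toL2, φ.2.memLp_weightedFourier h0 h1⟩ : ↥(sobolevSubmodule μ)),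
    (testSubmodule μ).le_topologicalClosure ⟨φ.1, φ.2, φ.2.memLp_two.coeFn_toLp⟩⟩
  map_add' φ ψ := by
    apply Subtype.ext
    apply SobolevR.toL2_injective
    exact MemLp.toLp_add φ.2.memLp_two ψ.2.memLp_two
  map_smul' c φ := by
    apply Subtype.ext
    apply SobolevR.toL2_injective
    exact MemLp.toLp_const_smul c φ.2.memLp_two

section

variable {μ : ℝ} (h0 : 0 ≤ μ) (h1 : μ ≤ 1)

theorem toL2_embTest (φ : testFunctions) :
    SobolevR.toL2 (embTest h0 h1 φ : SobolevR μ) = φ.2.toL2 := rfl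

theorem fn_embTest (φ : testFunctions) : (embTest h0 h1 φ).fn =ᵐ[volume] φ.1 :=
  φ.2.memLp_two.coeFn_toLp

theorem norm_sq_toLp {α E : Type*} [MeasurableSpace α] [NormedAddCommGroup E] {ν : Measure α}
    {f : α → E} (hf : MemLp f 2 ν) : ‖hf.toLp f‖ ^ 2 = ∫ x, ‖f x‖ ^ 2 ∂ν := by
  rw [Lp.norm_toLp, hf.eLpNorm_eq_integral_rpow_norm two_ne_zero ENNReal.ofNat_ne_top,
    ENNReal.toReal_ofReal (by positivity), ← rpow_natCast, ← rpow_mul (by positivity)]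
  simp

theorem norm_sq_embTest (φ : testFunctions) :
    ‖embTest h0 h1 φ‖ ^ 2 = (∫ x, φ.1 x ^ 2) + seminormSq μ φ.1 := by
  rw [Submodule.coe_norm, SobolevR.norm_sq_eq, toL2_embTest,
    show φ.2.toL2 = φ.2.memLp_two.toLp φ.1 from rfl, norm_sq_toLp]
  have e : SobolevR.weighted (embTest h0 h1 φ : SobolevR μ) =
      MemLp.toLp _ (φ.2.memLp_weightedFourier h0 h1) := rfl
  rw [e, norm_sq_toLp, seminormSq]
  congr 1
  · simp
  · refine integral_congr_ae ?_
    filter_upwards [φ.2.weightedFourier_ae μ] with ξ h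
    rw [h, IsTestFunction.norm_weight_sq]

theorem seminormSq_le_norm_sq (φ : testFunctions) :
    seminormSq μ φ.1 ≤ ‖embTest h0 h1 φ‖ ^ 2 := by
  rw [norm_sq_embTest]
  have : 0 ≤ ∫ x, φ.1 x ^ 2 := integral_nonneg fun x => sq_nonneg _
  linarith

/-- The constant is `2 + 1`: the `L²` part costs two copies of the seminorm by
`IsTestFunction.integral_sq_le`. -/
theorem norm_sq_le_seminormSq (φ : testFunctions) :
    ‖embTest h0 h1 φ‖ ^ 2 ≤ 3 * seminormSq μ φ.1 := by
  rw [norm_sq_embTest]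
  have := φ.2.integral_sq_le h0 h1
  linarith

theorem denseRange_embTest : DenseRange (embTest h0 h1) := by
  intro x
  rw [Metric.mem_closure_iff]
  intro ε hε
  obtain ⟨y, hy, hxy⟩ := Metric.mem_closure_iff.1 x.2 ε hε
  obtain ⟨φ, hφ, hφy⟩ := hy
  refine ⟨_, ⟨⟨φ, hφ⟩, rfl⟩, ?_⟩
  have : (embTest h0 h1 ⟨φ, hφ⟩ : SobolevR μ) = y := by
    apply SobolevR.toL2_injective
    rw [toL2_embTest]
    exact Lp.ext (hφ.memLp_two.coeFn_toLp.trans hφy.symm)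
  rw [Subtype.dist_eq, this]
  exact hxy

end

namespace SobolevR

variable {μ : ℝ}

theorem norm_toL2_le (w : SobolevR μ) : ‖toL2 w‖ ≤ ‖w‖ :=
  le_of_sq_le_sq (by rw [norm_sq_eq]; nlinarith [sq_nonneg ‖weighted w‖]) (norm_nonneg _)

theorem norm_weighted_le (w : SobolevR μ) : ‖weighted w‖ ≤ ‖w‖ :=
  le_of_sq_le_sq (by rw [norm_sq_eq]; nlinarith [sq_nonneg ‖toL2 w‖]) (norm_nonneg _)

/-- The inclusion `H^μ(ℝ) ⊆ L²(ℝ)` is continuous. -/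
def toL2CLM : SobolevR μ →L[ℝ] Lp ℝ 2 (volume : Measure ℝ) :=
  toL2.mkContinuous 1 fun w => by simpa using norm_toL2_le w

/-- The map `w ↦ |ω| ^ μ * 𝓕 w` is continuous. -/
def weightedCLM : SobolevR μ →L[ℝ] Lp ℂ 2 (volume : Measure ℝ) :=
  weighted.mkContinuous 1 fun w => by simpa using norm_weighted_le w

theorem coeFn_weighted (w : SobolevR μ) :
    weighted w =ᵐ[volume] weightedFourier μ (toL2 w) := (memLp_weighted w).coeFn_toLp

theorem continuous_fourierL2 : Continuous fourierL2 :=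
  (Lp.fourierTransformₗᵢ ℝ ℂ).continuous.comp complexify.continuous

theorem exists_subseq_ae {E : Type*} [NormedAddCommGroup E] {f : ℕ → Lp E 2 (volume : Measure ℝ)}
    {g : Lp E 2 (volume : Measure ℝ)} (h : Tendsto f atTop (𝓝 g)) :
    ∃ ns : ℕ → ℕ, StrictMono ns ∧
      ∀ᵐ x, Tendsto (fun i => f (ns i) x) atTop (𝓝 (g x)) :=
  (tendstoInMeasure_of_tendsto_Lp h).exists_seq_tendsto_ae

/-- Multiplication by `|ω|^μ` after the Fourier transform is a closed operator: along a subsequence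
everything converges almost everywhere, so the limit of the weighted transforms is the weighted
transform of the limit. -/
instance : CompleteSpace (SobolevR μ) := by
  refine Metric.complete_of_cauchySeq_tendsto fun u hu => ?_
  obtain ⟨w, hw⟩ := cauchySeq_tendsto_of_complete (toL2CLM.uniformContinuous.comp_cauchySeq hu)
  obtain ⟨z, hz⟩ := cauchySeq_tendsto_of_complete (weightedCLM.uniformContinuous.comp_cauchySeq hu)
  have hF : Tendsto (fun n => fourierL2 (toL2 (u n))) atTop (𝓝 (fourierL2 w)) :=
    (continuous_fourierL2.tendsto w).comp hw
  obtain ⟨ns, hns, h1⟩ := exists_subseq_ae hF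
  obtain ⟨ms, hms, h2⟩ := exists_subseq_ae (f := fun i => weighted (u (ns i)))
    (hz.comp hns.tendsto_atTop)
  have hwz : weightedFourier μ w =ᵐ[volume] z := by
    have h3 : ∀ᵐ ξ, ∀ n, weighted (u n) ξ = weightedFourier μ (toL2 (u n)) ξ :=
      ae_all_iff.2 fun n => coeFn_weighted (u n)
    filter_upwards [h1, h2, h3] with ξ a1 a2 a3
    simp only [a3, weightedFourier] at a2
    exact tendsto_nhds_unique ((a1.comp hms.tendsto_atTop).const_mul _) a2
  have hmem : MemLp (weightedFourier μ w) 2 volume := (memLp_congr_ae hwz).2 (Lp.memLp z)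
  set x : SobolevR μ := (⟨w, hmem⟩ : ↥(sobolevSubmodule μ))
  have hxz : weighted x = z := Lp.ext ((coeFn_weighted x).trans hwz)
  refine ⟨x, ?_⟩
  rw [tendsto_iff_norm_sub_tendsto_zero]
  have e : ∀ n, ‖u n - x‖ = √(‖toL2 (u n) - w‖ ^ 2 + ‖weighted (u n) - z‖ ^ 2) := fun n => by
    rw [← hxz, ← map_sub, show w = toL2 x from rfl, ← map_sub, ← norm_sq_eq,
      Real.sqrt_sq (norm_nonneg _)]
  simp only [e]
  have a1 : Tendsto (fun n => ‖toL2 (u n) - w‖) atTop (𝓝 0) :=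
    tendsto_iff_norm_sub_tendsto_zero.1 hw
  have a2 : Tendsto (fun n => ‖weighted (u n) - z‖) atTop (𝓝 0) :=
    tendsto_iff_norm_sub_tendsto_zero.1 hz
  have := ((a1.pow 2).add (a2.pow 2)).sqrt
  simpa using this

end SobolevR

instance (μ : ℝ) : CompleteSpace (SobolevZero μ) :=
  (Submodule.isClosed_topologicalClosure _).completeSpace_coe

/-- The restriction of elements of `H^μ_0(0,1)` to the unit interval. -/
def restrictUnit (μ : ℝ) : SobolevZero μ →L[ℝ] L2Unit :=
  (LpToLpRestrictCLM ℝ ℝ ℝ volume 2 (Ioo (0 : ℝ) 1)).comp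
    (SobolevR.toL2CLM.comp (testSubmodule μ).topologicalClosure.subtypeL)

theorem coeFn_restrictUnit {μ : ℝ} (w : SobolevZero μ) :
    restrictUnit μ w =ᵐ[volume.restrict (Ioo (0 : ℝ) 1)] w.fn :=
  LpToLpRestrictCLM_coeFn ℝ (Ioo (0 : ℝ) 1) (SobolevR.toL2 (w : SobolevR μ))

theorem memLp_fn {μ : ℝ} (w : SobolevZero μ) : MemLp w.fn 2 volume :=
  Lp.memLp (SobolevR.toL2 (w : SobolevR μ))

/-! ### Weak derivatives and the continuous operators behind the form -/

/-- Young's inequality for the convolution of an integrable and a square integrable function. -/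
theorem memLp_conv {K f : ℝ → ℝ} (hK : Integrable K) (hf : Integrable f) (hf2 : MemLp f 2 volume) :
    MemLp (conv K f) 2 volume := by
  have hc := conv_integrable hK hf
  refine (memLp_two_iff_integrable_sq hc.aestronglyMeasurable).2 ?_
  have hsq : Integrable fun x => f x ^ 2 := hf2.integrable_sq
  have hKf := hK.abs.integrable_convolution (ContinuousLinearMap.mul ℝ ℝ) hsq
  refine Integrable.mono' (hKf.const_mul (∫ t, |K t|)) (hc.aestronglyMeasurable.pow 2) ?_
  filter_upwards [hK.abs.ae_convolution_exists (ContinuousLinearMap.mul ℝ ℝ) hsq,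
    hK.ae_convolution_exists (ContinuousLinearMap.mul ℝ ℝ) hf] with x hx hx1
  have hx' : Integrable fun t => |K t| * f (x - t) ^ 2 := hx
  have hx1' : Integrable fun t => K t * f (x - t) := hx1
  rw [Real.norm_of_nonneg (sq_nonneg _)]
  -- Cauchy-Schwarz for `|K f| = √|K| · √(|K| f²)`; the second factor is square integrable for
  -- almost every `x` since `|K| * f²` is a convolution of integrable functions.
  set a : ℝ → ℝ := fun t => √|K t|
  set b : ℝ → ℝ := fun t => √(|K t| * f (x - t) ^ 2)
  have ha : MemLp a 2 volume := by
    refine (memLp_two_iff_integrable_sq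
      (continuous_sqrt.comp_aestronglyMeasurable hK.abs.aestronglyMeasurable)).2 ?_
    simpa only [a, Real.sq_sqrt (abs_nonneg _)] using hK.abs
  have hb : MemLp b 2 volume := by
    refine (memLp_two_iff_integrable_sq
      (continuous_sqrt.comp_aestronglyMeasurable hx'.aestronglyMeasurable)).2 ?_
    simpa only [b, Real.sq_sqrt (mul_nonneg (abs_nonneg _) (sq_nonneg _))] using hx'
  have hab : ∀ t, a t * b t = |K t * f (x - t)| := fun t => by
    simp only [a, b]
    rw [← Real.sqrt_mul (abs_nonneg _), ← mul_assoc, Real.sqrt_mul (by positivity),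
      Real.sqrt_mul_self (abs_nonneg _), Real.sqrt_sq_eq_abs, abs_mul]
  have h := integral_mul_le_Lp_mul_Lq_of_nonneg (μ := volume) Real.HolderConjugate.two_two
    (f := a) (g := b) (Eventually.of_forall fun t => sqrt_nonneg _)
    (Eventually.of_forall fun t => sqrt_nonneg _) (by simpa using ha) (by simpa using hb)
  simp only [hab, rpow_two, a, b, Real.sq_sqrt (abs_nonneg _),
    Real.sq_sqrt (mul_nonneg (abs_nonneg _) (sq_nonneg _)), ← Real.sqrt_eq_rpow] at h
  have h2 : |conv K f x| ≤ √(∫ t, |K t|) * √(∫ t, |K t| * f (x - t) ^ 2) :=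
    (abs_integral_le_integral_abs).trans h
  rw [← Real.sqrt_mul (integral_nonneg fun _ => abs_nonneg _)] at h2
  have h3 := (Real.le_sqrt (abs_nonneg _) (mul_nonneg (integral_nonneg fun _ => abs_nonneg _)
    (integral_nonneg fun _ => mul_nonneg (abs_nonneg _) (sq_nonneg _)))).1 h2
  rw [sq_abs] at h3
  exact h3

/-- The fundamental lemma of the calculus of variations. It makes the arbitrary choice inside
`weakDeriv` harmless. -/
theorem HasWeakDeriv.ae_eq {u g g' : ℝ → ℝ} (h : HasWeakDeriv u g) (h' : HasWeakDeriv u g') :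
    g =ᵐ[volume.restrict (Ioo (0 : ℝ) 1)] g' := by
  have hint : ∀ {g : ℝ → ℝ} {φ : ℝ → ℝ}, LocallyIntegrableOn g (Ioo 0 1) → IsTestFunction φ →
      Integrable (fun x => g x * φ x) (volume.restrict (Ioo (0 : ℝ) 1)) := by
    intro g φ hg hφ
    have h1 : IntegrableOn g (tsupport φ) :=
      hg.integrableOn_compact_subset hφ.tsupport_subset hφ.hasCompactSupport
    obtain ⟨B, hB⟩ := hφ.bounded
    have h2 : IntegrableOn (fun x => g x * φ x) (tsupport φ) :=
      Integrable.mul_bdd h1 hφ.continuous.aestronglyMeasurable (Eventually.of_forall hB)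
    refine ((integrableOn_iff_integrable_of_support_subset ?_).1 h2).integrableOn
    exact (Function.support_mul_subset_right _ _).trans subset_closure
  have key := isOpen_Ioo.ae_eq_zero_of_integral_contDiff_smul_eq_zero (U := Ioo (0 : ℝ) 1)
    (f := g - g') (μ := volume) (h.2.1.sub h'.2.1) fun φ h1 h2 h3 => by
      have hφ : IsTestFunction φ := ⟨h1, h2, h3⟩
      have e := (h.2.2 φ hφ).symm.trans (h'.2.2 φ hφ)
      have e2 : ∫ x, φ x • (g - g') x =
          ∫ x in Ioo (0 : ℝ) 1, (g x * φ x - g' x * φ x) := by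
        rw [← setIntegral_eq_integral_of_forall_compl_eq_zero (s := Ioo (0 : ℝ) 1)]
        · congr 1; funext x; simp only [Pi.sub_apply, smul_eq_mul]; ring
        · intro x hx; simp [hφ.eq_zero hx]
      rw [e2, integral_sub (hint h.2.1 hφ) (hint h'.2.1 hφ)]
      linarith
  rw [Filter.EventuallyEq, ae_restrict_iff' measurableSet_Ioo]
  filter_upwards [key] with x hx hx'
  exact sub_eq_zero.1 (hx hx')

theorem HasWeakDeriv.weakDeriv_ae {u g : ℝ → ℝ} (h : HasWeakDeriv u g) :
    weakDeriv u =ᵐ[volume.restrict (Ioo (0 : ℝ) 1)] g := by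
  have hex : ∃ g, HasWeakDeriv u g := ⟨g, h⟩
  rw [weakDeriv, dif_pos hex]
  exact hex.choose_spec.ae_eq h

theorem locallyIntegrableOn_of_memLp {f : ℝ → ℝ}
    (hf : MemLp f 2 (volume.restrict (Ioo (0 : ℝ) 1))) : LocallyIntegrableOn f (Ioo 0 1) :=
  IntegrableOn.locallyIntegrableOn (hf.integrable one_le_two)

/-- The weak derivative as a continuous operator on `H^1_0(0,1)`. -/
def derivCLM : SobolevZero 1 →L[ℝ] L2Unit :=
  derivTest.extendOfNorm (embTest zero_le_one le_rfl)

theorem norm_sq_derivTest (φ : testFunctions) : ‖derivTest φ‖ ^ 2 = seminormSq 1 φ.1 := by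
  have h : ‖derivTest φ‖ ^ 2 = ∫ x in Ioo (0 : ℝ) 1, deriv φ.1 x ^ 2 :=
    norm_sq_toLp_unit (memLp_unit_of_continuous φ.2.deriv.continuous)
  rw [h, setIntegral_eq_integral_of_forall_compl_eq_zero, φ.2.deriv.integral_sq, seminormSq]
  · simp only [φ.2.norm_fourier_deriv, mul_one, rpow_two]
  · intro x hx; simp [φ.2.deriv.eq_zero hx]

theorem norm_derivTest_le (φ : testFunctions) :
    ‖derivTest φ‖ ≤ 1 * ‖embTest zero_le_one le_rfl φ‖ := by
  rw [one_mul]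
  exact le_of_sq_le_sq (by rw [norm_sq_derivTest]; exact seminormSq_le_norm_sq _ _ φ)
    (norm_nonneg _)

theorem derivCLM_embTest (φ : testFunctions) :
    derivCLM (embTest zero_le_one le_rfl φ) = derivTest φ :=
  LinearMap.extendOfNorm_eq (denseRange_embTest _ _) ⟨1, norm_derivTest_le⟩ φ

theorem norm_derivCLM_le (v : SobolevZero 1) : ‖derivCLM v‖ ≤ ‖v‖ := by
  have h := LinearMap.norm_extendOfNorm_apply_le (denseRange_embTest _ _) 1 norm_derivTest_le v
  rwa [one_mul] at h

/-- The Poincaré inequality. -/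
theorem norm_le_norm_derivCLM (v : SobolevZero 1) : ‖v‖ ≤ 2 * ‖derivCLM v‖ := by
  refine (denseRange_embTest zero_le_one le_rfl).induction_on
    (p := fun v => ‖v‖ ≤ 2 * ‖derivCLM v‖) v (isClosed_le (by fun_prop) (by fun_prop)) fun φ => ?_
  rw [derivCLM_embTest]
  refine le_of_sq_le_sq ?_ (by positivity)
  rw [mul_pow, norm_sq_derivTest]
  -- The factor `2` comes from `3 ≤ 2²`.
  have := norm_sq_le_seminormSq zero_le_one le_rfl φ
  have := seminormSq_nonneg 1 φ.1
  linarith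

/-- Integrals against a fixed square integrable function as a continuous functional. -/
theorem inner_restrictUnit {μ : ℝ} (w : SobolevZero μ) {f : ℝ → ℝ}
    (hf : MemLp f 2 (volume.restrict (Ioo (0 : ℝ) 1))) :
    inner ℝ (restrictUnit μ w) (hf.toLp f) = ∫ x in Ioo (0 : ℝ) 1, w.fn x * f x := by
  rw [L2.inner_def]
  refine integral_congr_ae ?_
  filter_upwards [coeFn_restrictUnit w, hf.coeFn_toLp] with x h1 h2
  rw [h1, h2]
  simp [mul_comm]

theorem inner_unit_toLp (g : L2Unit) {f : ℝ → ℝ}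
    (hf : MemLp f 2 (volume.restrict (Ioo (0 : ℝ) 1))) :
    inner ℝ g (hf.toLp f) = ∫ x in Ioo (0 : ℝ) 1, g x * f x := by
  rw [L2.inner_def]
  refine integral_congr_ae ?_
  filter_upwards [hf.coeFn_toLp] with x h2
  rw [h2]
  simp [mul_comm]

theorem IsTestFunction.integral_mul_deriv {φ u u' : ℝ → ℝ} (hφ : IsTestFunction φ)
    (hu : ∀ x, HasDerivAt u (u' x) x) (hu' : Continuous u') :
    ∫ x in Ioo (0 : ℝ) 1, u x * _root_.deriv φ x = -∫ x in Ioo (0 : ℝ) 1, u' x * φ x := by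
  have huc : Continuous u := continuous_iff_continuousAt.2 fun x => (hu x).continuousAt
  have hi : ∀ {a b : ℝ → ℝ}, Continuous a → IsTestFunction b → Integrable (a * b) :=
    fun ha hb => (ha.mul hb.continuous).integrable_of_hasCompactSupport hb.hasCompactSupport.mul_left
  rw [setIntegral_eq_integral_of_forall_compl_eq_zero,
    setIntegral_eq_integral_of_forall_compl_eq_zero]
  · exact integral_mul_deriv_eq_deriv_mul_of_integrable (fun x _ => hu x)
      (fun x _ => (hφ.differentiable x).hasDerivAt) (hi huc hφ.deriv) (hi hu' hφ) (hi huc hφ)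
  · intro x hx; simp [hφ.eq_zero hx]
  · intro x hx; simp [hφ.deriv.eq_zero hx]

/-- For a fixed test function both sides are continuous in `v`, so density reduces the claim to
classical integration by parts. -/
theorem hasWeakDeriv_derivCLM (v : SobolevZero 1) : HasWeakDeriv v.fn (derivCLM v) := by
  refine ⟨locallyIntegrableOn_of_memLp ((memLp_fn v).restrict _),
    locallyIntegrableOn_of_memLp (Lp.memLp _), fun φ hφ => ?_⟩
  have m1 := memLp_unit_of_continuous hφ.deriv.continuous
  have m2 := memLp_unit_of_continuous hφ.continuous
  rw [← inner_restrictUnit v m1, ← inner_unit_toLp _ m2]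
  refine (denseRange_embTest zero_le_one le_rfl).induction_on
    (p := fun v => inner ℝ (restrictUnit 1 v) (m1.toLp _) = -inner ℝ (derivCLM v) (m2.toLp _)) v
    (isClosed_eq (by fun_prop) (by fun_prop)) fun ψ => ?_
  rw [derivCLM_embTest, inner_restrictUnit, show derivTest ψ = MemLp.toLp (deriv ψ.1)
    (memLp_unit_of_continuous ψ.2.deriv.continuous) from rfl, inner_toLp_unit,
    ← hφ.integral_mul_deriv (fun x => (ψ.2.differentiable x).hasDerivAt) ψ.2.deriv.continuous]
  refine integral_congr_ae ?_
  filter_upwards [ae_restrict_of_ae (fn_embTest zero_le_one le_rfl ψ)] with x hx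
  rw [hx]

theorem memSobolevOne_fn (v : SobolevZero 1) : MemSobolevOne v.fn :=
  ⟨(memLp_fn v).restrict _, _, hasWeakDeriv_derivCLM v, Lp.memLp _⟩

theorem hasDerivAt_conv {K φ : ℝ → ℝ} (hK : Integrable K) (hφ : IsTestFunction φ) (x : ℝ) :
    HasDerivAt (conv K φ) (conv K (deriv φ) x) x :=
  hφ.hasCompactSupport.hasDerivAt_convolution_right (ContinuousLinearMap.mul ℝ ℝ)
    hK.locallyIntegrable (hφ.smooth.of_le (by simp)) x

/-- The transpose of a convolution operator on the unit interval. -/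
theorem setIntegral_conv_indicator_mul {K f ψ : ℝ → ℝ} (hK : Integrable K)
    (hf : Integrable f (volume.restrict (Ioo (0 : ℝ) 1))) (hψ : IsTestFunction ψ) :
    ∫ x in Ioo (0 : ℝ) 1, conv K ((Ioo (0 : ℝ) 1).indicator f) x * ψ x =
      ∫ x in Ioo (0 : ℝ) 1, f x * conv (refl K) ψ x := by
  obtain ⟨B, hB⟩ := hψ.bounded
  rw [setIntegral_eq_integral_of_forall_compl_eq_zero, integral_conv_mul hK
    ((integrable_indicator_iff measurableSet_Ioo).2 hf) hψ.continuous hB,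
    ← integral_indicator measurableSet_Ioo]
  · congr 1
    funext x
    by_cases hx : x ∈ Ioo (0 : ℝ) 1 <;> simp [hx]
  · intro x hx; simp [hψ.eq_zero hx]

section convDeriv

variable {K : ℝ → ℝ} {μ : ℝ}

/-- The extension of `φ ↦ K * φ'` from test functions to `H^μ_0(0,1)`. -/
def convDeriv (hK : Integrable K) (h0 : 0 ≤ μ) (h1 : μ ≤ 1) : SobolevZero μ →L[ℝ] L2Unit :=
  (convTest K hK).extendOfNorm (embTest h0 h1)

variable (hK : Integrable K) (h0 : 0 ≤ μ) (h1 : μ ≤ 1)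

theorem norm_convTest_le (hb : ∀ φ, IsTestFunction φ →
    ∫ x in Ioo (0 : ℝ) 1, conv K (deriv φ) x ^ 2 ≤ seminormSq μ φ) (φ : testFunctions) :
    ‖convTest K hK φ‖ ≤ 1 * ‖embTest h0 h1 φ‖ := by
  rw [one_mul]
  refine le_of_sq_le_sq ?_ (norm_nonneg _)
  have h : ‖convTest K hK φ‖ ^ 2 = _ :=
    norm_sq_toLp_unit (memLp_unit_of_continuous (conv_continuous hK φ.2.deriv))
  rw [h]
  exact (hb φ.1 φ.2).trans (seminormSq_le_norm_sq h0 h1 φ)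

variable (hb : ∀ φ, IsTestFunction φ →
    ∫ x in Ioo (0 : ℝ) 1, conv K (deriv φ) x ^ 2 ≤ seminormSq μ φ)

include hb

theorem convDeriv_embTest (φ : testFunctions) :
    convDeriv hK h0 h1 (embTest h0 h1 φ) = convTest K hK φ :=
  LinearMap.extendOfNorm_eq (denseRange_embTest _ _) ⟨1, norm_convTest_le hK h0 h1 hb⟩ φ

theorem norm_convDeriv_le (w : SobolevZero μ) : ‖convDeriv hK h0 h1 w‖ ≤ ‖w‖ := by
  have h := LinearMap.norm_extendOfNorm_apply_le (denseRange_embTest _ _) 1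
    (norm_convTest_le hK h0 h1 hb) w
  rwa [one_mul] at h

/-- Transposing the kernel onto `deriv ψ` exhibits the left side as a continuous functional of `w`.
Density then reduces to test functions, where differentiation commutes with convolution. -/
theorem integral_conv_mul_deriv (w : SobolevZero μ) {ψ : ℝ → ℝ} (hψ : IsTestFunction ψ) :
    ∫ x in Ioo (0 : ℝ) 1, conv K ((Ioo (0 : ℝ) 1).indicator w.fn) x * deriv ψ x =
      -∫ x in Ioo (0 : ℝ) 1, convDeriv hK h0 h1 w x * ψ x := by
  have m1 := memLp_unit_of_continuous (conv_continuous (integrable_refl hK) hψ.deriv)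
  have m2 := memLp_unit_of_continuous hψ.continuous
  rw [setIntegral_conv_indicator_mul hK (((memLp_fn w).restrict _).integrable one_le_two) hψ.deriv,
    ← inner_restrictUnit w m1, ← inner_unit_toLp _ m2]
  refine (denseRange_embTest h0 h1).induction_on
    (p := fun w => inner ℝ (restrictUnit μ w) (m1.toLp _) =
      -inner ℝ (convDeriv hK h0 h1 w) (m2.toLp _)) w
    (isClosed_eq (by fun_prop) (by fun_prop)) fun φ => ?_
  rw [convDeriv_embTest hK h0 h1 hb, inner_restrictUnit, show convTest K hK φ = MemLp.toLp _
    (memLp_unit_of_continuous (conv_continuous hK φ.2.deriv)) from rfl, inner_toLp_unit,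
    ← hψ.integral_mul_deriv (hasDerivAt_conv hK φ.2) (conv_continuous hK φ.2.deriv)]
  have e : (Ioo (0 : ℝ) 1).indicator φ.1 = φ.1 := by
    funext x
    by_cases hx : x ∈ Ioo (0 : ℝ) 1
    · simp [hx]
    · simp [hx, φ.2.eq_zero hx]
  have e2 := setIntegral_conv_indicator_mul hK φ.2.integrable.restrict hψ.deriv
  rw [e] at e2
  rw [e2]
  refine integral_congr_ae ?_
  filter_upwards [ae_restrict_of_ae (fn_embTest h0 h1 φ)] with x hx
  rw [hx]

end convDeriv

theorem memLp_conv_fn {K : ℝ → ℝ} {μ : ℝ} (hK : Integrable K) (w : SobolevZero μ) :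
    MemLp (conv K ((Ioo (0 : ℝ) 1).indicator w.fn)) 2 (volume.restrict (Ioo (0 : ℝ) 1)) :=
  (memLp_conv hK ((integrable_indicator_iff measurableSet_Ioo).2
    (((memLp_fn w).restrict _).integrable one_le_two))
    ((memLp_fn w).indicator measurableSet_Ioo)).restrict _

section frac

variable {β : ℝ} (hβ : 0 < β) (hβ1 : β < 1 / 2)

/-- The weak derivative of the two-sided fractional integral, as a continuous operator. -/
def fracCLM (θ : ℝ) : SobolevZero (1 - β) →L[ℝ] L2Unit :=
  θ • convDeriv (integrable_intervalKernel hβ) (by linarith) (by linarith) +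
    (1 - θ) • convDeriv (integrable_refl (integrable_intervalKernel hβ)) (by linarith)
      (by linarith)

theorem fracCLM_embTest (θ : ℝ) (h0 : 0 ≤ 1 - β) (h1 : 1 - β ≤ 1) (φ : testFunctions) :
    fracCLM hβ hβ1 θ (embTest h0 h1 φ) =
      θ • convTest (intervalKernel β) (integrable_intervalKernel hβ) φ +
        (1 - θ) • convTest (refl (intervalKernel β))
          (integrable_refl (integrable_intervalKernel hβ)) φ := by
  simp only [fracCLM, add_apply, smul_apply]
  rw [convDeriv_embTest _ h0 h1 fun φ hφ => integral_left_sq_le hβ hβ1.le hφ,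
    convDeriv_embTest _ h0 h1 fun φ hφ => integral_right_sq_le hβ hβ1.le hφ]

theorem norm_fracCLM_le {θ : ℝ} (h0 : 0 ≤ θ) (h1 : θ ≤ 1) (w : SobolevZero (1 - β)) :
    ‖fracCLM hβ hβ1 θ w‖ ≤ ‖w‖ := by
  simp only [fracCLM, add_apply, smul_apply]
  refine (norm_add_le _ _).trans ?_
  rw [norm_smul, norm_smul, Real.norm_of_nonneg h0, Real.norm_of_nonneg (sub_nonneg.2 h1)]
  have a := norm_convDeriv_le (integrable_intervalKernel hβ) (by linarith) (by linarith)
    (fun φ hφ => integral_left_sq_le hβ hβ1.le hφ) w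
  have b := norm_convDeriv_le (integrable_refl (integrable_intervalKernel hβ)) (by linarith)
    (by linarith) (fun φ hφ => integral_right_sq_le hβ hβ1.le hφ) w
  have := mul_le_mul_of_nonneg_left a h0
  have := mul_le_mul_of_nonneg_left b (sub_nonneg.2 h1)
  linarith

theorem twoSidedFracInt_ae (θ : ℝ) (f : ℝ → ℝ) :
    twoSidedFracInt β θ f =ᵐ[volume.restrict (Ioo (0 : ℝ) 1)]
      θ • conv (intervalKernel β) ((Ioo (0 : ℝ) 1).indicator f) +
        (1 - θ) • conv (refl (intervalKernel β)) ((Ioo (0 : ℝ) 1).indicator f) := by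
  filter_upwards [ae_restrict_mem measurableSet_Ioo] with x hx
  simp [twoSidedFracInt, leftFracInt_eq_conv f hx, rightFracInt_eq_conv f hx]

include hβ in
theorem memLp_twoSidedFracInt (θ : ℝ) (w : SobolevZero (1 - β)) :
    MemLp (twoSidedFracInt β θ w.fn) 2 (volume.restrict (Ioo (0 : ℝ) 1)) :=
  (memLp_congr_ae (twoSidedFracInt_ae θ w.fn)).2
    (((memLp_conv_fn (integrable_intervalKernel hβ) w).const_smul θ).add
      ((memLp_conv_fn (integrable_refl (integrable_intervalKernel hβ)) w).const_smul (1 - θ)))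

theorem hasWeakDeriv_fracCLM (θ : ℝ) (w : SobolevZero (1 - β)) :
    HasWeakDeriv (twoSidedFracInt β θ w.fn) (fracCLM hβ hβ1 θ w) := by
  refine ⟨locallyIntegrableOn_of_memLp (memLp_twoSidedFracInt hβ θ w),
    locallyIntegrableOn_of_memLp (Lp.memLp _), fun ψ hψ => ?_⟩
  have hK := integrable_intervalKernel hβ
  have a := integral_conv_mul_deriv hK (by linarith) (by linarith)
    (fun φ hφ => integral_left_sq_le hβ hβ1.le hφ) w hψ
  have b := integral_conv_mul_deriv (integrable_refl hK) (by linarith)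
    (by linarith) (fun φ hφ => integral_right_sq_le hβ hβ1.le hφ) w hψ
  have hi : ∀ {f g : ℝ → ℝ}, MemLp f 2 (volume.restrict (Ioo (0 : ℝ) 1)) → IsTestFunction g →
      Integrable (fun x => f x * g x) (volume.restrict (Ioo (0 : ℝ) 1)) := fun hf hg =>
    hf.integrable_mul (memLp_unit_of_continuous hg.continuous)
  have m1 := memLp_conv_fn hK w
  have m2 := memLp_conv_fn (integrable_refl hK) w
  have m3 := Lp.memLp (convDeriv hK (by linarith) (by linarith) w)
  have m4 := Lp.memLp (convDeriv (integrable_refl hK) (by linarith) (by linarith) w)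
  have e1 : ∫ x in Ioo (0 : ℝ) 1, twoSidedFracInt β θ w.fn x * deriv ψ x =
      ∫ x in Ioo (0 : ℝ) 1, (θ * (conv (intervalKernel β) ((Ioo (0 : ℝ) 1).indicator w.fn) x *
        deriv ψ x) + (1 - θ) * (conv (refl (intervalKernel β))
          ((Ioo (0 : ℝ) 1).indicator w.fn) x * deriv ψ x)) := by
    refine integral_congr_ae ?_
    filter_upwards [twoSidedFracInt_ae (β := β) θ w.fn] with x hx
    simp only [hx, Pi.add_apply, Pi.smul_apply, smul_eq_mul]
    ring
  have e2 : ∫ x in Ioo (0 : ℝ) 1, fracCLM hβ hβ1 θ w x * ψ x =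
      ∫ x in Ioo (0 : ℝ) 1, (θ * (convDeriv hK (by linarith) (by linarith) w x * ψ x) +
        (1 - θ) * (convDeriv (integrable_refl hK) (by linarith) (by linarith) w x * ψ x)) := by
    refine integral_congr_ae ?_
    simp only [fracCLM, add_apply, smul_apply]
    filter_upwards [Lp.coeFn_add (θ • convDeriv hK (by linarith) (by linarith) w)
      ((1 - θ) • convDeriv (integrable_refl hK) (by linarith) (by linarith) w),
      Lp.coeFn_smul θ (convDeriv hK (by linarith) (by linarith) w),
      Lp.coeFn_smul (1 - θ) (convDeriv (integrable_refl hK) (by linarith) (by linarith) w)]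
      with x h1 h2 h3
    simp only [h1, h2, h3, Pi.add_apply, Pi.smul_apply, smul_eq_mul]
    ring
  rw [e1, e2, integral_add ((hi m1 hψ.deriv).const_mul θ) ((hi m2 hψ.deriv).const_mul (1 - θ)),
    integral_add ((hi m3 hψ).const_mul θ) ((hi m4 hψ).const_mul (1 - θ))]
  simp only [integral_const_mul]
  rw [a, b]
  ring

include hβ hβ1 in
theorem memSobolevOne_twoSidedFracInt (θ : ℝ) (w : SobolevZero (1 - β)) :
    MemSobolevOne (twoSidedFracInt β θ w.fn) :=
  ⟨memLp_twoSidedFracInt hβ θ w, _, hasWeakDeriv_fracCLM hβ hβ1 θ w, Lp.memLp _⟩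

/-- From here on the form is an inner product of two bounded operators, and the remaining arguments
take place in Hilbert space. -/
theorem pgForm_eq_inner (θ : ℝ) (w : SobolevZero (1 - β)) (v : SobolevZero 1) :
    pgForm β θ w v = inner ℝ (fracCLM hβ hβ1 θ w) (derivCLM v) := by
  rw [pgForm, L2.inner_def]
  refine integral_congr_ae ?_
  filter_upwards [(hasWeakDeriv_fracCLM hβ hβ1 θ w).weakDeriv_ae,
    (hasWeakDeriv_derivCLM v).weakDeriv_ae] with x h1 h2
  rw [h1, h2]
  simp [mul_comm]

/-- The Petrov-Galerkin form as a bilinear map. -/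
def pgBilin (θ : ℝ) :
    SobolevZero (1 - β) →ₗ[ℝ] SobolevZero 1 →ₗ[ℝ] ℝ :=
  (innerₗ L2Unit).compl₁₂ (fracCLM hβ hβ1 θ).toLinearMap derivCLM.toLinearMap

theorem pgBilin_apply (θ : ℝ) (w : SobolevZero (1 - β)) (v : SobolevZero 1) :
    pgBilin hβ hβ1 θ w v = pgForm β θ w v :=
  (pgForm_eq_inner hβ hβ1 θ w v).symm

include hβ hβ1 in
theorem abs_pgForm_le {θ : ℝ} (h0 : 0 ≤ θ) (h1 : θ ≤ 1) (w : SobolevZero (1 - β))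
    (v : SobolevZero 1) : |pgForm β θ w v| ≤ ‖w‖ * ‖v‖ := by
  rw [pgForm_eq_inner hβ hβ1]
  exact (abs_real_inner_le_norm _ _).trans (mul_le_mul (norm_fracCLM_le hβ hβ1 h0 h1 w)
    (norm_derivCLM_le v) (norm_nonneg _) (norm_nonneg _))

end frac

/-! ### The lemma of du Bois-Reymond -/

theorem IsTestFunction.exists_primitive {χ : ℝ → ℝ} (hχ : IsTestFunction χ) (h : ∫ x, χ x = 0) :
    ∃ φ, IsTestFunction φ ∧ _root_.deriv φ = χ := by
  -- The point `1/2` makes the compact set nonempty even for `χ = 0`, so that it has a least and a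
  -- greatest element.
  have hs : IsCompact (insert (1 / 2 : ℝ) (tsupport χ)) := hχ.hasCompactSupport.insert _
  have hsub : insert (1 / 2 : ℝ) (tsupport χ) ⊆ Ioo 0 1 :=
    insert_subset (by norm_num) hχ.tsupport_subset
  obtain ⟨a, ha⟩ := hs.exists_isLeast (insert_nonempty _ _)
  obtain ⟨b, hb⟩ := hs.exists_isGreatest (insert_nonempty _ _)
  have ha0 := (hsub ha.1).1
  have hb1 := (hsub hb.1).2
  have hz : ∀ x, x ∉ Icc a b → χ x = 0 := fun x hx => image_eq_zero_of_notMem_tsupport fun hx' =>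
    hx ⟨ha.2 (mem_insert_of_mem _ hx'), hb.2 (mem_insert_of_mem _ hx')⟩
  set φ : ℝ → ℝ := fun x => ∫ t in (0 : ℝ)..x, χ t
  have hd : ∀ x, HasDerivAt φ (χ x) x := fun x =>
    intervalIntegral.integral_hasDerivAt_right (hχ.continuous.intervalIntegrable _ _)
      (hχ.continuous.stronglyMeasurableAtFilter _ _) hχ.continuous.continuousAt
  have hderiv : _root_.deriv φ = χ := funext fun x => (hd x).deriv
  have hφz : ∀ x, x ∉ Icc a b → φ x = 0 := by
    intro x hx
    rcases lt_or_ge x a with hxa | hxa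
    · refine (intervalIntegral.integral_congr fun t ht => hz t fun ht' => ?_).trans
        (intervalIntegral.integral_zero (a := (0 : ℝ)) (b := x))
      have := ht.2
      exact absurd ht'.1 (not_le.2 (this.trans_lt (max_lt ha0 hxa)))
    · have hxb : b < x := not_le.1 fun hxb => hx ⟨hxa, hxb⟩
      refine (intervalIntegral.integral_eq_integral_of_support_subset fun t ht => ?_).trans h
      by_contra ht'
      refine ht (hz t fun h3 => ht' ⟨ha0.trans_le h3.1, h3.2.trans hxb.le⟩)
  have hsupp : tsupport φ ⊆ Icc a b :=
    closure_minimal (fun x hx => not_not.1 fun hx' => hx (hφz x hx')) isClosed_Icc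
  refine ⟨φ, ⟨contDiff_infty_iff_deriv.2 ⟨fun x => (hd x).differentiableAt, hderiv ▸ hχ.smooth⟩,
    HasCompactSupport.of_support_subset_isCompact isCompact_Icc (subset_closure.trans hsupp),
    hsupp.trans fun x hx => ⟨ha0.trans_le hx.1, hx.2.trans_lt hb1⟩⟩, hderiv⟩

theorem exists_isTestFunction_integral_eq_one : ∃ η, IsTestFunction η ∧ ∫ x, η x = 1 := by
  let f : ContDiffBump (1 / 2 : ℝ) := ⟨1 / 8, 1 / 4, by norm_num, by norm_num⟩
  refine ⟨f.normed volume, ⟨f.contDiff_normed, f.hasCompactSupport_normed, ?_⟩, f.integral_normed⟩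
  rw [f.tsupport_normed_eq, Real.closedBall_eq_Icc]
  intro x hx
  simp only [f, mem_Icc, mem_Ioo] at hx ⊢
  constructor <;> linarith [hx.1, hx.2]

/-- The lemma of du Bois-Reymond: the orthogonal complement of the derivatives of test functions
consists of the constants. -/
theorem exists_eq_smul_oneUnit {r : L2Unit} (h : ∀ φ, inner ℝ r (derivTest φ) = 0) :
    ∃ c : ℝ, r = c • oneUnit := by
  obtain ⟨η, hη, hη1⟩ := exists_isTestFunction_integral_eq_one
  have hmem : ∀ {ψ : ℝ → ℝ}, IsTestFunction ψ → MemLp ψ 2 (volume.restrict (Ioo (0 : ℝ) 1)) :=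
    fun hψ => memLp_unit_of_continuous hψ.continuous
  have hi : ∀ {ψ : ℝ → ℝ}, IsTestFunction ψ →
      Integrable (fun x => r x * ψ x) (volume.restrict (Ioo (0 : ℝ) 1)) :=
    fun hψ => (Lp.memLp r).integrable_mul (hmem hψ)
  refine ⟨∫ x in Ioo (0 : ℝ) 1, r x * η x, ?_⟩
  set c := ∫ x in Ioo (0 : ℝ) 1, r x * η x
  have key : ∀ ψ, IsTestFunction ψ → ∫ x in Ioo (0 : ℝ) 1, r x * ψ x = c * ∫ x, ψ x := by
    intro ψ hψ
    -- Removing the mean by a multiple of `η` leaves the derivative of a test function, to which `r`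
    -- is orthogonal.
    have hχ : IsTestFunction (ψ + (-∫ x, ψ x) • η) := hψ.add (hη.smul _)
    obtain ⟨φ, hφ, hd⟩ := hχ.exists_primitive (by
      simp only [Pi.add_apply, Pi.smul_apply, smul_eq_mul]
      rw [integral_add hψ.integrable (hη.integrable.const_mul _), integral_const_mul, hη1]
      ring)
    have h1 := h ⟨φ, hφ⟩
    rw [show derivTest ⟨φ, hφ⟩ = MemLp.toLp (deriv φ) (hmem hφ.deriv) from rfl,
      inner_unit_toLp, hd] at h1
    have h2 : ∀ x, r x * (ψ + (-∫ x, ψ x) • η) x = r x * ψ x + (-∫ x, ψ x) * (r x * η x) := by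
      intro x; simp only [Pi.add_apply, Pi.smul_apply, smul_eq_mul]; ring
    simp only [h2] at h1
    rw [integral_add (hi hψ) ((hi hη).const_mul _), integral_const_mul] at h1
    linarith
  have h0 := isOpen_Ioo.ae_eq_zero_of_integral_contDiff_smul_eq_zero (U := Ioo (0 : ℝ) 1)
    (f := fun x => r x - c) (μ := volume)
    ((locallyIntegrableOn_of_memLp (Lp.memLp r)).sub (continuous_const.locallyIntegrable.locallyIntegrableOn _))
    fun ψ h1 h2 h3 => by
      have hψ : IsTestFunction ψ := ⟨h1, h2, h3⟩
      rw [← setIntegral_eq_integral_of_forall_compl_eq_zero (s := Ioo (0 : ℝ) 1)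
        fun x hx => by simp [hψ.eq_zero hx]]
      have e : ∀ x, ψ x • (r x - c) = r x * ψ x - c * ψ x := fun x => by
        rw [smul_eq_mul]; ring
      simp only [e]
      rw [integral_sub (hi hψ) (hψ.integrable.restrict.const_mul c), key ψ hψ, integral_const_mul,
        setIntegral_eq_integral_of_forall_compl_eq_zero fun x hx => hψ.eq_zero hx, sub_self]
  refine Lp.ext ?_
  rw [← ae_restrict_iff' measurableSet_Ioo] at h0
  filter_upwards [h0, Lp.coeFn_smul c oneUnit,
    (memLp_unit_of_continuous continuous_const).coeFn_toLp (f := fun _ : ℝ => (1 : ℝ))]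
    with x h1 h2 h3
  rw [h2, Pi.smul_apply, oneUnit, h3, smul_eq_mul, mul_one]
  linarith

/-! ### Inf-sup conditions and solvability in Hilbert space -/

section abstractInfSup

variable {X V Y : Type*} [NormedAddCommGroup X] [NormedSpace ℝ X]
  [NormedAddCommGroup V] [NormedSpace ℝ V] [CompleteSpace V]
  [NormedAddCommGroup Y] [InnerProductSpace ℝ Y] [CompleteSpace Y]

theorem isClosed_range_of_bound {W Z : Type*} [NormedAddCommGroup W] [NormedSpace ℝ W]
    [CompleteSpace W] [NormedAddCommGroup Z] [NormedSpace ℝ Z] {T : W →L[ℝ] Z} {d : ℝ}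
    (hT : ∀ v, ‖v‖ ≤ d * ‖T v‖) : IsClosed (range T) :=
  (AddMonoidHomClass.antilipschitz_of_bound T (K := d.toNNReal) fun v => (hT v).trans
    (mul_le_mul_of_nonneg_right (le_coe_toNNReal d) (norm_nonneg _))).isClosed_range
      T.uniformContinuous

theorem completeSpace_range_of_bound {T : V →L[ℝ] Y} {d : ℝ} (hT : ∀ v, ‖v‖ ≤ d * ‖T v‖) :
    CompleteSpace T.range := by
  have h : IsClosed (T.range : Set Y) := by
    rw [LinearMap.coe_range]
    exact isClosed_range_of_bound hT
  exact h.completeSpace_coe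

variable {G : X →L[ℝ] Y} {D : V →L[ℝ] Y} {c d : ℝ}

/-- Inf-sup estimate for the form `(w, v) ↦ ⟪G w, D v⟫`, if `G` stays away from the orthogonal
complement of the range of `D`. -/
theorem exists_le_inner (hd : 0 < d) (hD : ∀ v, ‖v‖ ≤ d * ‖D v‖) (hc : 0 < c)
    (hG : ∀ w y, (∀ v, inner ℝ y (D v) = 0) → c * ‖w‖ ≤ ‖G w - y‖) (w : X) :
    ∃ v, (w ≠ 0 → v ≠ 0) ∧ c / d * ‖w‖ * ‖v‖ ≤ inner ℝ (G w) (D v) := by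
  have := completeSpace_range_of_bound hD
  -- The optimal test vector: `D v` is the projection of `G w` onto the range of `D`. The residual
  -- is orthogonal to that range, so the distance hypothesis bounds `‖D v‖` from below.
  obtain ⟨v, hv⟩ : ∃ v, D v = D.range.starProjection (G w) :=
    D.range.starProjection_apply_mem (G w)
  have horth : ∀ v', inner ℝ (G w - D v) (D v') = 0 := fun v' => by
    rw [hv]
    exact D.range.starProjection_inner_eq_zero _ _ ⟨v', rfl⟩
  have hle : c * ‖w‖ ≤ ‖D v‖ := by simpa using hG w _ horth
  refine ⟨v, fun hw hv0 => ?_, ?_⟩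
  · rw [hv0, map_zero, norm_zero] at hle
    exact absurd hle (not_le.2 (mul_pos hc (norm_pos_iff.2 hw)))
  · have h1 := horth v
    rw [inner_sub_left, sub_eq_zero, real_inner_self_eq_norm_sq] at h1
    rw [h1, sq]
    have h2 := mul_le_mul hle (hD v) (norm_nonneg _) (norm_nonneg _)
    have e : c / d * ‖w‖ * ‖v‖ = c * ‖w‖ * ‖v‖ / d := by ring
    rw [e, div_le_iff₀ hd]
    linarith

/-- The Babuška-Lax-Milgram theorem for the form `(w, v) ↦ ⟪G w, D v⟫`. -/
theorem exists_forall_inner_eq [CompleteSpace X] (hD : ∀ v, ‖v‖ ≤ d * ‖D v‖) (hc : 0 < c)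
    (hG : ∀ w y, (∀ v, inner ℝ y (D v) = 0) → c * ‖w‖ ≤ ‖G w - y‖)
    (hinj : ∀ v, (∀ w, inner ℝ (G w) (D v) = 0) → v = 0) (f : StrongDual ℝ V) :
    ∃ u, ∀ v, inner ℝ (G u) (D v) = f v := by
  have := completeSpace_range_of_bound hD
  have hDinj : Function.Injective D := (injective_iff_map_eq_zero D).2 fun v hv => by
    have h := hD v
    rw [hv, norm_zero, mul_zero] at h
    exact norm_le_zero_iff.1 h
  let E := D.equivRange hDinj (isClosed_range_of_bound hD)
  have hE : ∀ v, ((E v : D.range) : Y) = D v := fun v => rfl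
  -- The Riesz representative of `f` transported to the range of `D`; the equation becomes `T u = m`
  -- for the projection `T` of `G`.
  let m := (InnerProductSpace.toDual ℝ D.range).symm (f.comp E.symm.toContinuousLinearMap)
  have hm : ∀ v, inner ℝ (m : Y) (D v) = f v := fun v => by
    have h := InnerProductSpace.toDual_symm_apply (x := E v)
      (y := f.comp E.symm.toContinuousLinearMap)
    rw [Submodule.coe_inner] at h
    simpa [hE] using h
  let T : X →L[ℝ] D.range := D.range.orthogonalProjectionOnto.comp G
  have hT : ∀ w v, inner ℝ (T w : Y) (D v) = inner ℝ (G w) (D v) := fun w v => by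
    have h := D.range.starProjection_inner_eq_zero (G w) (D v) ⟨v, rfl⟩
    rw [inner_sub_left, sub_eq_zero] at h
    exact h.symm
  have hTb : ∀ w, ‖w‖ ≤ c⁻¹ * ‖T w‖ := fun w => by
    have h := hG w (G w - T w) fun v => by rw [inner_sub_left, hT, sub_self]
    rw [sub_sub_cancel] at h
    rw [← div_eq_inv_mul, le_div_iff₀ hc, mul_comm]
    exact h
  have := completeSpace_range_of_bound hTb
  -- The range of `T` is closed by the lower bound `hTb` and has trivial orthogonal complement by
  -- `hinj`.
  have htop : T.range = ⊤ := by
    refine (Submodule.orthogonal_eq_bot_iff (K := T.range)).1 ((Submodule.eq_bot_iff _).2 ?_)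
    rintro ⟨_, v, rfl⟩ hy
    have hv : v = 0 := hinj v fun w => by
      rw [← hT]
      exact hy _ ⟨w, rfl⟩
    ext
    simp [hv]
  obtain ⟨u, hu⟩ : m ∈ T.range := htop ▸ Submodule.mem_top
  refine ⟨u, fun v => ?_⟩
  rw [← hT, ← hm]
  exact congrArg (fun y : D.range => inner ℝ (y : Y) (D v)) hu

end abstractInfSup

/-! ### Weak coercivity on the Sobolev spaces -/

theorem norm_sq_embTest_le {μ : ℝ} (h0 : 0 ≤ μ) (h1 : μ ≤ 1) (φ : testFunctions) :
    ‖embTest h0 h1 φ‖ ^ 2 ≤ 2 * ‖embTest zero_le_one le_rfl φ‖ ^ 2 := by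
  rw [norm_sq_embTest, norm_sq_embTest]
  have h : seminormSq μ φ.1 ≤ (∫ x, φ.1 x ^ 2) + seminormSq 1 φ.1 := by
    have hi := φ.2.integrable_seminorm zero_le_one le_rfl
    rw [φ.2.integral_sq, seminormSq, seminormSq, ← integral_add φ.2.integrable_norm_sq hi]
    refine integral_mono (φ.2.integrable_seminorm h0 h1) (φ.2.integrable_norm_sq.add hi)
      fun ξ => ?_
    have := mul_le_mul_of_nonneg_right (abs_rpow_le_one_add_sq h0 h1 (2 * π * ξ))
      (sq_nonneg ‖fhat φ.1 ξ‖)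
    simp only [mul_one, rpow_two]
    linarith
  have := seminormSq_nonneg 1 φ.1
  have : 0 ≤ ∫ x, φ.1 x ^ 2 := integral_nonneg fun _ => sq_nonneg _
  linarith

section

variable {β : ℝ} (hβ : 0 < β) (hβ1 : β < 1 / 2) {θ : ℝ} (h0 : 0 ≤ θ) (h1 : θ ≤ 1)

include h0 h1

theorem infSup_fracCLM (w : SobolevZero (1 - β)) (c : ℝ) :
    infSupConst β / 2 * ‖w‖ ≤ ‖fracCLM hβ hβ1 θ w - c • oneUnit‖ := by
  have hμ0 : 0 ≤ 1 - β := by linarith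
  have hμ1 : 1 - β ≤ 1 := by linarith
  refine (denseRange_embTest hμ0 hμ1).induction_on
    (p := fun w => infSupConst β / 2 * ‖w‖ ≤ ‖fracCLM hβ hβ1 θ w - c • oneUnit‖) w
    (isClosed_le (by fun_prop) (by fun_prop)) fun φ => ?_
  rw [fracCLM_embTest]
  refine le_trans ?_ (infSup_test hβ hβ1 h0 h1 φ c)
  rw [div_mul_eq_mul_div, mul_div_assoc]
  refine mul_le_mul_of_nonneg_left ?_ (infSupConst_pos hβ hβ1).le
  refine Real.le_sqrt_of_sq_le ?_
  -- The loss of a factor `2` in passing from the seminorm to the norm again comes from `3 ≤ 2²`.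
  have := norm_sq_le_seminormSq hμ0 hμ1 φ
  have := seminormSq_nonneg (1 - β) φ.1
  rw [div_pow]
  linarith

theorem infSup_fracCLM_of_orthogonal (w : SobolevZero (1 - β)) (y : L2Unit)
    (hy : ∀ v, inner ℝ y (derivCLM v) = 0) :
    infSupConst β / 2 * ‖w‖ ≤ ‖fracCLM hβ hβ1 θ w - y‖ := by
  obtain ⟨c, rfl⟩ := exists_eq_smul_oneUnit (r := y) fun φ => by
    rw [← derivCLM_embTest]
    exact hy _
  exact infSup_fracCLM hβ hβ1 h0 h1 w c

/-- Each one-sided form is coercive in the seminorm of order `1 - β/2`, hence so is their convex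
combination. Only the `L²` bound that this implies is kept, since it is enough to detect zero. -/
theorem le_inner_fracCLM_embTest (hμ0 : 0 ≤ 1 - β) (hμ1 : 1 - β ≤ 1) (φ : testFunctions) :
    cos (π * β / 2) / 2 * ∫ x, φ.1 x ^ 2 ≤
      inner ℝ (fracCLM hβ hβ1 θ (embTest hμ0 hμ1 φ))
        (derivCLM (embTest zero_le_one le_rfl φ)) := by
  have hcos : 0 ≤ cos (π * β / 2) :=
    (cos_pos_of_mem_Ioo ⟨by nlinarith [pi_pos], by nlinarith [pi_pos]⟩).le
  have hsemi := mul_le_mul_of_nonneg_left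
    (φ.2.integral_sq_le (μ := 1 - β / 2) (by linarith) (by linarith)) hcos
  have a := seminormSq_le_integral_left hβ hβ1.le φ.2
  have b := seminormSq_le_integral_right hβ hβ1.le φ.2
  have e : ∀ {K : ℝ → ℝ} (hK : Integrable K), inner ℝ (convTest K hK φ) (derivTest φ) =
      ∫ x in Ioo (0 : ℝ) 1, deriv φ.1 x * conv K (deriv φ.1) x := fun hK => by
    rw [real_inner_comm]
    exact inner_toLp_unit (memLp_unit_of_continuous φ.2.deriv.continuous)
      (memLp_unit_of_continuous (conv_continuous hK φ.2.deriv))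
  rw [fracCLM_embTest, derivCLM_embTest, inner_add_left, real_inner_smul_left,
    real_inner_smul_left, e, e]
  have := mul_le_mul_of_nonneg_left a h0
  have := mul_le_mul_of_nonneg_left b (sub_nonneg.2 h1)
  linarith

/-- The vector `v` itself is approximated by test functions `φ`, each used also as a trial function.
By the sign hypothesis `A(φ,φ) ≤ A(φ, φ - v)`, so the `L²` norm of `φ` is controlled by the distance
from `φ` to `v`. -/
theorem eq_zero_of_forall_pgForm_nonpos (v : SobolevZero 1)
    (hv : ∀ w, inner ℝ (fracCLM hβ hβ1 θ w) (derivCLM v) ≤ 0) : v = 0 := by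
  have hμ0 : 0 ≤ 1 - β := by linarith
  have hμ1 : 1 - β ≤ 1 := by linarith
  have hcos : 0 < cos (π * β / 2) :=
    cos_pos_of_mem_Ioo ⟨by nlinarith [pi_pos], by nlinarith [pi_pos]⟩
  let J : SobolevZero 1 →L[ℝ] Lp ℝ 2 (volume : Measure ℝ) :=
    SobolevR.toL2CLM.comp (testSubmodule 1).topologicalClosure.subtypeL
  -- Both sides are continuous in the `H^1` norm, so the bound passes from test functions to all
  -- `x`, and in particular to `x = v`, where the right side is zero.
  have key : ∀ x, cos (π * β / 2) / 2 * ‖J x‖ ^ 2 ≤ 2 * ‖x‖ * ‖x - v‖ := fun x => by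
    refine (denseRange_embTest zero_le_one le_rfl).induction_on
      (p := fun x => cos (π * β / 2) / 2 * ‖J x‖ ^ 2 ≤ 2 * ‖x‖ * ‖x - v‖) x
      (isClosed_le (by fun_prop) (by fun_prop)) fun φ => ?_
    set x := embTest zero_le_one le_rfl φ
    set w := embTest hμ0 hμ1 φ
    have hJ : ‖J x‖ ^ 2 = ∫ x, φ.1 x ^ 2 := by
      have : J x = φ.2.memLp_two.toLp φ.1 := rfl
      rw [this, norm_sq_toLp]
      simp only [Real.norm_eq_abs, sq_abs]
    have hw : ‖w‖ ≤ 2 * ‖x‖ := le_of_sq_le_sq (by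
      have := norm_sq_embTest_le hμ0 hμ1 φ
      nlinarith [sq_nonneg ‖x‖]) (by positivity)
    have h2 : inner ℝ (fracCLM hβ hβ1 θ w) (derivCLM x) ≤
        inner ℝ (fracCLM hβ hβ1 θ w) (derivCLM (x - v)) := by
      rw [map_sub, inner_sub_right]
      linarith [hv w]
    rw [hJ]
    refine (le_inner_fracCLM_embTest hβ hβ1 h0 h1 hμ0 hμ1 φ).trans (h2.trans ?_)
    refine (real_inner_le_norm _ _).trans (mul_le_mul ?_ (norm_derivCLM_le _) (norm_nonneg _)
      (by positivity))
    exact (norm_fracCLM_le hβ hβ1 h0 h1 w).trans hw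
  have h := key v
  rw [sub_self, norm_zero, mul_zero] at h
  have h3 : ‖J v‖ ^ 2 ≤ 0 := by
    by_contra h4
    exact absurd h (not_le.2 (mul_pos (half_pos hcos) (not_le.1 h4)))
  have h4 : J v = 0 := norm_eq_zero.1 (pow_eq_zero_iff two_ne_zero |>.1
    (le_antisymm h3 (sq_nonneg _)))
  exact Subtype.ext (SobolevR.toL2_injective (h4.trans (map_zero _).symm))

end

end FracPG

end

theorem theorem5p1 (β : ℝ) (hβ0 : 0 < β) (hβ : β < 1 / 2) :
    ∃ κ C : ℝ, 0 < κ ∧ ∀ θ : ℝ, 0 ≤ θ → θ ≤ 1 →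
      -- the functions entering the form lie in `H^1(0,1)`, so that the form is well defined
      (∀ w : FracPG.SobolevZero (1 - β),
        FracPG.MemSobolevOne (FracPG.twoSidedFracInt β θ w.fn)) ∧
      (∀ v : FracPG.SobolevZero 1, FracPG.MemSobolevOne v.fn) ∧
      -- the form is bilinear and bounded
      (∃ A : FracPG.SobolevZero (1 - β) →ₗ[ℝ] FracPG.SobolevZero 1 →ₗ[ℝ] ℝ,
        (∀ w v, A w v = FracPG.pgForm β θ w v) ∧
        ∀ w v, |A w v| ≤ C * ‖w‖ * ‖v‖) ∧
      -- weak coercivity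
      ((κ : EReal) ≤ ⨅ w : {w : FracPG.SobolevZero (1 - β) // w ≠ 0},
        ⨆ v : {v : FracPG.SobolevZero 1 // v ≠ 0},
          ((FracPG.pgForm β θ w v / (‖(w : FracPG.SobolevZero (1 - β))‖ *
            ‖(v : FracPG.SobolevZero 1)‖) : ℝ) : EReal)) ∧
      (∀ v : FracPG.SobolevZero 1, v ≠ 0 →
        (0 : EReal) < ⨆ w : FracPG.SobolevZero (1 - β), (FracPG.pgForm β θ w v : EReal)) ∧
      -- well-posedness
      ∀ f : FracPG.SobolevMinusOne,
        (∃! u : FracPG.SobolevZero (1 - β), FracPG.IsPGSolution β θ f u) ∧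
        ∀ u : FracPG.SobolevZero (1 - β), FracPG.IsPGSolution β θ f u →
          ‖u‖ ≤ 1 / κ * ‖f‖ := by
  have hκ := FracPG.infSupConst_pos hβ0 hβ
  -- One factor `1/2` comes from replacing the seminorm by the norm, the other from the constant `2`
  -- in the Poincaré inequality. The form is bounded with constant `1` because both operators are
  -- contractions.
  refine ⟨FracPG.infSupConst β / 2 / 2, 1, by positivity, fun θ h0 h1 => ?_⟩
  have hG := FracPG.infSup_fracCLM_of_orthogonal hβ0 hβ h0 h1
  have hsup := FracPG.exists_le_inner two_pos FracPG.norm_le_norm_derivCLM (half_pos hκ) hG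
  simp only [← FracPG.pgForm_eq_inner] at hsup
  have hbound : ∀ (f : FracPG.SobolevMinusOne) (u : FracPG.SobolevZero (1 - β)),
      FracPG.IsPGSolution β θ f u → ‖u‖ ≤ 1 / (FracPG.infSupConst β / 2 / 2) * ‖f‖ := by
    intro f u hu
    obtain ⟨v, hv0, hv⟩ := hsup u
    by_cases hu0 : u = 0
    · rw [hu0, norm_zero]
      positivity
    have hvpos := norm_pos_iff.2 (hv0 hu0)
    rw [hu v] at hv
    have h := le_of_mul_le_mul_right (hv.trans ((le_abs_self _).trans (f.le_opNorm v))) hvpos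
    rw [one_div, ← div_eq_inv_mul, le_div_iff₀ (by positivity), mul_comm]
    exact h
  refine ⟨FracPG.memSobolevOne_twoSidedFracInt hβ0 hβ θ, FracPG.memSobolevOne_fn,
    ⟨FracPG.pgBilin hβ0 hβ θ, FracPG.pgBilin_apply hβ0 hβ θ, fun w v => ?_⟩,
    le_iInf fun w => ?_, fun v hv => ?_, fun f => ⟨?_, hbound f⟩⟩
  · rw [FracPG.pgBilin_apply, one_mul]
    exact FracPG.abs_pgForm_le hβ0 hβ h0 h1 w v
  · obtain ⟨v, hv0, hv⟩ := hsup w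
    refine le_iSup_of_le ⟨v, hv0 w.2⟩ (EReal.coe_le_coe_iff.2 ?_)
    rw [le_div_iff₀ (mul_pos (norm_pos_iff.2 w.2) (norm_pos_iff.2 (hv0 w.2))), ← mul_assoc]
    exact hv
  · by_contra h
    refine hv (FracPG.eq_zero_of_forall_pgForm_nonpos hβ0 hβ h0 h1 v fun w => ?_)
    rw [← FracPG.pgForm_eq_inner]
    exact EReal.coe_le_coe_iff.1 ((le_iSup (fun w => (FracPG.pgForm β θ w v : EReal)) w).trans
      (not_lt.1 h))
  · obtain ⟨u, hu⟩ := FracPG.exists_forall_inner_eq FracPG.norm_le_norm_derivCLM (half_pos hκ) hG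
      (fun v hv => FracPG.eq_zero_of_forall_pgForm_nonpos hβ0 hβ h0 h1 v fun w => (hv w).le) f
    refine ⟨u, fun v => by rw [FracPG.pgForm_eq_inner hβ0 hβ, hu], fun u' hu' => ?_⟩
    -- Uniqueness is the stability bound applied to a difference of solutions, which has zero data.
    have hz : FracPG.IsPGSolution β θ 0 (u' - u) := fun v => by
      rw [FracPG.pgForm_eq_inner hβ0 hβ, map_sub, inner_sub_left, hu,
        ← FracPG.pgForm_eq_inner, hu' v, sub_self]
      rfl
    have h := hbound 0 _ hz
    rw [show ‖(0 : FracPG.SobolevMinusOne)‖ = 0 from ContinuousLinearMap.opNorm_zero, mul_zero] at h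
    exact sub_eq_zero.1 (norm_le_zero_iff.1 h)
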